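/- Let $\mathbb F$ be a field of characteristic zero, $n\ge 1$, $m=2n-1$, and let $V(a)$ be the irreducible $\mathfrak{sl}(2)$-module of highest weight $a\ge 0$. Let $\mathfrak h_n$ be the Heisenberg Lie algebra of dimension $2n+1$ with centre $\mathbb F z$, and let $\mathfrak g=\mathfrak{sl}(2)\ltimes\mathfrak h_n$, where $\mathfrak{sl}(2)$ acts on $\mathfrak h_n$ by derivations so that $\mathfrak h_n\simeq V(m)\oplus V(0)$, with $V(0)=\mathbb F z$. All modules are finite dimensional. A $\mathfrak g$-module is uniserial if it has a unique composition series. The socle series is given by $\mathrm{soc}^0(V)=0$ and $\mathrm{soc}^{k+1}(V)/\mathrm{soc}^k(V)=\mathrm{soc}(V/\mathrm{soc}^k(V))$; a socle decomposition $V=V(a_0)\oplus V(a_1)\oplus V(a_2)$ is a decomposition into $\mathfrak{sl}(2)$-submodules such that $\mathrm{soc}^k(V)$ is the sum of the first $k$ summands for $k\le 3$. For suitable $(a_0,a_1)$, $FU_{(a_0,a_1,a_0)}$ denotes the $\mathfrak g$-module, unique up to isomorphism, equal to $V(a_0)\oplus V(a_1)\oplus V(a_0)$ as an $\mathfrak{sl}(2)$-module,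 on which $V(m)\subset\mathfrak h_n$ maps the first summand to $0$, the second to the first and the third to the second by nonzero $\mathfrak{sl}(2)$-homomorphisms $V(m)\otimes V(a_1)\to V(a_0)$ and $V(m)\otimes V(a_0)\to V(a_1)$, and on which $z$ maps the third summand isomorphically onto the first one and annihilates the other two. A faithful uniserial $\mathfrak g$-module is called standard if it is not isomorphic to the module $FU_{(4,3,4)}$ for $n=2$. **Theorem.** Let $V_1=V(a_0)\oplus V(a_1)\oplus V(a_2)$ and $V_2=V(b_0)\oplus V(b_1)\oplus V(b_2)$ be socle decompositions of two standard faithful uniserial $\mathfrak g$-modules, and let $$S_t=\Big(\bigoplus_{i+j=t}V(a_i)\otimes V(b_j)\Big)^{\mathfrak h_n}\subset V_1\otimes V_2 .$$ Then $$\mathrm{soc}(V_1\otimes V_2)=S_0\oplus S_1\oplus S_2,\qquad S_0=\mathrm{soc}(V_1)\otimes\mathrm{soc}(V_2)\simeq\bigoplus_{k=0}^{\min\{a_0,b_0\}}V(a_0+b_0-2k),$$ and, up to isomorphism, $V_1$ and $V_2$ are among the modules listed below, and $S_1$ and $S_2$ are given, as $\mathfrak{sl}(2)$-modules, as follows. *Case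 $n=1$.* Each $V_i$ is isomorphic to $FU_{(c,c+1,c)}$ ($c\ge0$) or $FU_{(c,c-1,c)}$ ($c\ge1$), with $c=a_0$ for $V_1$ and $c=b_0$ for $V_2$. - $V_1\simeq FU_{(a_0,a_0+1,a_0)}$, $V_2\simeq FU_{(b_0,b_0+1,b_0)}$: $S_1\simeq V(a_0+b_0+1)$; $S_2\simeq V(0)$ if $a_0=b_0$, and $S_2=0$ otherwise. - $V_1\simeq FU_{(a_0,a_0+1,a_0)}$, $V_2\simeq FU_{(b_0,b_0-1,b_0)}$: $S_1\simeq V(b_0-a_1)$ if $a_1\le b_0$, and $S_1=0$ otherwise; $S_2=0$. - $V_1\simeq FU_{(a_0,a_0-1,a_0)}$, $V_2\simeq FU_{(b_0,b_0+1,b_0)}$: $S_1\simeq V(a_0-b_1)$ if $b_1\le a_0$, and $S_1=0$ otherwise; $S_2=0$. - $V_1\simeq FU_{(a_0,a_0-1,a_0)}$, $V_2\simeq FU_{(b_0,b_0-1,b_0)}$: $S_1=0$; $S_2\simeq V(0)$ if $a_0=b_0$, and $S_2=0$ otherwise. *Case $n>1$.* Each $V_i$ is isomorphic to $FU_{(c,c+m,c)}$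 with $c\in\{0,1\}$ ($c=a_0$ for $V_1$ and $c=b_0$ for $V_2$) or to $FU_{(1,m-1,1)}$. - $V_1\simeq FU_{(a_0,a_0+m,a_0)}$, $V_2\simeq FU_{(b_0,b_0+m,b_0)}$: $S_1\simeq V(a_0+b_0+m)$; $S_2\simeq V(0)$ if $a_0=b_0$, and $S_2=0$ otherwise. - $V_1\simeq FU_{(a_0,a_0+m,a_0)}$, $V_2\simeq FU_{(1,m-1,1)}$: $S_1\simeq V(m-1)$ if $a_0=0$, and $S_1=0$ otherwise; $S_2=0$. - $V_1\simeq FU_{(1,m-1,1)}$, $V_2\simeq FU_{(b_0,b_0+m,b_0)}$: $S_1\simeq V(m-1)$ if $b_0=0$, and $S_1=0$ otherwise; $S_2=0$. - $V_1\simeq V_2\simeq FU_{(1,m-1,1)}$: $S_1\simeq V(m-2)$ and $S_2\simeq V(0)$. In particular, $S_2\simeq V(0)$ if and only if $V_1\simeq V_2$, and $S_2=0$ otherwise; if $V_1\simeq V_2$, then $\mathrm{soc}(V_1\otimes V_2)$ is not multiplicity free as an $\mathfrak{sl}(2)$-module. -/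

import Mathlib

open scoped TensorProduct DirectSum

namespace UniserialTensor

/-! ### The Lie algebra `sl(2)` and its irreducible modules -/

/-- The Lie algebra `sl(2)` of traceless `2 × 2` matrices, with the standard basis
`e = !![0,1;0,0]`, `h = !![1,0;0,-1]`, `f = !![0,0;1,0]`. -/
abbrev SL2 (F : Type*) [Field F] : Type _ := LieAlgebra.SpecialLinear.sl (Fin 2) F

/-- The space of binary forms `∑ v_i X^(d-1-i) Y^i` of degree `d - 1` (dimension `d`), in
coordinates with respect to the monomials `w_i = X^(d-1-i) Y^i`, `0 ≤ i < d`. -/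
def BinForm (F : Type*) (d : ℕ) : Type _ := Fin d → F

section BinForm

variable {F : Type*} [Field F] {d : ℕ}

instance : AddCommGroup (BinForm F d) := inferInstanceAs (AddCommGroup (Fin d → F))

instance : Module F (BinForm F d) := inferInstanceAs (Module F (Fin d → F))

/-- The `k`-th coordinate of a binary form, extended by zero to all `k`. -/
def BinForm.coord (v : BinForm F d) (k : ℕ) : F := if hk : k < d then v ⟨k, hk⟩ else 0

/-- The action of `sl(2)` on binary forms, with `e = X ∂_Y`, `f = Y ∂_X`, `h = X ∂_X - Y ∂_Y`:
`e w_k = k w_(k-1)`, `h w_k = (d - 1 - 2 k) w_k`, `f w_k = (d - 1 - k) w_(k+1)`. -/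
def slAct (A : SL2 F) (v : BinForm F d) : BinForm F d := fun i =>
  A.1 0 0 * ((d : F) - 1 - 2 * ((i : ℕ) : F)) * v.coord i
    + A.1 0 1 * (((i : ℕ) : F) + 1) * v.coord (i + 1)
    + A.1 1 0 * (if (i : ℕ) = 0 then 0 else ((d : F) - ((i : ℕ) : F)) * v.coord (i - 1))

theorem BinForm.ext_coord {u v : BinForm F d} (h : ∀ k, u.coord k = v.coord k) : u = v := by
  funext i
  have := h i
  simpa [BinForm.coord] using this

theorem BinForm.coord_add (u v : BinForm F d) (k : ℕ) :
    (u + v).coord k = u.coord k + v.coord k := by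
  unfold BinForm.coord
  split_ifs
  · rfl
  · simp

theorem BinForm.coord_smul (c : F) (v : BinForm F d) (k : ℕ) :
    (c • v).coord k = c * v.coord k := by
  unfold BinForm.coord
  split_ifs
  · rfl
  · simp

theorem BinForm.coord_of_le (v : BinForm F d) {k : ℕ} (hk : d ≤ k) : v.coord k = 0 := by
  simp [BinForm.coord, hk]

theorem coord_slAct (A : SL2 F) (v : BinForm F d) (k : ℕ) :
    (slAct A v).coord k =
      A.1 0 0 * ((d : F) - 1 - 2 * (k : F)) * v.coord k
        + A.1 0 1 * ((k : F) + 1) * v.coord (k + 1)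
        + A.1 1 0 * (if k = 0 then 0 else ((d : F) - (k : F)) * v.coord (k - 1)) := by
  by_cases hk : k < d
  · conv_lhs => rw [BinForm.coord]
    rw [dif_pos hk]
    rfl
  · have hk' : d ≤ k := not_lt.mp hk
    rw [BinForm.coord_of_le _ hk', BinForm.coord_of_le _ hk',
      BinForm.coord_of_le _ (by omega : d ≤ k + 1)]
    by_cases h0 : k = 0
    · simp [h0]
    · rcases hk'.eq_or_lt with h | h
      · simp [h]
      · rw [BinForm.coord_of_le v (by omega : d ≤ k - 1)]
        simp

theorem sl_apply_one_one (A : SL2 F) : A.1 1 1 = -A.1 0 0 := by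
  have h : Matrix.trace A.1 = 0 := LinearMap.mem_ker.mp A.2
  rw [Matrix.trace_fin_two] at h
  linear_combination h

theorem slAct_lie (A B : SL2 F) (v : BinForm F d) :
    slAct ⁅A, B⁆ v = slAct A (slAct B v) - slAct B (slAct A v) := by
  rw [eq_sub_iff_add_eq]
  apply BinForm.ext_coord
  intro k
  have h00 : (⁅A, B⁆ : SL2 F).1 0 0 = A.1 0 1 * B.1 1 0 - B.1 0 1 * A.1 1 0 := by
    rw [LieAlgebra.SpecialLinear.sl_bracket]
    simp [Matrix.mul_apply]
    ring
  have h01 : (⁅A, B⁆ : SL2 F).1 0 1 = 2 * (A.1 0 0 * B.1 0 1 - B.1 0 0 * A.1 0 1) := by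
    rw [LieAlgebra.SpecialLinear.sl_bracket]
    simp [Matrix.mul_apply, sl_apply_one_one]
    ring
  have h10 : (⁅A, B⁆ : SL2 F).1 1 0 = 2 * (A.1 1 0 * B.1 0 0 - B.1 1 0 * A.1 0 0) := by
    rw [LieAlgebra.SpecialLinear.sl_bracket]
    simp [Matrix.mul_apply, sl_apply_one_one]
    ring
  rw [BinForm.coord_add]
  simp only [coord_slAct, h00, h01, h10]
  rcases k with _ | _ | k
  · simp; ring
  · simp; ring
  · simp; ring

instance : LieRingModule (SL2 F) (BinForm F d) where
  bracket A v := slAct A v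
  add_lie A B v := by
    apply BinForm.ext_coord
    intro k
    have h : ∀ i j, (A + B : SL2 F).1 i j = A.1 i j + B.1 i j := fun _ _ => rfl
    simp only [BinForm.coord_add, coord_slAct, h]
    ring
  lie_add A u v := by
    apply BinForm.ext_coord
    intro k
    simp only [BinForm.coord_add, coord_slAct]
    split_ifs <;> ring
  leibniz_lie A B v := by
    change slAct A (slAct B v) = slAct ⁅A, B⁆ v + slAct B (slAct A v)
    rw [slAct_lie]
    abel

instance : LieModule F (SL2 F) (BinForm F d) where
  smul_lie c A v := by
    apply BinForm.ext_coord
    intro k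
    change (slAct (c • A) v).coord k = (c • slAct A v).coord k
    have h : ∀ i j, (c • A : SL2 F).1 i j = c * A.1 i j := fun _ _ => rfl
    simp only [BinForm.coord_smul, coord_slAct, h]
    ring
  lie_smul c A v := by
    apply BinForm.ext_coord
    intro k
    change (slAct A (c • v)).coord k = (c • slAct A v).coord k
    simp only [BinForm.coord_smul, coord_slAct]
    split_ifs <;> ring

end BinForm

/-- `V(a)`, the irreducible `sl(2)`-module with highest weight `a` (over a field of characteristic
zero), realised on binary forms of degree `a`. -/
abbrev Irr (F : Type*) (a : ℕ) : Type _ := BinForm F (a + 1)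

/-! ### The Heisenberg Lie algebra `h_n = V(2n-1) ⊕ V(0)` and `sl(2) ⋉ h_n` -/

section Heisenberg

variable {F : Type*} [Field F]

/-- The `sl(2)`-invariant bilinear form on binary forms of degree `d - 1`, normalised by
`ω(w_i, w_(d-1-i)) = (-1)^i / binom(d-1, i)`; for even `d` it is skew-symmetric. -/
def invForm {d : ℕ} (u v : BinForm F d) : F :=
  ∑ i : Fin d, (-1) ^ (i : ℕ) * (((d - 1).choose i : ℕ) : F)⁻¹ * u i * v i.rev

theorem invForm_eq_range {d : ℕ} (u v : BinForm F d) :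
    invForm u v = ∑ i ∈ Finset.range d,
      (-1) ^ i * (((d - 1).choose i : ℕ) : F)⁻¹ * u.coord i * v.coord (d - 1 - i) := by
  rw [Finset.sum_range]
  apply Finset.sum_congr rfl
  intro i _
  have h1 : u.coord i = u i := by simp [BinForm.coord]
  have h2 : v.coord (d - 1 - i) = v i.rev := by
    have : d - 1 - (i : ℕ) = (i.rev : ℕ) := by rw [Fin.val_rev]; omega
    rw [this, BinForm.coord, dif_pos i.rev.isLt]
  rw [h1, h2]

theorem invForm_swap {n : ℕ} (u v : BinForm F (2 * n)) : invForm u v = -invForm v u := by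
  unfold invForm
  rw [← Equiv.sum_comp Fin.revPerm, ← Finset.sum_neg_distrib]
  apply Finset.sum_congr rfl
  intro i _
  have hi := i.isLt
  simp only [Fin.revPerm_apply, Fin.rev_rev]
  have h1 : ((i.rev : Fin (2 * n)) : ℕ) = (2 * n - 1) - i := by rw [Fin.val_rev]; omega
  have h2 : (2 * n - 1).choose ((2 * n - 1) - i) = (2 * n - 1).choose i :=
    Nat.choose_symm (by omega)
  have h3 : (-1 : F) ^ ((2 * n - 1) - (i : ℕ)) = -(-1) ^ (i : ℕ) := by
    rcases Nat.even_or_odd (i : ℕ) with h | h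
    · rw [h.neg_one_pow, Odd.neg_one_pow]
      obtain ⟨j, hj⟩ := h
      exact ⟨n - 1 - j, by omega⟩
    · rw [h.neg_one_pow, Even.neg_one_pow]
      · simp
      · obtain ⟨j, hj⟩ := h
        exact ⟨n - 1 - j, by omega⟩
  rw [h1, h2, h3]
  ring

theorem invForm_self [CharZero F] {n : ℕ} (u : BinForm F (2 * n)) : invForm u u = 0 :=
  self_eq_neg.mp (invForm_swap u u)

theorem invForm_add_left {d : ℕ} (u u' v : BinForm F d) :
    invForm (u + u') v = invForm u v + invForm u' v := by
  unfold invForm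
  rw [← Finset.sum_add_distrib]
  apply Finset.sum_congr rfl
  intro i _
  change _ * (u i + u' i) * _ = _
  ring

theorem invForm_add_right {d : ℕ} (u v v' : BinForm F d) :
    invForm u (v + v') = invForm u v + invForm u v' := by
  unfold invForm
  rw [← Finset.sum_add_distrib]
  apply Finset.sum_congr rfl
  intro i _
  change _ * (v i.rev + v' i.rev) = _
  ring

theorem invForm_smul_right {d : ℕ} (c : F) (u v : BinForm F d) :
    invForm u (c • v) = c * invForm u v := by
  unfold invForm
  rw [Finset.mul_sum]
  apply Finset.sum_congr rfl
  intro i _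
  change _ * (c * v i.rev) = _
  ring

/-- Invariance of the form under `sl(2)`. -/
theorem invForm_lie [CharZero F] {d : ℕ} (A : SL2 F) (u v : BinForm F d) :
    invForm ⁅A, u⁆ v + invForm u ⁅A, v⁆ = 0 := by
  rcases d with _ | D
  · simp [invForm]
  change invForm (slAct A u) v + invForm u (slAct A v) = 0
  simp only [invForm_eq_range, coord_slAct, Nat.add_sub_cancel]
  set c : ℕ → F := fun i => (-1) ^ i * ((D.choose i : ℕ) : F)⁻¹ with hc
  have hrec : ∀ i, i < D → c i * ((i : F) + 1) + c (i + 1) * ((D : F) - (i : F)) = 0 := by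
    intro i hi
    have e : ((D.choose (i + 1) : ℕ) : F) * ((i : F) + 1)
        = ((D.choose i : ℕ) : F) * ((D : F) - (i : F)) := by
      have := Nat.choose_succ_right_eq D i
      have h2 : ((D - i : ℕ) : F) = (D : F) - (i : F) := by
        rw [Nat.cast_sub hi.le]
      rw [← h2]
      exact_mod_cast this
    have n1 : ((D.choose i : ℕ) : F) ≠ 0 := by
      exact_mod_cast (Nat.choose_pos hi.le).ne'
    have n2 : ((D.choose (i + 1) : ℕ) : F) ≠ 0 := by
      exact_mod_cast (Nat.choose_pos (by omega : i + 1 ≤ D)).ne'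
    have e' : ((D.choose i : ℕ) : F)⁻¹ * ((i : F) + 1)
        = ((D.choose (i + 1) : ℕ) : F)⁻¹ * ((D : F) - (i : F)) := by
      field_simp
      linear_combination e
    simp only [hc, pow_succ]
    linear_combination (-1) ^ i * e'
  -- the `h`-part cancels termwise, the `e`-part and the `f`-part telescope
  have hE : ∑ i ∈ Finset.range (D + 1), c i * (((i : F) + 1) * u.coord (i + 1)) * v.coord (D - i)
      + ∑ i ∈ Finset.range (D + 1),
        c i * u.coord i * (((D - i : ℕ) + 1 : F) * v.coord (D - i + 1)) = 0 := by
    rw [Finset.sum_range_succ, Finset.sum_range_succ' _ D]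
    rw [BinForm.coord_of_le u (le_refl (D + 1)), Nat.sub_zero,
      BinForm.coord_of_le v (le_refl (D + 1))]
    simp only [mul_zero, zero_mul, add_zero]
    rw [← Finset.sum_add_distrib]
    apply Finset.sum_eq_zero
    intro i hi
    have hi' : i < D := Finset.mem_range.mp hi
    have e1 : D - (i + 1) + 1 = D - i := by omega
    have e2 : ((D - (i + 1) : ℕ) : F) + 1 = (D : F) - (i : F) := by
      rw [Nat.cast_sub (by omega)]
      push_cast
      ring
    rw [e1, e2]
    linear_combination (u.coord (i + 1) * v.coord (D - i)) * hrec i hi'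
  have hF : ∑ i ∈ Finset.range (D + 1),
        c i * (if i = 0 then 0 else ((D : F) + 1 - (i : F)) * u.coord (i - 1)) * v.coord (D - i)
      + ∑ i ∈ Finset.range (D + 1), c i * u.coord i *
        (if D - i = 0 then 0 else ((D : F) + 1 - ((D - i : ℕ) : F)) * v.coord (D - i - 1))
        = 0 := by
    rw [Finset.sum_range_succ' _ D, Finset.sum_range_succ _ D]
    simp only [Nat.sub_self, if_true, mul_zero, zero_mul, add_zero]
    rw [← Finset.sum_add_distrib]
    apply Finset.sum_eq_zero
    intro i hi
    have hi' : i < D := Finset.mem_range.mp hi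
    have e1 : D - (i + 1) = D - i - 1 := by omega
    have e2 : ((D - i : ℕ) : F) = (D : F) - (i : F) := Nat.cast_sub hi'.le
    rw [if_neg (Nat.succ_ne_zero i), if_neg (by omega : ¬ D - i = 0), e1, e2,
      Nat.add_sub_cancel]
    push_cast
    linear_combination (u.coord i * v.coord (D - i - 1)) * hrec i hi'
  have hH : ∑ i ∈ Finset.range (D + 1),
        (c i * (((D : F) - 2 * (i : F)) * u.coord i) * v.coord (D - i)
        + c i * u.coord i * (((D : F) - 2 * ((D - i : ℕ) : F)) * v.coord (D - i))) = 0 := by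
    apply Finset.sum_eq_zero
    intro i hi
    have hi' : i < D + 1 := Finset.mem_range.mp hi
    have e2 : ((D - i : ℕ) : F) = (D : F) - (i : F) := Nat.cast_sub (by omega)
    rw [e2]
    ring
  have key := congrArg₂ (· + ·) (congrArg₂ (· + ·) (congrArg (A.1 0 0 * ·) hH)
    (congrArg (A.1 0 1 * ·) hE)) (congrArg (A.1 1 0 * ·) hF)
  simp only [mul_zero, add_zero] at key
  refine Eq.trans ?_ key
  simp only [← Finset.sum_add_distrib, Finset.mul_sum]
  apply Finset.sum_congr rfl
  intro i _
  simp only [hc]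
  push_cast
  ring

/-- The underlying space `V(2n-1) ⊕ V(0)` of the Heisenberg Lie algebra `h_n` of dimension
`2n + 1`; the second component is the coefficient of the central element `z`. -/
def Heis (F : Type*) (n : ℕ) : Type _ := BinForm F (2 * n) × F

instance {n : ℕ} : AddCommGroup (Heis F n) :=
  inferInstanceAs (AddCommGroup (BinForm F (2 * n) × F))

instance {n : ℕ} : Module F (Heis F n) := inferInstanceAs (Module F (BinForm F (2 * n) × F))

/-- The element `u + s z` of `h_n`. -/
def Heis.mk {n : ℕ} (u : BinForm F (2 * n)) (s : F) : Heis F n := (u, s)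

variable [CharZero F] {n : ℕ}

/-- The bracket of `h_n` is `[u + s z, v + t z] = ω(u, v) z`. For `n ≥ 1`, a rescaling of the
elements `w_i` and `w_(2n-1-i)` (`i < n`) gives the relations `[x_i, x'_i] = z`. With
`e_i = √binom(2n-1, i) w_i` and a rescaled `z`, the relations read
`[e_i, e_(2n-1-i)] = (-1)^i z / √(2n)`; no square roots are needed in the basis `w_i`. -/
instance : LieRing (Heis F n) where
  bracket x y := Heis.mk 0 (invForm x.1 y.1)
  add_lie x y w := Prod.ext (add_zero _).symm (invForm_add_left _ _ _)
  lie_add x y w := Prod.ext (add_zero _).symm (invForm_add_right _ _ _)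
  lie_self x := Prod.ext rfl (invForm_self _)
  leibniz_lie x y w := by
    have hz : ∀ u : BinForm F (2 * n), invForm u 0 = 0 := by
      intro u
      have h := invForm_smul_right 0 u 0
      simpa using h
    have hz' : ∀ u : BinForm F (2 * n), invForm 0 u = 0 := by
      intro u
      rw [invForm_swap, hz, neg_zero]
    refine Prod.ext (add_zero _).symm ?_
    change invForm x.1 0 = invForm 0 w.1 + invForm y.1 0
    rw [hz, hz, hz', add_zero]

instance : LieAlgebra F (Heis F n) where
  lie_smul _ _ _ := Prod.ext (smul_zero _).symm (invForm_smul_right _ _ _)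

/-- `sl(2)` acts on `h_n` by derivations, as on `V(2n-1) ⊕ V(0)`. -/
def slDer (F : Type*) [Field F] [CharZero F] (n : ℕ) :
    SL2 F →ₗ⁅F⁆ LieDerivation F (Heis F n) (Heis F n) where
  toFun A :=
    { toFun := fun x => Heis.mk ⁅A, x.1⁆ 0
      map_add' := fun x y => Prod.ext (lie_add _ _ _) (add_zero _).symm
      map_smul' := fun c x => Prod.ext (lie_smul _ _ _) (smul_zero _).symm
      leibniz' := fun x y => by
        refine Prod.ext ((lie_zero A).trans (sub_zero _).symm) ?_
        change (0 : F) = invForm x.1 ⁅A, y.1⁆ - invForm y.1 ⁅A, x.1⁆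
        rw [invForm_swap y.1, sub_neg_eq_add, add_comm, invForm_lie] }
  map_add' A B := by
    ext x
    exact Prod.ext (add_lie _ _ _) (add_zero _).symm
  map_smul' c A := by
    ext x
    exact Prod.ext (smul_lie _ _ _) (smul_zero _).symm
  map_lie' {A B} := by
    ext x
    rw [LieDerivation.lie_apply]
    exact Prod.ext (lie_lie _ _ _) (sub_zero _).symm

end Heisenberg

/-- The Lie algebra `sl(2) ⋉ h_n`. -/
abbrev SlHeis (F : Type*) [Field F] [CharZero F] (n : ℕ) : Type _ :=
  LieAlgebra.SemiDirectSum (Heis F n) (SL2 F) (slDer F n)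

/-- The inclusion of `sl(2)` in `sl(2) ⋉ h_n`. -/
abbrev inSl {F : Type*} [Field F] [CharZero F] (n : ℕ) (A : SL2 F) : SlHeis F n :=
  LieAlgebra.SemiDirectSum.inr (slDer F n) A

/-- The inclusion of `h_n` in `sl(2) ⋉ h_n`. -/
abbrev inHeis {F : Type*} [Field F] [CharZero F] {n : ℕ} (y : Heis F n) : SlHeis F n :=
  LieAlgebra.SemiDirectSum.inl (slDer F n) y

/-! ### Socles and uniserial modules -/

section Socle

variable (R L M : Type*) [CommRing R] [LieRing L] [LieAlgebra R L] [AddCommGroup M] [Module R M]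
  [LieRingModule L M] [LieModule R L M]

/-- The socle: the sum of all irreducible submodules. -/
def socle : LieSubmodule R L M := sSup {N | LieModule.IsIrreducible R L N}

/-- The socle series: `soc^0 = 0` and `soc^(k+1) / soc^k = soc(M / soc^k)`. -/
def socleSeries : ℕ → LieSubmodule R L M
  | 0 => ⊥
  | k + 1 =>
    (socle R L (M ⧸ socleSeries k)).comap (LieSubmodule.Quotient.mk' (socleSeries k))

/-- `M` is uniserial: it has exactly one composition series
`0 = N_0 ⋖ N_1 ⋖ ⋯ ⋖ N_l = M`. -/
def IsUniserial : Prop :=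
  ∃! s : RelSeries {p : LieSubmodule R L M × LieSubmodule R L M | p.1 ⋖ p.2},
    s.head = ⊥ ∧ s.last = ⊤

end Socle

section Modules

variable {F : Type*} [Field F] [CharZero F] {n : ℕ}

/-- The subspace `S` of the `sl(2) ⋉ h_n`-module `U` is an `sl(2)`-submodule isomorphic to the
`sl(2)`-module `M`. -/
def IsoAsSl (n : ℕ) {U : Type*} [AddCommGroup U] [Module F U] [LieRingModule (SlHeis F n) U]
    (S : Submodule F U) (M : Type*) [AddCommGroup M] [Module F M] [LieRingModule (SL2 F) M] :
    Prop :=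
  ∃ φ : M →ₗ[F] U, Function.Injective φ ∧ LinearMap.range φ = S ∧
    ∀ (A : SL2 F) (v : M), φ ⁅A, v⁆ = ⁅inSl n A, φ v⁆

/-- The `sl(2)`-submodule `S` is multiplicity free: for each `c` it contains at most one submodule
isomorphic to `V(c)`. -/
def MultiplicityFree (n : ℕ) {U : Type*} [AddCommGroup U] [Module F U]
    [LieRingModule (SlHeis F n) U] (S : Submodule F U) : Prop :=
  ∀ (c : ℕ) (P Q : Submodule F U), P ≤ S → Q ≤ S →
    IsoAsSl n P (Irr F c) → IsoAsSl n Q (Irr F c) → P = Q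

/-- A socle decomposition `V = V(a_0) ⊕ ⋯ ⊕ V(a_(l-1))` of an `sl(2) ⋉ h_n`-module: an
`sl(2)`-module decomposition such that `soc^k(V)` is the sum of the first `k` summands, for every `k ≤ l`. -/
structure SocleDecomposition (F : Type*) [Field F] [CharZero F] (n : ℕ) (V : Type*)
    [AddCommGroup V] [Module F V] [LieRingModule (SlHeis F n) V] [LieModule F (SlHeis F n) V]
    (l : ℕ) where
  /-- the highest weights `a_0, …, a_(l-1)` -/
  wt : Fin l → ℕ
  /-- the summands -/
  comp : Fin l → Submodule F V
  isInternal : DirectSum.IsInternal comp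
  iso : ∀ i, IsoAsSl n (comp i) (Irr F (wt i))
  socleSeries_eq : ∀ k ≤ l, (socleSeries F (SlHeis F n) V k).toSubmodule =
    ⨆ i : Fin l, ⨆ _ : (i : ℕ) < k, comp i

/-- The space `S_t(V, W) = (⨁_{i+j=t} V(a_i) ⊗ V(b_j))^{h_n}` of vectors of
`⨁_{i+j=t} V(a_i) ⊗ V(b_j) ⊆ V ⊗ W` annihilated by `h_n`. -/
def gradedInvariants {V W : Type*} [AddCommGroup V] [Module F V] [LieRingModule (SlHeis F n) V]
    [LieModule F (SlHeis F n) V] [AddCommGroup W] [Module F W] [LieRingModule (SlHeis F n) W]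
    [LieModule F (SlHeis F n) W] {l l' : ℕ} (D : SocleDecomposition F n V l)
    (D' : SocleDecomposition F n W l') (t : ℕ) : Submodule F (V ⊗[F] W) where
  carrier := {u | (u ∈ ⨆ i : Fin l, ⨆ j : Fin l', ⨆ _ : (i : ℕ) + (j : ℕ) = t,
      Submodule.map₂ (TensorProduct.mk F V W) (D.comp i) (D'.comp j)) ∧
    ∀ y : Heis F n, ⁅inHeis y, u⁆ = 0}
  add_mem' := fun hu hv => ⟨Submodule.add_mem _ hu.1 hv.1, fun y => by
    rw [lie_add, hu.2, hv.2, add_zero]⟩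
  zero_mem' := ⟨Submodule.zero_mem _, fun y => lie_zero _⟩
  smul_mem' := fun c _ hu => ⟨Submodule.smul_mem _ c hu.1, fun y => by
    rw [lie_smul, hu.2, smul_zero]⟩

/-! ### The modules `FU_(a₀, a₁, a₀)` -/

/-- The `sl(2)`-homomorphism `V(m) ⊗ V(b) → V(a)`, `m = 2n - 1`, unique up to a scalar, by which
`h_n(m) = V(m)` sends `V(b)` to `V(a)` (here `m/2, a/2, b/2` satisfy the triangle condition).
It is the `k`-th transvectant
`(p, q) ↦ ∑_r (-1)^r binom(k, r) (∂_X^(k-r) ∂_Y^r p) (∂_X^r ∂_Y^(k-r) q)` with `k = (m + b - a) / 2`.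
The coefficient of `w_s ⊗ w_j ↦ w_(s+j-k)` is, up to normalisation of the bases and a
common scalar, `(-1)^j` times the Clebsch-Gordan coefficient
`CG(a/2, a/2 - i; b/2, -b/2 + j | m/2, m/2 - s)` with `i = s + j - k`. -/
def arrow (n b a : ℕ) (p : BinForm F (2 * n)) (q : Irr F b) : Irr F a := fun i =>
  let m := 2 * n - 1
  let k := (m + b - a) / 2
  ∑ s : Fin (2 * n), ∑ j : Fin (b + 1),
    if (s : ℕ) + j = i + k then
      (∑ r ∈ Finset.range (k + 1), (-1) ^ r *
        ((k.choose r * (m - s).descFactorial (k - r) * (s : ℕ).descFactorial r *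
          (b - j).descFactorial r * (j : ℕ).descFactorial (k - r) : ℕ) : F)) * p s * q j
    else 0

/-- `V` is isomorphic to the `sl(2) ⋉ h_n`-module `FU_(a₀, a₁, a₀)`: the `sl(2)`-module
`V(a₀) ⊕ V(a₁) ⊕ V(a₀)` on which `h_n(m)`, `m = 2n - 1`, acts by
`0 ⟵ V(a₀) ⟵ V(a₁) ⟵ V(a₀)` through the maps `arrow`, and on which `z` acts as a nonzero multiple
of the identification of the third summand with the first one (the multiple is determined by
the action of `h_n(m)`). -/
def IsFU (n : ℕ) (V : Type*) [AddCommGroup V] [Module F V] [LieRingModule (SlHeis F n) V]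
    (a₀ a₁ : ℕ) : Prop :=
  ∃ φ : V ≃ₗ[F] Irr F a₀ × Irr F a₁ × Irr F a₀,
    (∀ (A : SL2 F) (v : V),
      φ ⁅inSl n A, v⁆ = (⁅A, (φ v).1⁆, ⁅A, (φ v).2.1⁆, ⁅A, (φ v).2.2⁆)) ∧
    (∀ (p : BinForm F (2 * n)) (v : V),
      φ ⁅inHeis (Heis.mk p 0), v⁆ = (arrow n a₁ a₀ p (φ v).2.1, arrow n a₀ a₁ p (φ v).2.2, 0)) ∧
    ∃ c : F, c ≠ 0 ∧ ∀ v : V, φ ⁅inHeis (Heis.mk (0 : BinForm F (2 * n)) 1), v⁆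
      = (c • (φ v).2.2, 0, 0)

/-- Standard faithful uniserial modules: the faithful uniserial modules that are not isomorphic to
`FU_(4,3,4)` (`n = 2`). -/
structure IsStandardFaithfulUniserial (F : Type*) [Field F] [CharZero F] (n : ℕ) (V : Type*)
    [AddCommGroup V] [Module F V] [LieRingModule (SlHeis F n) V] [LieModule F (SlHeis F n) V] :
    Prop where
  uniserial : IsUniserial F (SlHeis F n) V
  faithful : LieModule.IsFaithful F (SlHeis F n) V
  ne_exceptional : ¬ (n = 2 ∧ IsFU (F := F) n V 4 3)

end Modules

end UniserialTensor

open UniserialTensor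

/-! Write `m = 2n - 1` and let `w_0, …, w_m` be the monomial basis of `V(m)`. The modules are first
identified with explicit ones; the vectors killed by `h_n` in the tensor product are then found in
monomial coordinates.

Classification. An equivariant map `V(m) ⊗ V(b) → V(a)` is a multiple of a single transvectant
(`exists_smul_arrow`). Since `m` is odd there is no nonzero such map with `a = b`, so in a module
with three layers `V(m)` moves each layer into the one below. The commutator `z` then maps the third
layer to the first, and it is nonzero by faithfulness; Schur's lemma gives `a₂ = a₀`, while `a₁ = a₀
+ m - 2k` for some `k`. Applying `[w_t, w_(m-t)] = ± z / binom(m, t)` to the highest weight vector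
of the third layer yields an expression that must not depend on `t`. For `n > 1` this leaves `k = 0,
a₀ ≤ 1`, or `k = 1, a₀ = 1`, or the exceptional weights `(4, 3, 4)` with `n = 2`
(`weights_of_eigenFactor_constant`). For `n = 1` one has `k ≤ m = 1` anyway. So `k ∈ {0, 1}` for
standard modules.

Socle. The tensor product is graded by the sum of the layer indices, and `V(m)` lowers this degree
by one. Hence every nonzero submodule contains nonzero `h_n`-invariants, and the socle lies in the
space of invariants. That space is graded too, and `z` forces its degrees to be at most two, so it
is `S_0 ⊕ S_1 ⊕ S_2`. Each `S_t` turns out to be zero or a sum of modules `V(c)` with trivial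
`h_n`-action, so it lies in the socle.

Computation of `S_1` and `S_2`. A highest weight vector of `V(a) ⊗ V(b)` is determined by its
coordinates at `w_0 ⊗ w_l`. Such a vector is `h_n`-invariant as soon as `w_m` kills it, and `w_m`
acts on monomials by an index shift with scalar coefficients. Invariance thus becomes a family of
linear relations with two unknowns each (`tcrd_relation`). Well chosen relations kill all
coordinates but those of at most one highest weight. In degree two only `k₁ = k₂` and `l = a₀ = b₀`
can survive, which is a vector of weight zero; `lowOne_mul_choose` shows that it exists. When `a₀ =
b₀` the Clebsch-Gordan decomposition of `S_0` contains a `V(0)` as well, whence the failure of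
multiplicity freeness. -/

namespace UniserialTensor

/-! ### The standard basis of `sl(2)` -/

section SlBasis

variable {F : Type*} [Field F]

/-- The standard basis vector `e` of `sl(2)`. -/
def slE (F : Type*) [Field F] : SL2 F :=
  ⟨!![0, 1; 0, 0], LinearMap.mem_ker.mpr (by simp [Matrix.trace_fin_two])⟩

/-- The standard basis vector `f` of `sl(2)`. -/
def slF (F : Type*) [Field F] : SL2 F :=
  ⟨!![0, 0; 1, 0], LinearMap.mem_ker.mpr (by simp [Matrix.trace_fin_two])⟩

/-- The standard basis vector `h` of `sl(2)`. -/
def slH (F : Type*) [Field F] : SL2 F :=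
  ⟨!![1, 0; 0, -1], LinearMap.mem_ker.mpr (by simp [Matrix.trace_fin_two])⟩

theorem sl_ext {A B : SL2 F} (h00 : A.1 0 0 = B.1 0 0) (h01 : A.1 0 1 = B.1 0 1)
    (h10 : A.1 1 0 = B.1 1 0) : A = B := by
  apply Subtype.ext
  ext i j
  fin_cases i <;> fin_cases j
  · exact h00
  · exact h01
  · exact h10
  · change A.1 1 1 = B.1 1 1
    rw [sl_apply_one_one, sl_apply_one_one, h00]

theorem sl_eq (A : SL2 F) : A = A.1 0 0 • slH F + A.1 0 1 • slE F + A.1 1 0 • slF F := by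
  have h1 : ∀ (A B : SL2 F) i j, (A + B : SL2 F).1 i j = A.1 i j + B.1 i j := fun _ _ _ _ => rfl
  have h2 : ∀ (c : F) (A : SL2 F) i j, (c • A : SL2 F).1 i j = c * A.1 i j := fun _ _ _ _ => rfl
  apply sl_ext <;> simp only [h1, h2] <;> simp [slE, slF, slH]

theorem lie_slE_slF : ⁅slE F, slF F⁆ = slH F := by
  apply sl_ext <;> rw [LieAlgebra.SpecialLinear.sl_bracket] <;>
    simp [slE, slF, slH]

theorem lie_slH_slE : ⁅slH F, slE F⁆ = (2 : F) • slE F := by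
  have h2 : ∀ (c : F) (A : SL2 F) i j, (c • A : SL2 F).1 i j = c * A.1 i j := fun _ _ _ _ => rfl
  apply sl_ext <;> rw [LieAlgebra.SpecialLinear.sl_bracket, h2] <;>
    simp [slE, slH] ; ring

theorem lie_slH_slF : ⁅slH F, slF F⁆ = -((2 : F) • slF F) := by
  have h2 : ∀ (c : F) (A : SL2 F) i j, (-(c • A) : SL2 F).1 i j = -(c * A.1 i j) :=
    fun _ _ _ _ => rfl
  apply sl_ext <;> rw [LieAlgebra.SpecialLinear.sl_bracket, h2] <;>
    simp [slF, slH] ; ring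

end SlBasis

/-! ### Monomials and coordinates of binary forms -/

section Monomials

variable {F : Type*} [Field F] {d : ℕ}

/-- The monomial `w_k = X^(d-1-k) Y^k`, which is `0` for `k ≥ d`. -/
def mono (F : Type*) [Field F] (d k : ℕ) : BinForm F d := fun i => if (i : ℕ) = k then 1 else 0

theorem coord_mono (k j : ℕ) :
    (mono F d k).coord j = if j = k ∧ k < d then 1 else 0 := by
  unfold BinForm.coord mono
  by_cases hj : j < d
  · rw [dif_pos hj]
    exact if_congr (by constructor <;> intro h <;> simp at h ⊢ <;> omega) rfl rfl
  · rw [dif_neg hj, if_neg (by omega)]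

/-- The `k`-th coordinate as a linear form. -/
def coordL (F : Type*) [Field F] (d k : ℕ) : BinForm F d →ₗ[F] F where
  toFun v := v.coord k
  map_add' u v := BinForm.coord_add u v k
  map_smul' c v := BinForm.coord_smul c v k

@[simp] theorem coordL_apply (k : ℕ) (v : BinForm F d) : coordL F d k v = v.coord k := rfl

@[simp] theorem coord_zero (k : ℕ) : (0 : BinForm F d).coord k = 0 := (coordL F d k).map_zero

theorem mono_of_le {k : ℕ} (hk : d ≤ k) : mono F d k = 0 := by
  apply BinForm.ext_coord
  intro j
  rw [coord_mono, if_neg (by omega), coord_zero]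

theorem coord_sum {ι : Type*} (s : Finset ι) (f : ι → BinForm F d) (k : ℕ) :
    (∑ i ∈ s, f i).coord k = ∑ i ∈ s, (f i).coord k := map_sum (coordL F d k) f s

theorem sum_coord_smul_mono (v : BinForm F d) :
    v = ∑ k ∈ Finset.range d, v.coord k • mono F d k := by
  apply BinForm.ext_coord
  intro j
  rw [coord_sum]
  simp only [BinForm.coord_smul, coord_mono]
  by_cases hj : j < d
  · rw [Finset.sum_eq_single j]
    · simp [hj]
    · intro k _ hk
      rw [if_neg (by omega), mul_zero]
    · intro h
      simp [hj] at h
  · rw [BinForm.coord_of_le v (by omega), Finset.sum_eq_zero]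
    intro k hk
    rw [if_neg (by rw [Finset.mem_range] at hk; omega), mul_zero]

theorem linearMap_ext_mono {M : Type*} [AddCommGroup M] [Module F M] {f g : BinForm F d →ₗ[F] M}
    (h : ∀ k < d, f (mono F d k) = g (mono F d k)) : f = g := by
  ext v
  rw [sum_coord_smul_mono v, map_sum, map_sum]
  apply Finset.sum_congr rfl
  intro k hk
  rw [map_smul, map_smul, h k (Finset.mem_range.mp hk)]

theorem coord_lie_slE (v : BinForm F d) (k : ℕ) :
    (⁅slE F, v⁆ : BinForm F d).coord k = ((k : F) + 1) * v.coord (k + 1) := by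
  change (slAct _ v).coord k = _
  rw [coord_slAct]
  simp [slE]

theorem coord_lie_slF (v : BinForm F d) (k : ℕ) :
    (⁅slF F, v⁆ : BinForm F d).coord k =
      if k = 0 then 0 else ((d : F) - (k : F)) * v.coord (k - 1) := by
  change (slAct _ v).coord k = _
  rw [coord_slAct]
  simp [slF]

theorem coord_lie_slH (v : BinForm F d) (k : ℕ) :
    (⁅slH F, v⁆ : BinForm F d).coord k = ((d : F) - 1 - 2 * (k : F)) * v.coord k := by
  change (slAct _ v).coord k = _
  rw [coord_slAct]
  simp [slH]

theorem lie_slH_mono (k : ℕ) :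
    ⁅slH F, mono F d k⁆ = ((d : F) - 1 - 2 * (k : F)) • mono F d k := by
  apply BinForm.ext_coord
  intro j
  rw [coord_lie_slH, BinForm.coord_smul, coord_mono]
  split_ifs with h
  · rw [h.1]
  · simp

theorem lie_slE_mono {k : ℕ} (hk : k < d) :
    ⁅slE F, mono F d k⁆ = (k : F) • mono F d (k - 1) := by
  apply BinForm.ext_coord
  intro j
  rw [coord_lie_slE, BinForm.coord_smul, coord_mono, coord_mono]
  rcases k with _ | k
  · simp
  · by_cases h : j = k
    · subst h
      rw [if_pos (by omega), if_pos (by omega)]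
      push_cast
      ring
    · rw [if_neg (by omega), if_neg (by omega)]
      simp

theorem lie_slF_mono (k : ℕ) :
    ⁅slF F, mono F d k⁆ = ((d : F) - 1 - (k : F)) • mono F d (k + 1) := by
  apply BinForm.ext_coord
  intro j
  rw [coord_lie_slF, BinForm.coord_smul, coord_mono, coord_mono]
  rcases j with _ | j
  · simp
  · by_cases h : j = k
    · subst h
      by_cases hd : j + 1 < d
      · rw [if_neg (Nat.succ_ne_zero _), Nat.add_sub_cancel, if_pos (by omega), if_pos (by omega)]
        push_cast
        ring
      · rw [if_neg (Nat.succ_ne_zero _), Nat.add_sub_cancel, if_neg (by omega : ¬(j + 1 = j + 1 ∧ _))]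
        by_cases hd' : j < d
        · have : d = j + 1 := by omega
          subst this
          simp
        · rw [if_neg (by omega)]
          simp
    · rw [if_neg (by omega), if_neg (by omega), if_neg (by omega)]
      simp

variable [CharZero F]

theorem eq_smul_mono_zero_of_lie_slE {v : BinForm F d} (hv : ⁅slE F, v⁆ = 0) :
    v = v.coord 0 • mono F d 0 := by
  apply BinForm.ext_coord
  intro j
  rw [BinForm.coord_smul, coord_mono]
  rcases j with _ | j
  · by_cases hd : 0 < d
    · simp [hd]
    · rw [BinForm.coord_of_le v (by omega), zero_mul]
  · have h := congrArg (BinForm.coord · j) hv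
    simp only [coord_lie_slE, coord_zero] at h
    have h2 : ((j : F) + 1) ≠ 0 := by exact_mod_cast Nat.succ_ne_zero j
    rw [(mul_eq_zero.mp h).resolve_left h2]
    simp

end Monomials


/-! ### Structure constants of the transvectants -/

section TransvectantCoefficients

variable {F : Type*} [Field F]

/-- The falling factorial `x (x - 1) ⋯ (x - k + 1)`. -/
def fallFact (x : F) : ℕ → F
  | 0 => 1
  | k + 1 => x * fallFact (x - 1) k

theorem fallFact_natCast (N k : ℕ) : fallFact (N : F) k = (N.descFactorial k : F) := by
  induction k generalizing N with
  | zero => simp [fallFact]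
  | succ k ih =>
    rcases N with _ | N
    · simp [fallFact]
    · rw [fallFact, Nat.succ_descFactorial_succ, Nat.cast_mul, ← ih]
      push_cast
      rw [add_sub_cancel_right]

/-- The coefficient of `(∂_X ∂_Y' - ∂_Y ∂_X')^k` on `X^p Y^p' X'^q Y'^q'`. -/
def omegaCoeff : ℕ → F → F → F → F → F
  | 0, _, _, _, _ => 1
  | k + 1, p, p', q, q' =>
    p * q' * omegaCoeff k (p - 1) p' q (q' - 1) - p' * q * omegaCoeff k p (p' - 1) (q - 1) q'

/-- The two summands of `∂_X ∂_Y' - ∂_Y ∂_X'` commute, so this is the binomial theorem; the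
induction step is Pascal's rule. The exponents are field elements so that they can be shifted freely
without truncated subtraction. -/
theorem omegaCoeff_eq_sum (k : ℕ) (p p' q q' : F) :
    omegaCoeff k p p' q q' = ∑ r ∈ Finset.range (k + 1), (k.choose r : F) *
      ((-1) ^ r * fallFact p (k - r) * fallFact p' r * fallFact q r * fallFact q' (k - r)) := by
  induction k generalizing p p' q q' with
  | zero => simp [omegaCoeff, fallFact]
  | succ k ih =>
    rw [Finset.sum_choose_succ_mul (fun i j => (-1) ^ i * fallFact p j * fallFact p' i *
      fallFact q i * fallFact q' j), omegaCoeff, ih, ih, Finset.mul_sum, Finset.mul_sum,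
      sub_eq_add_neg, ← Finset.sum_neg_distrib]
    congr 1 <;> apply Finset.sum_congr rfl <;> intro r hr
    · have : k + 1 - r = (k - r) + 1 := by rw [Finset.mem_range] at hr; omega
      rw [this, fallFact, fallFact]
      ring
    · rw [fallFact, fallFact]
      ring

/-- Compatibility of the transvectant with `Y ∂_X`. -/
theorem omegaCoeff_lower (k : ℕ) (p p' q q' : F) :
    p * omegaCoeff k (p - 1) (p' + 1) q q' + q * omegaCoeff k p p' (q - 1) (q' + 1)
      = (p + q - k) * omegaCoeff k p p' q q' := by
  induction k generalizing p p' q q' with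
  | zero => simp [omegaCoeff]
  | succ k ih =>
    simp only [omegaCoeff, add_sub_cancel_right]
    have h1 := ih (p - 1) p' q (q' - 1)
    have h2 := ih p (p' - 1) (q - 1) q'
    simp only [sub_add_cancel] at h1 h2
    push_cast
    linear_combination p * q' * h1 - p' * q * h2

/-- The structure constants of `arrow`: the coefficient of `w_s ⊗ w_j ↦ w_(s+j-k)`. -/
def arrowCoeff (F : Type*) [Field F] (m b k s j : ℕ) : F :=
  ∑ r ∈ Finset.range (k + 1), (-1) ^ r *
    ((k.choose r * (m - s).descFactorial (k - r) * s.descFactorial r *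
      (b - j).descFactorial r * j.descFactorial (k - r) : ℕ) : F)

theorem arrowCoeff_eq (m b k s j : ℕ) :
    arrowCoeff F m b k s j = omegaCoeff k ((m - s : ℕ) : F) s ((b - j : ℕ) : F) j := by
  rw [omegaCoeff_eq_sum, arrowCoeff]
  apply Finset.sum_congr rfl
  intro r _
  simp only [fallFact_natCast]
  push_cast
  ring

theorem arrowCoeff_lower {m b s j : ℕ} (k : ℕ) (hs : s ≤ m) (hj : j ≤ b) :
    ((m : F) - s) * arrowCoeff F m b k (s + 1) j + ((b : F) - j) * arrowCoeff F m b k s (j + 1)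
      = ((m : F) - s + (b - j) - k) * arrowCoeff F m b k s j := by
  have h := omegaCoeff_lower k ((m - s : ℕ) : F) (s : F) ((b - j : ℕ) : F) j
  have e1 : ((m : F) - s) * arrowCoeff F m b k (s + 1) j = ((m - s : ℕ) : F) *
      omegaCoeff k (((m - s : ℕ) : F) - 1) (s + 1) ((b - j : ℕ) : F) j := by
    rw [Nat.cast_sub hs]
    -- At `s = m` the subtraction `m - (s + 1)` is truncated, so the coefficient at `s + 1` has no
    -- meaning; its factor `m - s` vanishes.
    rcases hs.eq_or_lt with rfl | hlt
    · simp
    · rw [arrowCoeff_eq, Nat.cast_sub hlt]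
      push_cast
      congr 2
      ring
  have e2 : ((b : F) - j) * arrowCoeff F m b k s (j + 1) = ((b - j : ℕ) : F) *
      omegaCoeff k ((m - s : ℕ) : F) s (((b - j : ℕ) : F) - 1) (j + 1) := by
    rw [Nat.cast_sub hj]
    rcases hj.eq_or_lt with rfl | hlt
    · simp
    · rw [arrowCoeff_eq, Nat.cast_sub hlt]
      push_cast
      congr 2
      ring
  rw [e1, e2, h, arrowCoeff_eq, Nat.cast_sub hs, Nat.cast_sub hj]

theorem arrowCoeff_eq_zero {m b k s j : ℕ} (h : s + j < k) : arrowCoeff F m b k s j = 0 := by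
  apply Finset.sum_eq_zero
  intro r hr
  rcases lt_or_ge s r with h1 | h1
  · simp [Nat.descFactorial_of_lt h1]
  · rw [Nat.descFactorial_of_lt (by omega : j < k - r)]
    simp

theorem arrowCoeff_zero_right (m b k s : ℕ) : arrowCoeff F m b k s 0 =
    (-1) ^ k * ((s.descFactorial k * b.descFactorial k : ℕ) : F) := by
  rw [arrowCoeff, Finset.sum_range_succ, Finset.sum_eq_zero]
  · simp
  · intro r hr
    rw [Nat.descFactorial_of_lt (by rw [Finset.mem_range] at hr; omega : 0 < k - r)]
    simp

theorem arrowCoeff_last (m b k j : ℕ) : arrowCoeff F m b k m j =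
    (-1) ^ k * ((m.descFactorial k * (b - j).descFactorial k : ℕ) : F) := by
  rw [arrowCoeff, Finset.sum_range_succ, Finset.sum_eq_zero]
  · simp
  · intro r hr
    rw [Nat.sub_self, Nat.descFactorial_of_lt (by rw [Finset.mem_range] at hr; omega : 0 < k - r)]
    simp

/-- The structure constants for the first coordinate of `arrow`. -/
theorem arrowCoeff_of_add_eq {m b k t j : ℕ} (h : t + j = k) : arrowCoeff F m b k t j =
    (-1) ^ t * ((k.factorial * (m - t).descFactorial j * (b - j).descFactorial t : ℕ) : F) := by
  subst h
  rw [arrowCoeff, Finset.sum_eq_single t]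
  · have h1 : (t + j).choose t * t.factorial * j.factorial = (t + j).factorial := by
      have := Nat.choose_mul_factorial_mul_factorial (Nat.le_add_right t j)
      rwa [Nat.add_sub_cancel_left] at this
    rw [← h1, Nat.add_sub_cancel_left, Nat.descFactorial_self, Nat.descFactorial_self]
    push_cast
    ring
  · intro r hr hne
    rcases lt_or_gt_of_ne hne with h1 | h1
    · rw [Nat.descFactorial_of_lt (by omega : j < t + j - r)]
      simp
    · rw [Nat.descFactorial_of_lt h1]
      simp
  · intro h
    simp at h

end TransvectantCoefficients

/-! ### Uniqueness of the equivariant maps `V(m) ⊗ V(b) → V(a)` -/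

section Arrow

variable {F : Type*} [Field F] {n a b : ℕ}

/-- `arrow` as a bilinear map. -/
def arrowL (F : Type*) [Field F] (n b a : ℕ) : BinForm F (2 * n) →ₗ[F] Irr F b →ₗ[F] Irr F a :=
  LinearMap.mk₂ F (arrow n b a)
    (fun p p' q => by
      funext i
      change arrow n b a (p + p') q i = arrow n b a p q i + arrow n b a p' q i
      unfold arrow
      simp only [← Finset.sum_add_distrib]
      refine Finset.sum_congr rfl fun s _ => Finset.sum_congr rfl fun j _ => ?_
      change (if _ then _ * (p s + p' s) * _ else _) = _
      split_ifs <;> ring)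
    (fun c p q => by
      funext i
      change arrow n b a (c • p) q i = c * arrow n b a p q i
      unfold arrow
      simp only [Finset.mul_sum]
      refine Finset.sum_congr rfl fun s _ => Finset.sum_congr rfl fun j _ => ?_
      change (if _ then _ * (c * p s) * _ else _) = _
      split_ifs <;> ring)
    (fun p q q' => by
      funext i
      change arrow n b a p (q + q') i = arrow n b a p q i + arrow n b a p q' i
      unfold arrow
      simp only [← Finset.sum_add_distrib]
      refine Finset.sum_congr rfl fun s _ => Finset.sum_congr rfl fun j _ => ?_
      change (if _ then _ * (q j + q' j) else _) = _
      split_ifs <;> ring)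
    (fun c p q => by
      funext i
      change arrow n b a p (c • q) i = c * arrow n b a p q i
      unfold arrow
      simp only [Finset.mul_sum]
      refine Finset.sum_congr rfl fun s _ => Finset.sum_congr rfl fun j _ => ?_
      change (if _ then _ * (c * q j) else _) = _
      split_ifs <;> ring)

@[simp] theorem arrowL_apply (p : BinForm F (2 * n)) (q : Irr F b) :
    arrowL F n b a p q = arrow n b a p q := rfl

theorem coord_arrow_mono {k s j : ℕ} (hk : a + 2 * k = 2 * n - 1 + b) (hs : s < 2 * n)
    (hj : j ≤ b) (i : ℕ) :
    (arrow n b a (mono F (2 * n) s) (mono F (b + 1) j)).coord i =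
      if s + j = i + k ∧ i ≤ a then arrowCoeff F (2 * n - 1) b k s j else 0 := by
  have hk' : (2 * n - 1 + b - a) / 2 = k := by omega
  by_cases hi : i < a + 1
  · rw [BinForm.coord, dif_pos hi]
    unfold arrow
    simp only [hk']
    rw [Finset.sum_eq_single ⟨s, hs⟩, Finset.sum_eq_single ⟨j, by omega⟩]
    · simp only [mono, if_true, mul_one]
      exact if_congr (by constructor <;> intro h <;> omega) rfl rfl
    · intro j' _ hj'
      have : (j' : ℕ) ≠ j := fun h => hj' (Fin.ext h)
      simp [mono, this]
    · simp
    · intro s' _ hs'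
      have : (s' : ℕ) ≠ s := fun h => hs' (Fin.ext h)
      simp [mono, this]
    · simp
  · rw [BinForm.coord_of_le _ (by omega), if_neg (by omega)]

/-- In the matrix coefficients `G s j i`, compatibility with `h` fixes the value of `s + j - i`,
compatibility with `f` computes the column `j + 1` from the column `j`, and compatibility with `e`
is a one-term recursion along the column `j = 0`. Hence everything is determined by `G k 0 0`, and
the transvectant satisfies the same recursions. -/
theorem exists_smul_arrow [CharZero F] (hn : 1 ≤ n) (g : BinForm F (2 * n) →ₗ[F] Irr F b →ₗ[F] Irr F a)
    (hg : ∀ (A : SL2 F) p q, ⁅A, g p q⁆ = g ⁅A, p⁆ q + g p ⁅A, q⁆) (hne : g ≠ 0) :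
    ∃ k, k ≤ 2 * n - 1 ∧ k ≤ b ∧ a + 2 * k = 2 * n - 1 + b ∧
      ∃ c : F, c ≠ 0 ∧ ∀ p q, g p q = c • arrow n b a p q := by
  set m := 2 * n - 1 with hm
  have hnm : 2 * n = m + 1 := by omega
  set G : ℕ → ℕ → ℕ → F := fun s j i => (g (mono F (2 * n) s) (mono F (b + 1) j)).coord i with hG
  have hcast : ((2 * n : ℕ) : F) = (m : F) + 1 := by rw [hnm]; push_cast; ring
  have hH : ∀ s j i, G s j i ≠ 0 → a + 2 * (s + j) = m + b + 2 * i := by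
    intro s j i h
    have h1 := congrArg (BinForm.coord · i) (hg (slH F) (mono F (2 * n) s) (mono F (b + 1) j))
    simp only [lie_slH_mono, map_smul, LinearMap.smul_apply, BinForm.coord_add, BinForm.coord_smul,
      coord_lie_slH, hcast] at h1
    have h2 : ((a : F) + 2 * (s + j) - (m + b + 2 * i)) * G s j i = 0 := by
      simp only [hG]
      push_cast at h1
      linear_combination h1
    have h3 := (mul_eq_zero.mp h2).resolve_right h
    have h4 : ((a + 2 * (s + j) : ℕ) : F) = ((m + b + 2 * i : ℕ) : F) := by
      push_cast
      linear_combination h3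
    exact_mod_cast h4
  have hE : ∀ s i : ℕ, s ≤ m → ((i : F) + 1) * G s 0 (i + 1) = s * G (s - 1) 0 i := by
    intro s i hs
    have h1 := congrArg (BinForm.coord · i) (hg (slE F) (mono F (2 * n) s) (mono F (b + 1) 0))
    simp only [lie_slE_mono (by omega : s < 2 * n), lie_slE_mono (Nat.succ_pos b), map_smul,
      LinearMap.smul_apply, BinForm.coord_add, BinForm.coord_smul, coord_lie_slE] at h1
    simp only [hG]
    push_cast at h1
    linear_combination h1
  have hFv : ∀ s j, ⁅slF F, g (mono F (2 * n) s) (mono F (b + 1) j)⁆ =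
      ((m : F) - s) • g (mono F (2 * n) (s + 1)) (mono F (b + 1) j) +
      ((b : F) - j) • g (mono F (2 * n) s) (mono F (b + 1) (j + 1)) := by
    intro s j
    rw [hg, lie_slF_mono, lie_slF_mono, map_smul, map_smul, LinearMap.smul_apply, hcast]
    push_cast
    simp only [add_sub_cancel_right]
  have hF : ∀ s j i, ((b : F) - j) * G s (j + 1) i =
      (if i = 0 then 0 else ((a : F) + 1 - i) * G s j (i - 1)) - ((m : F) - s) * G (s + 1) j i := by
    intro s j i
    have h1 := congrArg (BinForm.coord · i) (hFv s j)
    simp only [BinForm.coord_add, BinForm.coord_smul, coord_lie_slF] at h1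
    simp only [hG]
    push_cast at h1
    rw [h1]
    ring
  -- If the column `j = 0` vanished, the `f`-recursion would make all columns vanish.
  obtain ⟨s₀, hs₀, i₀, hi₀⟩ : ∃ s₀, s₀ ≤ m ∧ ∃ i₀, G s₀ 0 i₀ ≠ 0 := by
    by_contra! hcon
    have h0 : ∀ j, j ≤ b → ∀ s, g (mono F (2 * n) s) (mono F (b + 1) j) = 0 := by
      intro j
      induction j with
      | zero =>
        intro _ s
        by_cases hs : s ≤ m
        · apply BinForm.ext_coord
          intro i
          rw [coord_zero]
          exact hcon s hs i
        · rw [mono_of_le (by omega), map_zero, LinearMap.zero_apply]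
      | succ j ih =>
        intro hj s
        have h1 := hFv s j
        rw [ih (by omega), ih (by omega), lie_zero, smul_zero, zero_add] at h1
        refine (smul_eq_zero.mp h1.symm).resolve_left ?_
        rw [sub_eq_zero]
        exact_mod_cast (by omega : b ≠ j)
    apply hne
    apply linearMap_ext_mono
    intro s _
    apply linearMap_ext_mono
    intro j hj
    exact h0 j (by omega) s
  -- The `e`-recursion lowers `s` and `i` together and stops with zero at `s = 0`.
  have hle : ∀ s i, s ≤ m → G s 0 i ≠ 0 → i ≤ s := by
    intro s
    induction s with
    | zero =>
      intro i _ h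
      rcases i with _ | i
      · exact le_rfl
      · have h1 := hE 0 i (Nat.zero_le _)
        rw [Nat.cast_zero, zero_mul] at h1
        have h2 : (i : F) + 1 ≠ 0 := by exact_mod_cast Nat.succ_ne_zero i
        exact absurd ((mul_eq_zero.mp h1).resolve_left h2) h
    | succ s ih =>
      intro i hs h
      rcases i with _ | i
      · exact Nat.zero_le _
      · have h1 := hE (s + 1) i hs
        have h2 : (i : F) + 1 ≠ 0 := by exact_mod_cast Nat.succ_ne_zero i
        have h3 : G s 0 i ≠ 0 := by
          intro h0
          rw [Nat.add_sub_cancel, h0, mul_zero] at h1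
          exact mul_ne_zero h2 h h1
        exact Nat.succ_le_succ (ih i (by omega) h3)
  have hup : ∀ t, s₀ + t ≤ m → G (s₀ + t) 0 (i₀ + t) ≠ 0 := by
    intro t
    induction t with
    | zero => intro _; exact hi₀
    | succ t ih =>
      intro ht h0
      have h1 := hE (s₀ + (t + 1)) (i₀ + t) ht
      change G (s₀ + t + 1) 0 (i₀ + t + 1) = 0 at h0
      rw [← add_assoc, h0, mul_zero, Nat.add_sub_cancel] at h1
      refine mul_ne_zero ?_ (ih (by omega)) h1.symm
      exact_mod_cast Nat.succ_ne_zero (s₀ + t)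
  have hi₀s := hle s₀ i₀ hs₀ hi₀
  have hw := hH _ _ _ hi₀
  obtain ⟨k, hk⟩ := Nat.exists_eq_add_of_le hi₀s
  have hka : a + 2 * k = m + b := by omega
  -- Pushing the nonzero coefficient up to `s = m` puts it at the index `i = m - k`, which must be
  -- at most `a = m + b - 2k`.
  have hkb : k ≤ b := by
    have h1 := hup (m - s₀) (by omega)
    by_contra hkb
    apply h1
    exact BinForm.coord_of_le _ (by omega)
  refine ⟨k, by omega, hkb, hka, ?_⟩
  have hC : arrowCoeff F m b k k 0 ≠ 0 := by
    rw [arrowCoeff_zero_right]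
    refine mul_ne_zero (pow_ne_zero _ (by simp)) ?_
    rw [Nat.cast_ne_zero]
    refine mul_ne_zero ?_ ?_ <;> rw [Ne, Nat.descFactorial_eq_zero_iff_lt] <;> omega
  -- The scalar is read off from the first nonzero coefficient, `w_k ⊗ w_0 ↦ w_0`.
  set c : F := G k 0 0 / arrowCoeff F m b k k 0 with hc
  have hbase : ∀ s, s ≤ m → ∀ i, G s 0 i =
      c * if s = i + k ∧ i ≤ a then arrowCoeff F m b k s 0 else 0 := by
    intro s hs i
    by_cases hsi : s = i + k
    · subst hsi
      rw [if_pos (by omega)]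
      clear_value m
      induction i with
      | zero =>
        rw [zero_add, hc]
        field_simp
      | succ i ih =>
        have h1 := hE (i + 1 + k) i hs
        have e1 : i + 1 + k - 1 = i + k := by omega
        rw [e1, ih (by omega)] at h1
        have h2 : (i : F) + 1 ≠ 0 := by exact_mod_cast Nat.succ_ne_zero i
        apply mul_left_cancel₀ h2
        rw [h1, arrowCoeff_zero_right, arrowCoeff_zero_right]
        have h3 := Nat.succ_descFactorial (i + k) k
        rw [show i + k + 1 - k = i + 1 by omega] at h3
        have h4 : ((i : F) + 1) * ((i + 1 + k).descFactorial k : F) =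
            ((i : F) + 1 + k) * ((i + k).descFactorial k : F) := by
          rw [show i + 1 + k = i + k + 1 by omega]
          have := congrArg (Nat.cast : ℕ → F) h3
          push_cast at this
          linear_combination this
        push_cast
        linear_combination (-c * (-1) ^ k * (b.descFactorial k : F)) * h4
    · rw [if_neg (by omega), mul_zero]
      by_contra h
      exact hsi (by have := hH _ _ _ h; omega)
  have hall : ∀ j, j ≤ b → ∀ s, s ≤ m → ∀ i, G s j i =
      c * if s + j = i + k ∧ i ≤ a then arrowCoeff F m b k s j else 0 := by
    intro j
    induction j with
    | zero => intro _ s hs i; exact hbase s hs i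
    | succ j ih =>
      intro hj s hs i
      have hbj : (b : F) - j ≠ 0 := by
        rw [sub_ne_zero]
        exact_mod_cast (by omega : b ≠ j)
      by_cases hsi : s + (j + 1) = i + k ∧ i ≤ a
      · rw [if_pos hsi]
        apply mul_left_cancel₀ hbj
        rw [hF]
        have e1 : ((m : F) - s) * G (s + 1) j i =
            ((m : F) - s) * (c * arrowCoeff F m b k (s + 1) j) := by
          rcases hs.eq_or_lt with rfl | hlt
          · simp
          · rw [ih (by omega) (s + 1) hlt, if_pos (by omega)]
        have e2 : (if i = 0 then 0 else ((a : F) + 1 - i) * G s j (i - 1)) =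
            c * (((m : F) - s + (b - j) - k) * arrowCoeff F m b k s j) := by
          split_ifs with h0
          · rw [arrowCoeff_eq_zero (by omega)]
            simp
          · rw [ih (by omega) s hs, if_pos (by omega)]
            have h5 : ((a + k + i : ℕ) : F) + 2 * k = ((m + b + (s + j + 1) : ℕ) : F) := by
              have : a + k + i + 2 * k = m + b + (s + j + 1) := by omega
              exact_mod_cast this
            have h6 : (i : F) + k = s + (j + 1) := by exact_mod_cast hsi.1.symm
            push_cast at h5
            linear_combination (c * arrowCoeff F m b k s j) * (h5 - 2 * h6)
        rw [e1, e2, ← arrowCoeff_lower k hs (by omega : j ≤ b)]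
        ring
      · rw [if_neg hsi, mul_zero]
        by_contra h
        have := hH _ _ _ h
        have h7 : i ≤ a := by
          by_contra h8
          exact h (BinForm.coord_of_le _ (by omega))
        omega
  have heq : g = c • arrowL F n b a := by
    apply linearMap_ext_mono
    intro s hs
    apply linearMap_ext_mono
    intro j hj
    apply BinForm.ext_coord
    intro i
    rw [LinearMap.smul_apply, LinearMap.smul_apply, arrowL_apply, BinForm.coord_smul,
      coord_arrow_mono hka hs (by omega)]
    exact hall j (by omega) s (by omega) i
  refine ⟨c, ?_, fun p q => by rw [heq]; rfl⟩
  rintro hc0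
  exact hne (by rw [heq, hc0, zero_smul])

end Arrow


/-! ### The commutation relation determines the weights -/

section Classification

/-- Up to a common factor, the eigenvalue of `arrow w_t ∘ arrow w_(m-t)` on the highest weight
vector, where `α = a₀ - k`. -/
def eigenFactor (m k α t : ℕ) : ℕ :=
  (m - t).descFactorial k * (m - t).descFactorial (m - k - t) * (α + t).descFactorial t

set_option maxHeartbeats 800000 in
-- Only the values at `t = 0, 1, 2`, and one middle value to get `k ≤ n`, need to be compared. The
-- term with index `m - t` contains the factor `t.descFactorial k`, so it is absent for `t < k`; the
-- larger `k` is, the simpler the equations become.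
theorem weights_of_eigenFactor_constant {n k α N : ℕ} (hn : 1 < n) (hN : N ≠ 0)
    (hk : k ≤ 2 * n - 1)
    (h : ∀ t ≤ 2 * n - 1, (2 * n - 1).choose t * (eigenFactor (2 * n - 1) k α t +
      eigenFactor (2 * n - 1) k α (2 * n - 1 - t)) = N) :
    (k = 0 ∧ α ≤ 1) ∨ (k = 1 ∧ α = 0) ∨ (n = 2 ∧ k = 2 ∧ α = 2) := by
  obtain ⟨m, hm⟩ : ∃ m, m = 2 * n - 1 := ⟨_, rfl⟩
  rw [← hm] at h hk
  -- For `k > n` both terms vanish at the middle index `t = n - 1`.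
  have hkn : k ≤ n := by
    by_contra hkn
    have h1 := h (n - 1) (by omega)
    simp only [eigenFactor] at h1
    rw [Nat.descFactorial_of_lt (by omega : m - (n - 1) < k),
      Nat.descFactorial_of_lt (by omega : m - (m - (n - 1)) < k)] at h1
    simp at h1
    exact hN h1.symm
  have h0 := h 0 (by omega)
  have h1 := h 1 (by omega)
  have h2 := h 2 (by omega)
  have e1 : m - (m - 1) = 1 := by omega
  have e2 : m - (m - 2) = 2 := by omega
  simp only [eigenFactor, Nat.choose_zero_right, one_mul, Nat.sub_zero, add_zero, Nat.sub_self,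
    Nat.descFactorial_zero, mul_one, Nat.choose_one_right, e1, e2, Nat.descFactorial_one] at h0 h1 h2
  rcases k with _ | _ | _ | k
  -- With `p = m - 1`, the difference of the values at `t = 0` and `t = 1` gives `(α + p)_p = (p +
  -- 1)!` unless `α = 0`. For `α ≥ 2` the left side is at least `(p + 2)! / 2`, which is too large.
  · left
    refine ⟨rfl, ?_⟩
    by_contra hα
    simp only [Nat.descFactorial_zero, one_mul, Nat.sub_zero, e1, Nat.sub_self,
      Nat.descFactorial_self] at h0 h1
    obtain ⟨p, rfl⟩ : ∃ p, m = p + 1 := ⟨m - 1, by omega⟩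
    simp only [Nat.add_sub_cancel, ← Nat.add_assoc] at h0 h1
    rw [Nat.succ_descFactorial_succ, Nat.factorial_succ] at h0
    rw [Nat.factorial_zero, one_mul, one_mul] at h0
    rw [Nat.factorial_one, one_mul] at h1
    have h3 := Nat.descFactorial_le p (by omega : p + 2 ≤ α + p)
    have h4 := Nat.factorial_mul_descFactorial (by omega : p ≤ p + 2)
    rw [Nat.add_sub_cancel_left, Nat.factorial_two, Nat.factorial_succ (p + 1),
      Nat.factorial_succ p] at h4
    have h5 : 0 < p.factorial := Nat.factorial_pos p
    have h6 : α * (α + p).descFactorial p = α * ((p + 1) * p.factorial) := by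
      linarith only [h0, h1]
    have h7 := Nat.eq_of_mul_eq_mul_left (by omega) h6
    rw [h7] at h3
    have h8 : 2 * ((p + 1) * p.factorial) < (p + 1 + 1) * ((p + 1) * p.factorial) :=
      Nat.mul_lt_mul_of_pos_right (by omega) (by positivity)
    linarith only [h3, h4, h8]
  -- With `p = m - 2`, the two values give `(p + 2) (p + 1)! = (p + 1) (α + 1) (p + 1)! + (α + p +
  -- 1)_(p+1)`; the right side is too large when `α ≥ 1`.
  · right; left
    refine ⟨rfl, ?_⟩
    by_contra hα
    simp only [zero_add, Nat.descFactorial_one, zero_mul, add_zero, one_mul] at h0 h1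
    obtain ⟨p, rfl⟩ : ∃ p, m = p + 2 := ⟨m - 2, by omega⟩
    have e3 : p + 2 - 1 = p + 1 := by omega
    have e4 : p + 2 - 1 - 1 = p := by omega
    have e5 : p + 2 - 1 - (p + 2 - 1) = 0 := by omega
    rw [e5, Nat.descFactorial_zero, one_mul] at h1
    rw [e3] at h0 h1
    rw [Nat.add_sub_cancel] at h1
    have h3 := Nat.descFactorial_le (p + 1) (by omega : p + 1 ≤ α + (p + 1))
    rw [Nat.descFactorial_self] at h3
    have h4 := Nat.factorial_mul_descFactorial (by omega : p + 1 ≤ p + 2)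
    have h5 := Nat.factorial_mul_descFactorial (by omega : p ≤ p + 1)
    rw [show p + 2 - (p + 1) = 1 by omega, Nat.factorial_one, one_mul,
      Nat.factorial_succ (p + 1)] at h4
    rw [Nat.add_sub_cancel_left, Nat.factorial_one, one_mul] at h5
    rw [h4, ← h1] at h0
    rw [h5] at h0
    have h6 : 0 < (p + 1).factorial := Nat.factorial_pos _
    have h7 := Nat.eq_of_mul_eq_mul_left (by omega) h0
    have h8 : 1 ≤ α := by omega
    have h9 : (p + 1) * (1 + 1) * (p + 1).factorial ≤ (p + 1) * (α + 1) * (p + 1).factorial := by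
      gcongr
    have h10 : 0 < p * (p + 1).factorial := Nat.mul_pos (by omega) h6
    linarith only [h3, h7, h9, h10]
  -- Here the two values reduce to `m = (m - 2) (α + 1)`, and `m` is odd, so `m = 3` and `α = 2`.
  -- This is the exceptional module.
  · right; right
    simp only [zero_add, Nat.reduceAdd, Nat.descFactorial_of_lt Nat.zero_lt_two,
      Nat.descFactorial_of_lt Nat.one_lt_two, zero_mul, add_zero] at h0 h1
    obtain ⟨p, rfl⟩ : ∃ p, m = p + 3 := ⟨m - 3, by omega⟩
    rw [show p + 3 - 2 = p + 1 by omega] at h0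
    rw [show p + 3 - 1 = p + 2 by omega, show p + 3 - 2 - 1 = p by omega] at h1
    have h4 := Nat.factorial_mul_descFactorial (by omega : p + 1 ≤ p + 3)
    have h5 := Nat.factorial_mul_descFactorial (by omega : p ≤ p + 2)
    rw [show p + 3 - (p + 1) = 2 by omega, Nat.factorial_succ (p + 2)] at h4
    rw [show p + 2 - p = 2 by omega] at h5
    have h6 : 0 < (p + 2).factorial := Nat.factorial_pos _
    have h7 : (p + 3).descFactorial 2 = (p + 3) * (p + 2) := by
      simp [Nat.descFactorial_succ]; ring
    have h8 : (p + 2).descFactorial 2 = (p + 2) * (p + 1) := by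
      simp [Nat.descFactorial_succ]; ring
    rw [h7] at h0
    rw [h8] at h1
    simp only [Nat.factorial_two] at h4 h5
    have h9 : ((p + 3) * (p + 2) * (p + 2).factorial) * (p + 3) =
        ((p + 3) * (p + 2) * (p + 2).factorial) * ((p + 1) * (α + 1)) := by
      calc _ = 2 * N := by rw [← h0, mul_left_comm, h4]; ring
        _ = ((p + 3) * (p + 2) * (2 * (p + 2).descFactorial p)) * ((p + 1) * (α + 1)) := by
          rw [← h1]; ring
        _ = _ := by rw [h5]
    have h10 := Nat.eq_of_mul_eq_mul_left (by positivity) h9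
    have h11 : α ≤ 2 := by
      by_contra hα
      have := Nat.mul_le_mul_left (p + 1) (by omega : 4 ≤ α + 1)
      linarith only [this, h10]
    clear * - h10 h11 hm
    interval_cases α <;> omega
  -- With `K = k` after renaming and `d = m - 2 - K`, consecutive values give `m = (d + 2) (α + 1)`
  -- and `2 (m - 1) = (d + 1) (α + 2)`. Together they yield `α (d + 3) = 0`, hence `α = 0` and `K =
  -- 0`.
  · exfalso
    obtain ⟨K, hK⟩ : ∃ K, K = k + 1 + 1 + 1 := ⟨_, rfl⟩
    rw [← hK] at h0 h1 h2 hkn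
    rw [Nat.descFactorial_of_lt (by omega : 0 < K)] at h0
    rw [Nat.descFactorial_of_lt (by omega : 1 < K)] at h1
    rw [Nat.descFactorial_of_lt (by omega : 2 < K)] at h2
    simp only [zero_mul, add_zero] at h0 h1 h2
    obtain ⟨d, rfl⟩ : ∃ d, m = d + 2 + K := ⟨m - 2 - K, by omega⟩
    rw [Nat.add_sub_cancel] at h0
    rw [show d + 2 + K - 1 = d + 1 + K by omega, show d + 2 + K - K - 1 = d + 1 by omega] at h1
    rw [show d + 2 + K - 2 = d + K by omega, show d + 2 + K - K - 2 = d by omega] at h2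
    have f0 := Nat.factorial_mul_descFactorial (by omega : d + 2 ≤ d + 2 + K)
    have f1 := Nat.factorial_mul_descFactorial (by omega : d + 1 ≤ d + 1 + K)
    have f2 := Nat.factorial_mul_descFactorial (by omega : d ≤ d + K)
    rw [Nat.add_sub_cancel_left] at f0 f1 f2
    have g1 := Nat.succ_descFactorial (d + 1 + K) K
    have g2 := Nat.succ_descFactorial (d + K) K
    rw [show d + 1 + K + 1 = d + 2 + K by omega, show d + 2 + K - K = d + 2 by omega] at g1
    rw [show d + K + 1 = d + 1 + K by omega, show d + 1 + K - K = d + 1 by omega] at g2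
    have c2 : 2 * (d + 2 + K).choose 2 = (d + 2 + K) * (d + 1 + K) := by
      have := Nat.descFactorial_eq_factorial_mul_choose (d + 2 + K) 2
      rw [Nat.factorial_two] at this
      rw [← this, show d + 2 + K = d + 1 + K + 1 by omega, Nat.succ_descFactorial_succ,
        Nat.descFactorial_one]
    have k2 : (α + 2).descFactorial 2 = (α + 2) * (α + 1) := by
      rw [Nat.succ_descFactorial_succ, Nat.descFactorial_one]
    have fa : (d + 2 + K).factorial = (d + 2 + K) * (d + 1 + K).factorial := by
      rw [show d + 2 + K = d + 1 + K + 1 by omega, Nat.factorial_succ]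
    have fb : (d + 1 + K).factorial = (d + 1 + K) * (d + K).factorial := by
      rw [show d + 1 + K = d + K + 1 by omega, Nat.factorial_succ]
    rw [k2] at h2
    have p0 : 0 < (d + K).factorial := Nat.factorial_pos _
    have p1 : 0 < (d + 1 + K).descFactorial K := Nat.descFactorial_pos.mpr (by omega)
    have p2 : 0 < (d + K).descFactorial K := Nat.descFactorial_pos.mpr (by omega)
    have i1 : ((d + 1 + K).descFactorial K * (d + 2 + K) * (d + 1 + K).factorial) * (d + 2 + K) =
        ((d + 1 + K).descFactorial K * (d + 2 + K) * (d + 1 + K).factorial) *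
          ((d + 2) * (α + 1)) := by
      calc _ = (d + 2) * (d + 2 + K).descFactorial K * (d + 2 + K).factorial := by
            rw [g1, fa]; ring
        _ = (d + 2) * K.factorial * N := by rw [← h0, ← f0]; ring
        _ = (d + 2) * ((d + 2 + K) * ((d + 1 + K).descFactorial K *
            (K.factorial * (d + 1 + K).descFactorial (d + 1)) * (α + 1))) := by
            rw [← h1]; ring
        _ = _ := by rw [f1]; ring
    have j1 := Nat.eq_of_mul_eq_mul_left (by positivity) i1
    have i2 : ((d + K).descFactorial K * (d + 2 + K) * (d + 1 + K) * (d + K).factorial * (α + 1)) *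
          (2 * (d + 1 + K)) =
        ((d + K).descFactorial K * (d + 2 + K) * (d + 1 + K) * (d + K).factorial * (α + 1)) *
          ((d + 1) * (α + 2)) := by
      calc _ = 2 * (d + 2 + K) * ((d + 1) * (d + 1 + K).descFactorial K) *
              (d + 1 + K).factorial * (α + 1) := by rw [g2, fb]; ring
        _ = 2 * (d + 1) * K.factorial * N := by rw [← h1, ← f1]; ring
        _ = (d + 1) * (2 * (d + 2 + K).choose 2) * ((d + K).descFactorial K *
            (K.factorial * (d + K).descFactorial d) * ((α + 2) * (α + 1))) := by
            rw [← h2]; ring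
        _ = _ := by rw [f2, c2]; ring
    have j2 := Nat.eq_of_mul_eq_mul_left (by positivity) i2
    have j3 : α * (d + 3) = 0 := by linarith only [j1, j2]
    have j4 : α = 0 := by simpa using j3
    rw [j4, zero_add, mul_one] at j1
    clear * - hK j1
    omega

variable {F : Type*} [Field F]

theorem invForm_mono {d t s : ℕ} (h : t + s + 1 = d) :
    invForm (mono F d t) (mono F d s) = (-1) ^ t * (((d - 1).choose t : ℕ) : F)⁻¹ := by
  rw [invForm_eq_range, Finset.sum_eq_single t]
  · rw [coord_mono, coord_mono, if_pos (by omega), if_pos (by omega), mul_one, mul_one]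
  · intro i _ hi
    rw [coord_mono, if_neg (by omega), mul_zero, zero_mul]
  · intro h'
    simp at h'
    omega

theorem invForm_mono_last {n : ℕ} (hn : 1 ≤ n) :
    invForm (mono F (2 * n) 0) (mono F (2 * n) (2 * n - 1)) = 1 := by
  rw [invForm_mono (by omega)]
  simp

theorem arrow_mono {n a b k s j : ℕ} (hk : a + 2 * k = 2 * n - 1 + b) (hs : s < 2 * n)
    (hj : j ≤ b) : arrow n b a (mono F (2 * n) s) (mono F (b + 1) j) =
      arrowCoeff F (2 * n - 1) b k s j • mono F (a + 1) (s + j - k) := by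
  apply BinForm.ext_coord
  intro i
  rw [coord_arrow_mono hk hs hj, BinForm.coord_smul, coord_mono]
  by_cases h : s + j < k
  · rw [arrowCoeff_eq_zero h]
    simp
  · by_cases h' : s + j = i + k ∧ i ≤ a
    · rw [if_pos h', if_pos (by omega), mul_one]
    · rw [if_neg h', if_neg (by omega), mul_zero]

/-- The product `w_t w_(m-t)` has weight zero, so it multiplies the highest weight vector by a
scalar. Both structure constants involved are extremal, one having source `w_0` and the other target
`w_0`, so their sums collapse to single terms. -/
theorem coord_zero_arrow_arrow {n a₀ a₁ k t : ℕ} (hk : k ≤ 2 * n - 1) (hka : k ≤ a₀)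
    (h1 : a₁ + 2 * k = 2 * n - 1 + a₀) (hn : 1 ≤ n) (ht : t ≤ 2 * n - 1) :
    (arrow n a₁ a₀ (mono F (2 * n) t) (arrow n a₀ a₁ (mono F (2 * n) (2 * n - 1 - t))
      (mono F (a₀ + 1) 0))).coord 0 = (-1) ^ t * ((-1) ^ k * (a₀.descFactorial k : F) *
        ((2 * n - 1 - k).factorial : F)) * (eigenFactor (2 * n - 1) k (a₀ - k) t : F) := by
  have hk' : a₀ + 2 * (2 * n - 1 - k) = 2 * n - 1 + a₁ := by omega
  rw [arrow_mono h1 (by omega) (Nat.zero_le _), ← arrowL_apply, map_smul, arrowL_apply,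
    BinForm.coord_smul, arrowCoeff_zero_right, eigenFactor]
  by_cases htk : 2 * n - 1 - t < k
  · rw [Nat.descFactorial_of_lt htk]
    simp
  · rw [coord_arrow_mono hk' (by omega) (by omega), if_pos (by omega),
      arrowCoeff_of_add_eq (by omega), show 2 * n - 1 - t + 0 - k = 2 * n - 1 - k - t by omega,
      show a₁ - (2 * n - 1 - k - t) = a₀ - k + t by omega]
    push_cast
    ring

/-- The commutation relation of the Heisenberg algebra determines the weights. -/
theorem weights_of_commutator [CharZero F] {n a₀ a₁ k : ℕ} (hn : 1 < n) (hk : k ≤ 2 * n - 1)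
    (hka : k ≤ a₀) (h1 : a₁ + 2 * k = 2 * n - 1 + a₀) {c : F} (hc : c ≠ 0)
    (h : ∀ (p q : BinForm F (2 * n)) (v : Irr F a₀),
      arrow n a₁ a₀ p (arrow n a₀ a₁ q v) - arrow n a₁ a₀ q (arrow n a₀ a₁ p v) =
        (invForm p q * c) • v) :
    (k = 0 ∧ a₀ ≤ 1) ∨ (k = 1 ∧ a₀ = 1) ∨ (n = 2 ∧ a₀ = 4 ∧ a₁ = 3) := by
  set m := 2 * n - 1 with hm
  set K : F := (-1) ^ k * (a₀.descFactorial k : F) * ((m - k).factorial : F) with hK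
  have hK0 : K ≠ 0 := by
    refine mul_ne_zero (mul_ne_zero (pow_ne_zero _ (by simp)) ?_) ?_
    · rw [Nat.cast_ne_zero, Ne, Nat.descFactorial_eq_zero_iff_lt]
      omega
    · exact_mod_cast (m - k).factorial_ne_zero
  -- Evaluate the commutator of `w_t` and `w_(m-t)` on the highest weight vector. Since `m` is odd,
  -- the signs `(-1)^t` and `(-1)^(m-t)` are opposite and the difference becomes a sum; the value of
  -- the form contributes the binomial coefficient.
  have key : ∀ t ≤ m, ((m.choose t * (eigenFactor m k (a₀ - k) t +
      eigenFactor m k (a₀ - k) (m - t)) : ℕ) : F) = c / K := by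
    intro t ht
    have h2 := congrArg (BinForm.coord · 0)
      (h (mono F (2 * n) t) (mono F (2 * n) (m - t)) (mono F (a₀ + 1) 0))
    simp only [sub_eq_add_neg, ← neg_one_smul F (arrow n a₁ a₀ _ _), BinForm.coord_add,
      BinForm.coord_smul] at h2
    rw [coord_zero_arrow_arrow hk hka h1 hn.le ht] at h2
    have h3 := coord_zero_arrow_arrow (F := F) hk hka h1 hn.le (Nat.sub_le m t)
    rw [← hm, Nat.sub_sub_self ht] at h3
    rw [h3, invForm_mono (by omega), coord_mono, if_pos (by omega), ← hm, ← hK] at h2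
    have h4 : (-1 : F) ^ (m - t) = -(-1) ^ t := by
      have : (-1 : F) ^ (m - t) * (-1) ^ t = -1 := by
        rw [← pow_add, Nat.sub_add_cancel ht]
        exact Odd.neg_one_pow ⟨n - 1, by omega⟩
      have h5 : (-1 : F) ^ t * (-1) ^ t = 1 := by rw [← mul_pow]; simp
      linear_combination (-1) ^ t * this - (-1) ^ (m - t) * h5
    have h5 : (m.choose t : F) ≠ 0 := by
      exact_mod_cast (Nat.choose_pos ht).ne'
    have h6 : (-1 : F) ^ t ≠ 0 := pow_ne_zero _ (by simp)
    rw [h4] at h2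
    rw [eq_div_iff hK0]
    apply mul_left_cancel₀ h6
    push_cast
    have h7 : (m.choose t : F) * (m.choose t : F)⁻¹ = 1 := mul_inv_cancel₀ h5
    linear_combination (m.choose t : F) * h2 + (-1) ^ t * c * h7
  obtain ⟨N, hN⟩ : ∃ N : ℕ, (N : F) = c / K := ⟨_, key 0 (Nat.zero_le _)⟩
  have hN0 : N ≠ 0 := by
    rintro rfl
    rw [Nat.cast_zero] at hN
    exact div_ne_zero hc hK0 hN.symm
  rcases weights_of_eigenFactor_constant (α := a₀ - k) hn hN0 hk
    (fun t ht => by exact_mod_cast (key t ht).trans hN.symm) with h | h | h <;> omega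

end Classification


/-! ### Brackets in `sl(2) ⋉ h_n` -/

section Brackets

variable {F : Type*} [Field F] [CharZero F] {n : ℕ}

/-- The element `p` of `V(2n-1) ⊆ h_n`, as an element of `sl(2) ⋉ h_n`. -/
abbrev heisVec (p : BinForm F (2 * n)) : SlHeis F n := inHeis (Heis.mk p (0 : F))

/-- The central element `z` of `h_n`, as an element of `sl(2) ⋉ h_n`. -/
abbrev heisZ (F : Type*) [Field F] [CharZero F] (n : ℕ) : SlHeis F n :=
  inHeis (Heis.mk (0 : BinForm F (2 * n)) 1)

theorem lie_inSl_inHeis (A : SL2 F) (y : Heis F n) : ⁅inSl n A, inHeis y⁆ = heisVec ⁅A, y.1⁆ := by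
  apply LieAlgebra.SemiDirectSum.ext
  · change ⁅(0 : Heis F n), y⁆ + slDer F n A y - slDer F n 0 0 = _
    rw [zero_lie, zero_add, map_zero, sub_zero]
    rfl
  · change ⁅A, (0 : SL2 F)⁆ = 0
    exact lie_zero A

theorem lie_heisVec_heisVec (p q : BinForm F (2 * n)) :
    ⁅heisVec p, heisVec q⁆ = invForm p q • heisZ F n := by
  rw [← LieHom.map_lie, ← map_smul]
  congr 1
  exact Prod.ext (smul_zero _).symm (mul_one _).symm

theorem lie_inSl_heisZ (A : SL2 F) : ⁅inSl n A, heisZ F n⁆ = 0 := by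
  rw [lie_inSl_inHeis]
  change inHeis (Heis.mk ⁅A, (0 : BinForm F (2 * n))⁆ (0 : F)) = 0
  rw [lie_zero]
  exact map_zero _

theorem heisVec_add (p q : BinForm F (2 * n)) : heisVec (p + q) = heisVec p + heisVec q := by
  rw [← map_add]
  exact congrArg inHeis (Prod.ext rfl (add_zero _).symm)

theorem heisVec_smul (c : F) (p : BinForm F (2 * n)) : heisVec (c • p) = c • heisVec p := by
  rw [← map_smul]
  exact congrArg inHeis (Prod.ext rfl (smul_zero _).symm)

theorem inHeis_eq (y : Heis F n) : inHeis y = heisVec y.1 + y.2 • heisZ F n := by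
  rw [← map_smul, ← map_add]
  congr 1
  refine Prod.ext ?_ ?_
  · exact ((congrArg (y.1 + ·) (smul_zero y.2)).trans (add_zero _)).symm
  · exact ((zero_add _).trans (mul_one _)).symm

theorem slHeis_eq (g : SlHeis F n) : g = inHeis g.left + inSl n g.right := by
  apply LieAlgebra.SemiDirectSum.ext
  · exact (add_zero _).symm
  · exact (zero_add _).symm

theorem heisZ_ne_zero : heisZ F n ≠ 0 := by
  intro h
  have h1 := congrArg (fun g : SlHeis F n => g.left.2) h
  exact one_ne_zero h1

theorem heisZ_eq_lie (hn : 1 ≤ n) :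
    heisZ F n = ⁅heisVec (mono F (2 * n) 0), heisVec (mono F (2 * n) (2 * n - 1))⁆ := by
  rw [lie_heisVec_heisVec, invForm_mono_last hn, one_smul]

end Brackets

/-! ### Schur's lemma -/

section Schur

variable {F : Type*} [Field F] [CharZero F]

/-- Schur's lemma for the modules `V(a)`. -/
theorem exists_eq_smul_of_equivariant {a b : ℕ} (Z : Irr F a →ₗ[F] Irr F b)
    (hZ : ∀ (A : SL2 F) v, Z ⁅A, v⁆ = ⁅A, Z v⁆) (hne : Z ≠ 0) :
    a = b ∧ ∃ c : F, ∀ v k, (Z v).coord k = c * v.coord k := by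
  set c := (Z (mono F (a + 1) 0)).coord 0 with hc
  have h0 : Z (mono F (a + 1) 0) = c • mono F (b + 1) 0 := by
    apply eq_smul_mono_zero_of_lie_slE
    rw [← hZ, lie_slE_mono (Nat.succ_pos a)]
    simp
  have hF : ∀ k : ℕ, ((a : F) - k) • Z (mono F (a + 1) (k + 1)) = ⁅slF F, Z (mono F (a + 1) k)⁆ := by
    intro k
    rw [← hZ, lie_slF_mono, map_smul]
    push_cast
    rw [add_sub_cancel_right]
  have hak : ∀ k < a, (a : F) - k ≠ 0 := by
    intro k hk
    rw [sub_ne_zero]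
    exact_mod_cast hk.ne'
  have hc0 : c ≠ 0 := by
    intro hc0
    apply hne
    apply linearMap_ext_mono
    intro k
    induction k with
    | zero => intro _; rw [h0, hc0, zero_smul, LinearMap.zero_apply]
    | succ k ih =>
      intro hk
      have h1 := hF k
      rw [ih (by omega), LinearMap.zero_apply, lie_zero] at h1
      rw [LinearMap.zero_apply]
      exact (smul_eq_zero.mp h1).resolve_left (hak k (by omega))
  have hab : a = b := by
    have h1 := hZ (slH F) (mono F (a + 1) 0)
    rw [h0, lie_smul, lie_slH_mono, lie_slH_mono, map_smul, h0] at h1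
    have h2 := congrArg (BinForm.coord · 0) h1
    simp only [BinForm.coord_smul, coord_mono] at h2
    simp only [true_and, if_pos (Nat.succ_pos b)] at h2
    have h3 : c * ((a : F) - b) = 0 := by
      push_cast at h2
      linear_combination h2
    have h4 := sub_eq_zero.mp ((mul_eq_zero.mp h3).resolve_left hc0)
    exact_mod_cast h4
  subst hab
  refine ⟨rfl, c, ?_⟩
  have h2 : Z = c • LinearMap.id := by
    apply linearMap_ext_mono
    intro k
    induction k with
    | zero => intro _; rw [h0]; rfl
    | succ k ih =>
      intro hk
      have h1 := hF k
      rw [ih (by omega), LinearMap.smul_apply, LinearMap.id_apply, lie_smul, lie_slF_mono] at h1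
      push_cast at h1
      rw [add_sub_cancel_right, smul_comm] at h1
      exact smul_right_injective _ (hak k (by omega)) h1
  intro v k
  rw [h2, LinearMap.smul_apply, BinForm.coord_smul, LinearMap.id_apply]

end Schur

/-! ### From a three-step filtration to `FU_(a₀, a₁, a₀)` -/

section Model

/-- An isomorphism of `V` with `FU_(a₀, a₁, a₀)`. -/
structure FUModel (F : Type*) [Field F] [CharZero F] (n : ℕ) (V : Type*) [AddCommGroup V]
    [Module F V] [LieRingModule (SlHeis F n) V] (a₀ a₁ : ℕ) where
  equiv : V ≃ₗ[F] Irr F a₀ × Irr F a₁ × Irr F a₀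
  equiv_sl : ∀ (A : SL2 F) (v : V),
    equiv ⁅inSl n A, v⁆ = (⁅A, (equiv v).1⁆, ⁅A, (equiv v).2.1⁆, ⁅A, (equiv v).2.2⁆)
  equiv_heis : ∀ (p : BinForm F (2 * n)) (v : V),
    equiv ⁅heisVec p, v⁆ = (arrow n a₁ a₀ p (equiv v).2.1, arrow n a₀ a₁ p (equiv v).2.2, 0)
  zScalar : F
  zScalar_ne_zero : zScalar ≠ 0
  equiv_z : ∀ v : V, equiv ⁅heisZ F n, v⁆ = (zScalar • (equiv v).2.2, 0, 0)

theorem FUModel.isFU {F : Type*} [Field F] [CharZero F] {n : ℕ} {V : Type*} [AddCommGroup V]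
    [Module F V] [LieRingModule (SlHeis F n) V] {a₀ a₁ : ℕ} (M : FUModel F n V a₀ a₁) :
    IsFU (F := F) n V a₀ a₁ :=
  ⟨M.equiv, M.equiv_sl, M.equiv_heis, M.zScalar, M.zScalar_ne_zero, M.equiv_z⟩

variable {F : Type*} [Field F] [CharZero F] {n : ℕ} {V : Type*} [AddCommGroup V] [Module F V]
  [LieRingModule (SlHeis F n) V] [LieModule F (SlHeis F n) V]

/-- The component `V(b) → V(a)` of the action of `V(2n-1) ⊆ h_n`. -/
def heisComponent {a b : ℕ} (π : V →ₗ[F] Irr F a) (α : Irr F b →ₗ[F] V) :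
    BinForm F (2 * n) →ₗ[F] Irr F b →ₗ[F] Irr F a :=
  LinearMap.mk₂ F (fun p q => π ⁅heisVec p, α q⁆)
    (fun p p' q => by rw [heisVec_add, add_lie, map_add])
    (fun c p q => by rw [heisVec_smul, smul_lie, map_smul])
    (fun p q q' => by rw [map_add, lie_add, map_add])
    (fun c p q => by rw [map_smul, lie_smul, map_smul])

theorem lie_heisComponent {a b : ℕ} (π : V →ₗ[F] Irr F a) (α : Irr F b →ₗ[F] V)
    (hπ : ∀ (A : SL2 F) v, π ⁅inSl n A, v⁆ = ⁅A, π v⁆)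
    (hα : ∀ (A : SL2 F) v, α ⁅A, v⁆ = ⁅inSl n A, α v⁆) (A : SL2 F) (p : BinForm F (2 * n))
    (q : Irr F b) : ⁅A, heisComponent π α p q⁆ =
      heisComponent π α ⁅A, p⁆ q + heisComponent π α p ⁅A, q⁆ := by
  change ⁅A, π ⁅heisVec p, α q⁆⁆ = π ⁅heisVec ⁅A, p⁆, α q⁆ + π ⁅heisVec p, α ⁅A, q⁆⁆
  rw [← hπ, leibniz_lie, lie_inSl_inHeis, map_add, hα]
  rfl

/-- A nonzero map would need `a + 2k = m + a`, but `m` is odd. -/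
theorem heisComponent_self {a : ℕ} (hn : 1 ≤ n) (π : V →ₗ[F] Irr F a) (α : Irr F a →ₗ[F] V)
    (hπ : ∀ (A : SL2 F) v, π ⁅inSl n A, v⁆ = ⁅A, π v⁆)
    (hα : ∀ (A : SL2 F) v, α ⁅A, v⁆ = ⁅inSl n A, α v⁆) (p : BinForm F (2 * n)) (q : Irr F a) :
    π ⁅heisVec p, α q⁆ = 0 := by
  have h : heisComponent (n := n) π α = 0 := by
    by_contra h
    obtain ⟨k, _, _, hk, _⟩ := exists_smul_arrow hn _ (lie_heisComponent π α hπ hα) h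
    omega
  exact LinearMap.congr_fun (LinearMap.congr_fun h p) q

/-- A faithful module `V(a₀) ⊕ V(a₁) ⊕ V(a₂)` filtered by submodules is isomorphic to
`FU_(a₀, a₁, a₀)`. -/
theorem exists_fuModel_of_filtration (hn : 1 ≤ n) (hf : LieModule.IsFaithful F (SlHeis F n) V)
    {a₀ a₁ a₂ : ℕ} (Φ : V ≃ₗ[F] Irr F a₀ × Irr F a₁ × Irr F a₂)
    (hΦ : ∀ (A : SL2 F) (v : V), Φ ⁅inSl n A, v⁆ = (⁅A, (Φ v).1⁆, ⁅A, (Φ v).2.1⁆, ⁅A, (Φ v).2.2⁆))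
    (h₀ : ∀ g : SlHeis F n, ∀ v, (Φ v).2.1 = 0 → (Φ v).2.2 = 0 →
      (Φ ⁅g, v⁆).2.1 = 0 ∧ (Φ ⁅g, v⁆).2.2 = 0)
    (h₁ : ∀ g : SlHeis F n, ∀ v, (Φ v).2.2 = 0 → (Φ ⁅g, v⁆).2.2 = 0) :
    a₂ = a₀ ∧ ∃ k, k ≤ 2 * n - 1 ∧ k ≤ a₀ ∧ a₁ + 2 * k = 2 * n - 1 + a₀ ∧
      ∃ M : FUModel F n V a₀ a₁, ∀ v,
        ((M.equiv v).1 = 0 ↔ (Φ v).1 = 0) ∧ ((M.equiv v).2.1 = 0 ↔ (Φ v).2.1 = 0) ∧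
        ((M.equiv v).2.2 = 0 ↔ (Φ v).2.2 = 0) := by
  set π₀ : V →ₗ[F] Irr F a₀ := LinearMap.fst F _ _ ∘ₗ Φ.toLinearMap with hπ₀
  set π₁ : V →ₗ[F] Irr F a₁ := LinearMap.fst F _ _ ∘ₗ LinearMap.snd F _ _ ∘ₗ Φ.toLinearMap with hπ₁
  set π₂ : V →ₗ[F] Irr F a₂ := LinearMap.snd F _ _ ∘ₗ LinearMap.snd F _ _ ∘ₗ Φ.toLinearMap with hπ₂
  set α₀ : Irr F a₀ →ₗ[F] V := Φ.symm.toLinearMap ∘ₗ LinearMap.inl F _ _ with hα₀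
  set α₁ : Irr F a₁ →ₗ[F] V := Φ.symm.toLinearMap ∘ₗ LinearMap.inr F _ _ ∘ₗ LinearMap.inl F _ _
    with hα₁
  set α₂ : Irr F a₂ →ₗ[F] V := Φ.symm.toLinearMap ∘ₗ LinearMap.inr F _ _ ∘ₗ LinearMap.inr F _ _
    with hα₂
  have hΦα₀ : ∀ q, Φ (α₀ q) = (q, 0, 0) := fun q => Φ.apply_symm_apply _
  have hΦα₁ : ∀ q, Φ (α₁ q) = (0, q, 0) := fun q => Φ.apply_symm_apply _
  have hΦα₂ : ∀ q, Φ (α₂ q) = (0, 0, q) := fun q => Φ.apply_symm_apply _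
  have hsum : ∀ v, v = α₀ (Φ v).1 + α₁ (Φ v).2.1 + α₂ (Φ v).2.2 := by
    intro v
    apply Φ.injective
    rw [map_add, map_add, hΦα₀, hΦα₁, hΦα₂]
    simp
  have eπ₀ : ∀ (A : SL2 F) v, π₀ ⁅inSl n A, v⁆ = ⁅A, π₀ v⁆ := fun A v =>
    congrArg Prod.fst (hΦ A v)
  have eπ₁ : ∀ (A : SL2 F) v, π₁ ⁅inSl n A, v⁆ = ⁅A, π₁ v⁆ := fun A v =>
    congrArg (fun x => x.2.1) (hΦ A v)
  have eπ₂ : ∀ (A : SL2 F) v, π₂ ⁅inSl n A, v⁆ = ⁅A, π₂ v⁆ := fun A v =>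
    congrArg (fun x => x.2.2) (hΦ A v)
  have eα₀ : ∀ (A : SL2 F) v, α₀ ⁅A, v⁆ = ⁅inSl n A, α₀ v⁆ := fun A v => by
    apply Φ.injective
    rw [hΦ, hΦα₀, hΦα₀, lie_zero, lie_zero]
  have eα₁ : ∀ (A : SL2 F) v, α₁ ⁅A, v⁆ = ⁅inSl n A, α₁ v⁆ := fun A v => by
    apply Φ.injective
    rw [hΦ, hΦα₁, hΦα₁, lie_zero, lie_zero]
  have eα₂ : ∀ (A : SL2 F) v, α₂ ⁅A, v⁆ = ⁅inSl n A, α₂ v⁆ := fun A v => by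
    apply Φ.injective
    rw [hΦ, hΦα₂, hΦα₂, lie_zero, lie_zero]
  have x0 : ∀ (p : BinForm F (2 * n)) q, ⁅heisVec p, α₀ q⁆ = 0 := by
    intro p q
    apply Φ.injective
    have h := h₀ (heisVec p) (α₀ q) (by rw [hΦα₀]) (by rw [hΦα₀])
    rw [map_zero Φ]
    exact Prod.ext (heisComponent_self hn π₀ α₀ eπ₀ eα₀ p q) (Prod.ext h.1 h.2)
  have x1 : ∀ (p : BinForm F (2 * n)) q, ⁅heisVec p, α₁ q⁆ = α₀ (heisComponent π₀ α₁ p q) := by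
    intro p q
    apply Φ.injective
    rw [hΦα₀]
    exact Prod.ext rfl (Prod.ext (heisComponent_self hn π₁ α₁ eπ₁ eα₁ p q)
      (h₁ (heisVec p) (α₁ q) (by rw [hΦα₁])))
  have x2 : ∀ (p : BinForm F (2 * n)) q, ⁅heisVec p, α₂ q⁆ =
      α₀ (heisComponent π₀ α₂ p q) + α₁ (heisComponent π₁ α₂ p q) := by
    intro p q
    apply Φ.injective
    rw [map_add, hΦα₀, hΦα₁]
    refine Prod.ext (add_zero _).symm (Prod.ext (zero_add _).symm ?_)
    exact (heisComponent_self hn π₂ α₂ eπ₂ eα₂ p q).trans (add_zero _).symm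
  have z0 : ∀ q, ⁅heisZ F n, α₀ q⁆ = 0 := by
    intro q
    rw [heisZ_eq_lie hn, lie_lie, x0, x0, lie_zero, lie_zero, sub_zero]
  have z1 : ∀ q, ⁅heisZ F n, α₁ q⁆ = 0 := by
    intro q
    rw [heisZ_eq_lie hn, lie_lie, x1, x1, x0, x0, sub_zero]
  have z2' : ∀ (p p' : BinForm F (2 * n)) q, invForm p p' • ⁅heisZ F n, α₂ q⁆ =
      α₀ (heisComponent π₀ α₁ p (heisComponent π₁ α₂ p' q) -
        heisComponent π₀ α₁ p' (heisComponent π₁ α₂ p q)) := by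
    intro p p' q
    rw [← smul_lie, ← lie_heisVec_heisVec, lie_lie, x2, x2, lie_add, lie_add, x0, x0, x1, x1,
      zero_add, zero_add, map_sub]
  set Z : Irr F a₂ →ₗ[F] Irr F a₀ :=
    π₀ ∘ₗ (LieModule.toEnd F (SlHeis F n) V (heisZ F n)) ∘ₗ α₂ with hZdef
  have z2 : ∀ q, ⁅heisZ F n, α₂ q⁆ = α₀ (Z q) := by
    intro q
    have h := z2' (mono F (2 * n) 0) (mono F (2 * n) (2 * n - 1)) q
    rw [invForm_mono_last hn, one_smul] at h
    change _ = α₀ (Φ ⁅heisZ F n, α₂ q⁆).1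
    rw [h, hΦα₀]
  have hcomm : ∀ (p p' : BinForm F (2 * n)) q, invForm p p' • Z q =
      heisComponent π₀ α₁ p (heisComponent π₁ α₂ p' q) -
        heisComponent π₀ α₁ p' (heisComponent π₁ α₂ p q) := by
    intro p p' q
    have h := z2' p p' q
    rw [z2, ← map_smul] at h
    have h' := congrArg Φ h
    rw [hΦα₀, hΦα₀] at h'
    exact congrArg Prod.fst h'
  have hZeq : ∀ (A : SL2 F) v, Z ⁅A, v⁆ = ⁅A, Z v⁆ := by
    intro A v
    change π₀ ⁅heisZ F n, α₂ ⁅A, v⁆⁆ = ⁅A, π₀ ⁅heisZ F n, α₂ v⁆⁆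
    rw [eα₂, ← eπ₀, leibniz_lie (inSl n A), lie_inSl_heisZ, zero_lie, zero_add]
  -- Faithfulness enters here: `z` kills the first two layers, so it must act nontrivially on the
  -- third.
  have hZne : Z ≠ 0 := by
    intro hZ
    apply heisZ_ne_zero (F := F) (n := n)
    refine (LieModule.isFaithful_iff' F (SlHeis F n) V).mp hf _ fun v => ?_
    rw [hsum v, lie_add, lie_add, z0, z1, z2, hZ]
    simp
  obtain ⟨rfl, c, hc⟩ := exists_eq_smul_of_equivariant Z hZeq hZne
  have hc' : ∀ v, Z v = c • v := fun v => BinForm.ext_coord fun k => by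
    rw [hc, BinForm.coord_smul]
  have hc0 : c ≠ 0 := by
    rintro rfl
    apply hZne
    ext v
    rw [hc', zero_smul, LinearMap.zero_apply]
  -- Once `a₂ = a₀` is known, parity excludes a component of `V(m)` from the third layer directly to
  -- the first.
  have g02 := heisComponent_self hn π₀ α₂ eπ₀ eα₂
  have hg01 : heisComponent (n := n) π₀ α₁ ≠ 0 := by
    intro h
    apply hZne
    ext v
    have := hcomm (mono F (2 * n) 0) (mono F (2 * n) (2 * n - 1)) v
    rw [invForm_mono_last hn, one_smul] at this
    rw [this, h]
    simp
  have hg12 : heisComponent (n := n) π₁ α₂ ≠ 0 := by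
    intro h
    apply hZne
    ext v
    have := hcomm (mono F (2 * n) 0) (mono F (2 * n) (2 * n - 1)) v
    rw [invForm_mono_last hn, one_smul] at this
    rw [this, h]
    simp
  obtain ⟨_, _, _, _, s, hs, hs'⟩ :=
    exists_smul_arrow hn _ (lie_heisComponent π₀ α₁ eπ₀ eα₁) hg01
  obtain ⟨k, hk, hka, hk', t, ht, ht'⟩ :=
    exists_smul_arrow hn _ (lie_heisComponent π₁ α₂ eπ₁ eα₂) hg12
  refine ⟨rfl, k, hk, hka, hk', ?_⟩
  -- The two maps are `s` and `t` times the transvectants. Rescaling the layers by `1`, `s`, `s t`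
  -- absorbs both scalars and turns the scalar `c` of `z` into `c / (s t)`.
  set R : (Irr F a₂ × Irr F a₁ × Irr F a₂) ≃ₗ[F] (Irr F a₂ × Irr F a₁ × Irr F a₂) :=
    (LinearEquiv.refl F _).prodCongr ((LinearEquiv.smulOfNeZero F _ s hs).prodCongr
      (LinearEquiv.smulOfNeZero F _ (s * t) (mul_ne_zero hs ht))) with hR
  have hRa : ∀ x, R x = (x.1, s • x.2.1, (s * t) • x.2.2) := fun x => rfl
  have hx : ∀ (p : BinForm F (2 * n)) v, Φ ⁅heisVec p, v⁆ =
      (s • arrow n a₁ a₂ p (Φ v).2.1, t • arrow n a₂ a₁ p (Φ v).2.2, 0) := by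
    intro p v
    have e0 : heisComponent π₀ α₂ p (Φ v).2.2 = 0 := g02 p (Φ v).2.2
    conv_lhs => rw [hsum v]
    rw [lie_add, lie_add, x0, x1, x2, e0, hs', ht', map_add, map_add, map_add, hΦα₀, hΦα₀, hΦα₁]
    simp
  refine ⟨⟨Φ.trans R, ?_, ?_, c / (s * t), div_ne_zero hc0 (mul_ne_zero hs ht), ?_⟩, ?_⟩
  · intro A v
    simp only [LinearEquiv.trans_apply, hRa, hΦ, lie_smul]
  · intro p v
    simp only [LinearEquiv.trans_apply, hRa, hx, smul_zero, ← arrowL_apply, map_smul, smul_smul]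
  · intro v
    have e : Φ ⁅heisZ F n, v⁆ = (c • (Φ v).2.2, 0, 0) := by
      conv_lhs => rw [hsum v]
      rw [lie_add, lie_add, z0, z1, z2, hc', zero_add, zero_add, hΦα₀]
    simp only [LinearEquiv.trans_apply, hRa, e, smul_zero, smul_smul]
    rw [div_mul_cancel₀ _ (mul_ne_zero hs ht)]
  · intro v
    simp only [LinearEquiv.trans_apply, hRa]
    refine ⟨trivial, ?_, ?_⟩
    · rw [smul_eq_zero]
      simp [hs]
    · rw [smul_eq_zero]
      simp [hs, ht]

end Model

/-! ### From a socle decomposition to a model -/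

section OfDecomposition

variable {F : Type*} [Field F] [CharZero F] {n : ℕ} {V : Type*} [AddCommGroup V] [Module F V]
  [LieRingModule (SlHeis F n) V] [LieModule F (SlHeis F n) V]

/-- An `sl(2)`-isomorphism of `V` with the sum of the modules `V(a_i)`. -/
theorem exists_equiv_of_socleDecomposition (D : SocleDecomposition F n V 3) :
    ∃ Φ : V ≃ₗ[F] Irr F (D.wt 0) × Irr F (D.wt 1) × Irr F (D.wt 2),
      (∀ (A : SL2 F) (v : V),
        Φ ⁅inSl n A, v⁆ = (⁅A, (Φ v).1⁆, ⁅A, (Φ v).2.1⁆, ⁅A, (Φ v).2.2⁆)) ∧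
      (∀ v, v ∈ D.comp 0 ↔ (Φ v).2.1 = 0 ∧ (Φ v).2.2 = 0) ∧
      (∀ v, v ∈ D.comp 1 ↔ (Φ v).1 = 0 ∧ (Φ v).2.2 = 0) ∧
      (∀ v, v ∈ D.comp 2 ↔ (Φ v).1 = 0 ∧ (Φ v).2.1 = 0) ∧
      (∀ v, v ∈ D.comp 0 ⊔ D.comp 1 ↔ (Φ v).2.2 = 0) := by
  choose α hinj hrange heq using D.iso
  have hmem : ∀ i x, α i x ∈ D.comp i := fun i x => hrange i ▸ LinearMap.mem_range_self _ x
  set Ψ : Irr F (D.wt 0) × Irr F (D.wt 1) × Irr F (D.wt 2) →ₗ[F] V :=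
    (α 0).coprod ((α 1).coprod (α 2)) with hΨ
  have hΨa : ∀ x, Ψ x = α 0 x.1 + (α 1 x.2.1 + α 2 x.2.2) := fun x => rfl
  have hΨinj : Function.Injective Ψ := by
    rw [← LinearMap.ker_eq_bot, LinearMap.ker_eq_bot']
    intro x hx
    have h := (iSupIndep_iff_finsetSum_eq_zero_imp_eq_zero _).mp D.isInternal.submodule_iSupIndep
      Finset.univ ![α 0 x.1, α 1 x.2.1, α 2 x.2.2]
      (fun i _ => by fin_cases i <;> exact hmem _ _) (by
        rw [Fin.sum_univ_three]
        exact (add_assoc _ _ _).trans hx)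
    have h0 : α 0 x.1 = 0 := h 0 (Finset.mem_univ _)
    have h1 : α 1 x.2.1 = 0 := h 1 (Finset.mem_univ _)
    have h2 : α 2 x.2.2 = 0 := h 2 (Finset.mem_univ _)
    exact Prod.ext (hinj 0 (h0.trans (map_zero _).symm))
      (Prod.ext (hinj 1 (h1.trans (map_zero _).symm)) (hinj 2 (h2.trans (map_zero _).symm)))
  have hΨsurj : Function.Surjective Ψ := by
    rw [← LinearMap.range_eq_top, eq_top_iff, ← D.isInternal.submodule_iSup_eq_top, iSup_le_iff]
    intro i v hv
    rw [← hrange i] at hv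
    obtain ⟨q, rfl⟩ := hv
    fin_cases i
    · exact ⟨(q, 0, 0), by rw [hΨa, map_zero, map_zero, add_zero, add_zero]; rfl⟩
    · exact ⟨(0, q, 0), by rw [hΨa, map_zero, map_zero, add_zero, zero_add]; rfl⟩
    · exact ⟨(0, 0, q), by rw [hΨa, map_zero, map_zero, zero_add, zero_add]; rfl⟩
  set Θ := LinearEquiv.ofBijective Ψ ⟨hΨinj, hΨsurj⟩ with hΘ
  have hΘa : ∀ x, Θ x = Ψ x := fun x => rfl
  have hsymm : ∀ x, Θ.symm (Ψ x) = x := fun x => Θ.symm_apply_apply x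
  have hsum : ∀ v, v = α 0 (Θ.symm v).1 + (α 1 (Θ.symm v).2.1 + α 2 (Θ.symm v).2.2) := fun v =>
    (Θ.apply_symm_apply v).symm
  refine ⟨Θ.symm, ?_, ?_, ?_, ?_, ?_⟩
  · intro A v
    obtain ⟨x, rfl⟩ := Θ.surjective v
    apply Θ.injective
    rw [Θ.apply_symm_apply, Θ.symm_apply_apply, hΘa, hΘa, hΨa, hΨa, lie_add, lie_add, heq, heq, heq]
  · intro v
    constructor
    · intro hv
      rw [← hrange 0] at hv
      obtain ⟨q, rfl⟩ := hv
      have := hsymm (q, 0, 0)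
      rw [hΨa, map_zero, map_zero, add_zero, add_zero] at this
      rw [this]
      exact ⟨rfl, rfl⟩
    · rintro ⟨h1, h2⟩
      rw [hsum v, h1, h2, map_zero, map_zero, add_zero, add_zero]
      exact hmem _ _
  · intro v
    constructor
    · intro hv
      rw [← hrange 1] at hv
      obtain ⟨q, rfl⟩ := hv
      have := hsymm (0, q, 0)
      rw [hΨa, map_zero, map_zero, add_zero, zero_add] at this
      rw [this]
      exact ⟨rfl, rfl⟩
    · rintro ⟨h1, h2⟩
      rw [hsum v, h1, h2, map_zero, map_zero, add_zero, zero_add]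
      exact hmem _ _
  · intro v
    constructor
    · intro hv
      rw [← hrange 2] at hv
      obtain ⟨q, rfl⟩ := hv
      have := hsymm (0, 0, q)
      rw [hΨa, map_zero, map_zero, zero_add, zero_add] at this
      rw [this]
      exact ⟨rfl, rfl⟩
    · rintro ⟨h1, h2⟩
      rw [hsum v, h1, h2, map_zero, map_zero, zero_add, zero_add]
      exact hmem _ _
  · intro v
    constructor
    · intro hv
      obtain ⟨x, hx, y, hy, rfl⟩ := Submodule.mem_sup.mp hv
      rw [← hrange 0] at hx
      rw [← hrange 1] at hy
      obtain ⟨q, rfl⟩ := hx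
      obtain ⟨q', rfl⟩ := hy
      have := hsymm (q, q', 0)
      rw [hΨa, map_zero, add_zero] at this
      rw [this]
    · intro h2
      rw [hsum v, h2, map_zero, add_zero]
      exact Submodule.add_mem_sup (hmem _ _) (hmem _ _)

/-- The terms `soc^1` and `soc^2` of the socle series are submodules, so they supply the two stable
subspaces of the filtration. -/
theorem exists_fuModel (hn : 1 ≤ n) (hf : LieModule.IsFaithful F (SlHeis F n) V)
    (D : SocleDecomposition F n V 3) :
    D.wt 2 = D.wt 0 ∧ ∃ k, k ≤ 2 * n - 1 ∧ k ≤ D.wt 0 ∧ D.wt 1 + 2 * k = 2 * n - 1 + D.wt 0 ∧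
      ∃ M : FUModel F n V (D.wt 0) (D.wt 1),
        (∀ v, v ∈ D.comp 0 ↔ (M.equiv v).2.1 = 0 ∧ (M.equiv v).2.2 = 0) ∧
        (∀ v, v ∈ D.comp 1 ↔ (M.equiv v).1 = 0 ∧ (M.equiv v).2.2 = 0) ∧
        (∀ v, v ∈ D.comp 2 ↔ (M.equiv v).1 = 0 ∧ (M.equiv v).2.1 = 0) := by
  obtain ⟨Φ, hΦ, hc0, hc1, hc2, hc01⟩ := exists_equiv_of_socleDecomposition D
  have hs1 : (socleSeries F (SlHeis F n) V 1).toSubmodule = D.comp 0 := by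
    rw [D.socleSeries_eq 1 (by omega)]
    apply le_antisymm
    · simp only [iSup_le_iff]
      intro i hi
      rw [show i = 0 from Fin.ext (by simp; omega)]
    · exact le_iSup₂_of_le 0 (by simp) le_rfl
  have hs2 : (socleSeries F (SlHeis F n) V 2).toSubmodule = D.comp 0 ⊔ D.comp 1 := by
    rw [D.socleSeries_eq 2 (by omega)]
    apply le_antisymm
    · simp only [iSup_le_iff]
      intro i hi
      fin_cases i
      · exact le_sup_left
      · exact le_sup_right
      · simp at hi
    · exact sup_le (le_iSup₂_of_le 0 (by simp) le_rfl) (le_iSup₂_of_le 1 (by simp) le_rfl)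
  obtain ⟨h20, k, hk, hka, hk1, M, hM⟩ := exists_fuModel_of_filtration hn hf Φ hΦ
    (fun g v h1 h2 => by
      have hv : v ∈ socleSeries F (SlHeis F n) V 1 := by
        rw [← LieSubmodule.mem_toSubmodule, hs1, hc0]
        exact ⟨h1, h2⟩
      have h3 : ⁅g, v⁆ ∈ socleSeries F (SlHeis F n) V 1 := LieSubmodule.lie_mem _ hv
      rwa [← LieSubmodule.mem_toSubmodule, hs1, hc0] at h3)
    (fun g v h2 => by
      have hv : v ∈ socleSeries F (SlHeis F n) V 2 := by
        rwa [← LieSubmodule.mem_toSubmodule, hs2, hc01]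
      have h3 : ⁅g, v⁆ ∈ socleSeries F (SlHeis F n) V 2 := LieSubmodule.lie_mem _ hv
      rwa [← LieSubmodule.mem_toSubmodule, hs2, hc01] at h3)
  refine ⟨h20, k, hk, hka, hk1, M, fun v => ?_, fun v => ?_, fun v => ?_⟩
  · rw [hc0, (hM v).2.1, (hM v).2.2]
  · rw [hc1, (hM v).1, (hM v).2.2]
  · rw [hc2, (hM v).1, (hM v).2.1]

/-- The classification of the standard faithful uniserial modules. -/
theorem FUModel.weights {a₀ a₁ k : ℕ} (M : FUModel F n V a₀ a₁) (hn : 1 < n)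
    (hk : k ≤ 2 * n - 1) (hka : k ≤ a₀) (h1 : a₁ + 2 * k = 2 * n - 1 + a₀) :
    (k = 0 ∧ a₀ ≤ 1) ∨ (k = 1 ∧ a₀ = 1) ∨ (n = 2 ∧ a₀ = 4 ∧ a₁ = 3) := by
  refine weights_of_commutator hn hk hka h1 M.zScalar_ne_zero fun p q v => ?_
  have h := lie_lie (heisVec p) (heisVec q) (M.equiv.symm (0, 0, v))
  rw [lie_heisVec_heisVec, smul_lie] at h
  have h2 := congrArg (fun x => (M.equiv x).1) h
  simp only [map_smul, map_sub, M.equiv_z, M.equiv_heis, LinearEquiv.apply_symm_apply,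
    Prod.smul_fst, Prod.fst_sub, smul_smul] at h2
  exact h2.symm

end OfDecomposition

/-! ### Dimensions -/

section Dimension

variable {F : Type*} [Field F]

instance {d : ℕ} : Module.Finite F (BinForm F d) := inferInstanceAs (Module.Finite F (Fin d → F))

theorem finrank_binForm (d : ℕ) : Module.finrank F (BinForm F d) = d :=
  (Module.finrank_fin_fun F : Module.finrank F (Fin d → F) = d)

/-- With `a₁ = a₀ + m - 2k` the dimension is `3 a₀ + m + 3 - 2k`, which determines both `a₀` and `k
∈ {0, 1}`. This is how the modules of the tables are told apart. -/
theorem finrank_of_isFU [CharZero F] {n : ℕ} {V : Type*} [AddCommGroup V] [Module F V]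
    [LieRingModule (SlHeis F n) V] {a₀ a₁ : ℕ} (h : IsFU (F := F) n V a₀ a₁) :
    Module.finrank F V = 2 * (a₀ + 1) + (a₁ + 1) := by
  obtain ⟨φ, _⟩ := h
  rw [φ.finrank_eq, Module.finrank_prod, Module.finrank_prod, finrank_binForm, finrank_binForm]
  ring

end Dimension


/-! ### Highest weight vectors and the modules they span -/

section Representations

/-- A homomorphism which is injective on highest weight vectors is injective. -/
theorem injective_of_primitive {F : Type*} [Field F] [CharZero F] {n : ℕ} {U : Type*}
    [AddCommGroup U] [Module F U] [LieRingModule (SlHeis F n) U] {M : Type*} [AddCommGroup M]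
    [Module F M] [LieRingModule (SL2 F) M]
    [LieModule F (SL2 F) M] (φ : M →ₗ[F] U)
    (hφ : ∀ (A : SL2 F) v, φ ⁅A, v⁆ = ⁅inSl n A, φ v⁆)
    (hnil : ∀ v : M, ∃ N, ((LieModule.toEnd F (SL2 F) M (slE F)) ^ N) v = 0)
    (h : ∀ v : M, ⁅slE F, v⁆ = 0 → φ v = 0 → v = 0) : Function.Injective φ := by
  rw [← LinearMap.ker_eq_bot, LinearMap.ker_eq_bot']
  intro v hv
  obtain ⟨N, hN⟩ := hnil v
  induction N generalizing v with
  | zero => exact hN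
  | succ N ih =>
    refine h v (ih _ ?_ ?_) hv
    · rw [hφ, hv, lie_zero]
    · rwa [pow_succ, Module.End.mul_apply] at hN

theorem pow_slE_irr {F : Type*} [Field F] (c : ℕ) (v : BinForm F c) :
    ((LieModule.toEnd F (SL2 F) (BinForm F c) (slE F)) ^ c) v = 0 := by
  have h : ∀ N k, c ≤ k + N →
      (((LieModule.toEnd F (SL2 F) (BinForm F c) (slE F)) ^ N) v).coord k = 0 := by
    intro N
    induction N with
    | zero => intro k hk; exact BinForm.coord_of_le _ hk
    | succ N ih =>
      intro k hk
      rw [pow_succ', Module.End.mul_apply, LieModule.toEnd_apply_apply, coord_lie_slE,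
        ih (k + 1) (by omega), mul_zero]
  apply BinForm.ext_coord
  intro k
  rw [h c k (by omega), coord_zero]

variable {F : Type*} [Field F] [CharZero F] {n : ℕ} {U : Type*} [AddCommGroup U] [Module F U]
  [LieRingModule (SlHeis F n) U] [LieModule F (SlHeis F n) U]

theorem isSl2Triple_inSl : IsSl2Triple (inSl n (slH F)) (inSl n (slE F)) (inSl n (slF F)) where
  h_ne_zero := by
    intro h
    have h1 := congrArg (fun g : SlHeis F n => g.right.1 0 0) h
    exact one_ne_zero h1
  lie_e_f := by rw [← LieHom.map_lie, lie_slE_slF]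
  lie_h_e_nsmul := by
    rw [← LieHom.map_lie, lie_slH_slE, map_smul, two_smul, two_smul]
  lie_h_f_nsmul := by
    rw [← LieHom.map_lie, lie_slH_slF, map_neg, map_smul, two_smul, two_smul]

theorem inSl_add (A B : SL2 F) : inSl n (A + B) = inSl n A + inSl n B :=
  LinearMap.map_add (LieAlgebra.SemiDirectSum.inr (slDer F n)).toLinearMap A B

theorem inSl_smul (c : F) (A : SL2 F) : inSl n (c • A) = c • inSl n A :=
  LinearMap.map_smul (LieAlgebra.SemiDirectSum.inr (slDer F n)).toLinearMap c A

theorem inSl_lie_eq (A : SL2 F) (u : U) : ⁅inSl n A, u⁆ =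
    A.1 0 0 • ⁅inSl n (slH F), u⁆ + A.1 0 1 • ⁅inSl n (slE F), u⁆ +
      A.1 1 0 • ⁅inSl n (slF F), u⁆ := by
  have h := sl_eq A
  generalize A.1 0 0 = x at h ⊢
  generalize A.1 0 1 = y at h ⊢
  generalize A.1 1 0 = z at h ⊢
  rw [h, inSl_add, inSl_add, inSl_smul, inSl_smul, inSl_smul, add_lie, add_lie, smul_lie,
    smul_lie, smul_lie]

/-- A linear map from `V(c)` is `sl(2)`-equivariant if it is compatible with `h`, `e` and `f` on
monomials. -/
theorem equivariant_of_mono {c : ℕ} (φ : Irr F c →ₗ[F] U)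
    (hH : ∀ k ≤ c, ⁅inSl n (slH F), φ (mono F (c + 1) k)⁆ =
      ((c : F) - 2 * k) • φ (mono F (c + 1) k))
    (hE : ∀ k ≤ c, ⁅inSl n (slE F), φ (mono F (c + 1) k)⁆ = (k : F) • φ (mono F (c + 1) (k - 1)))
    (hF : ∀ k ≤ c, ⁅inSl n (slF F), φ (mono F (c + 1) k)⁆ =
      ((c : F) - k) • φ (mono F (c + 1) (k + 1)))
    (A : SL2 F) (v : Irr F c) : φ ⁅A, v⁆ = ⁅inSl n A, φ v⁆ := by
  have h : φ ∘ₗ LieModule.toEnd F (SL2 F) (Irr F c) A =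
      LieModule.toEnd F (SlHeis F n) U (inSl n A) ∘ₗ φ := by
    apply linearMap_ext_mono
    intro k hk
    have hk' : k ≤ c := by omega
    change φ ⁅A, mono F (c + 1) k⁆ = ⁅inSl n A, φ (mono F (c + 1) k)⁆
    rw [inSl_lie_eq A, hH k hk', hE k hk', hF k hk']
    have h := sl_eq A
    generalize A.1 0 0 = x at h ⊢
    generalize A.1 0 1 = y at h ⊢
    generalize A.1 1 0 = z at h ⊢
    rw [h, add_lie, add_lie, smul_lie, smul_lie, smul_lie, lie_slH_mono, lie_slE_mono hk,
      lie_slF_mono, map_add, map_add, map_smul, map_smul, map_smul, map_smul, map_smul, map_smul]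
    push_cast
    rw [add_sub_cancel_right]
  exact LinearMap.congr_fun h v

/-- A highest weight vector of weight `c` spans a copy of `V(c)`. -/
theorem exists_hom_of_primitive [FiniteDimensional F U] {c : ℕ} {u : U}
    (hE : ⁅inSl n (slE F), u⁆ = 0) (hH : ⁅inSl n (slH F), u⁆ = (c : F) • u) (hu : u ≠ 0) :
    ∃ φ : Irr F c →ₗ[F] U, φ (mono F (c + 1) 0) = u ∧
      ∀ (A : SL2 F) v, φ ⁅A, v⁆ = ⁅inSl n A, φ v⁆ := by
  have P : isSl2Triple_inSl.HasPrimitiveVectorWith u (c : F) := ⟨hu, hH, hE⟩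
  set ψ : ℕ → U := fun k => ((LieModule.toEnd F (SlHeis F n) U (inSl n (slF F))) ^ k) u with hψ
  have hc : ψ (c + 1) = 0 := P.pow_toEnd_f_eq_zero_of_eq_nat rfl
  -- In `V(c)` one has `f^k w_0 = c (c - 1) ⋯ (c - k + 1) w_k`, so `w_k` must be sent to `f^k u`
  -- divided by this product.
  set d : ℕ → F := fun k => ((c.descFactorial k : ℕ) : F)⁻¹ with hd
  have hd1 : ∀ k, k < c → d k = ((c : F) - k) * d (k + 1) := by
    intro k hk
    have h1 : (c : F) - k ≠ 0 := by
      rw [sub_ne_zero]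
      exact_mod_cast hk.ne'
    simp only [hd]
    rw [Nat.descFactorial_succ, Nat.cast_mul, Nat.cast_sub hk.le, mul_inv, ← mul_assoc,
      mul_inv_cancel₀ h1, one_mul]
  set φ : Irr F c →ₗ[F] U := ∑ k ∈ Finset.range (c + 1),
    (coordL F (c + 1) k).smulRight (d k • ψ k) with hφ
  have hφm : ∀ k ≤ c, φ (mono F (c + 1) k) = d k • ψ k := by
    intro k hk
    rw [hφ, LinearMap.sum_apply, Finset.sum_eq_single k]
    · simp [coord_mono, Nat.lt_succ_of_le hk]
    · intro j _ hj
      simp [coord_mono, hj]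
    · intro h
      simp at h
      omega
  have hφm' : φ (mono F (c + 1) (c + 1)) = 0 := by rw [mono_of_le le_rfl, map_zero]
  refine ⟨φ, ?_, equivariant_of_mono φ ?_ ?_ ?_⟩
  · rw [hφm 0 (Nat.zero_le _)]
    simp [hd, hψ]
  · intro k hk
    rw [hφm k hk, lie_smul, P.lie_h_pow_toEnd_f, smul_comm]
  · intro k hk
    rcases k with _ | k
    · rw [hφm 0 hk, lie_smul, show ψ 0 = u from rfl, hE, smul_zero, Nat.cast_zero, zero_smul]
    · rw [hφm _ hk, Nat.add_sub_cancel, hφm k (by omega), lie_smul, P.lie_e_pow_succ_toEnd_f,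
        smul_smul, smul_smul, hd1 k (by omega)]
      congr 1
      push_cast
      ring
  · intro k hk
    rw [hφm k hk, lie_smul, P.lie_f_pow_toEnd_f]
    rcases hk.eq_or_lt with rfl | hlt
    · rw [hφm']
      change d k • ψ (k + 1) = _
      rw [hc, smul_zero, smul_zero]
    · rw [hφm (k + 1) hlt, smul_smul, ← hd1 k hlt]

/-- A submodule without highest weight vectors is zero. -/
theorem eq_bot_of_primitive {S : Submodule F U}
    (hS : ∀ u ∈ S, ⁅inSl n (slE F), u⁆ ∈ S)
    (hnil : ∀ u : U, ∃ N, ((LieModule.toEnd F (SlHeis F n) U (inSl n (slE F))) ^ N) u = 0)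
    (h : ∀ u ∈ S, ⁅inSl n (slE F), u⁆ = 0 → u = 0) : S = ⊥ := by
  rw [Submodule.eq_bot_iff]
  intro u hu
  obtain ⟨N, hN⟩ := hnil u
  induction N generalizing u with
  | zero => exact hN
  | succ N ih =>
    refine h u hu (ih _ (hS u hu) ?_)
    rwa [pow_succ, Module.End.mul_apply] at hN

/-- A submodule with a unique highest weight vector, on which `h_n` acts trivially, is
isomorphic to some `V(c)`. -/
theorem isoAsSl_of_primitive [FiniteDimensional F U] {S : Submodule F U}
    (hS : ∀ (A : SL2 F), ∀ u ∈ S, ⁅inSl n A, u⁆ ∈ S)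
    (hheis : ∀ (y : Heis F n), ∀ u ∈ S, ⁅inHeis y, u⁆ = 0)
    (hnil : ∀ u : U, ∃ N, ((LieModule.toEnd F (SlHeis F n) U (inSl n (slE F))) ^ N) u = 0)
    {c : ℕ} {w : U} (hwS : w ∈ S) (hw : w ≠ 0) (hE : ⁅inSl n (slE F), w⁆ = 0)
    (hH : ⁅inSl n (slH F), w⁆ = (c : F) • w)
    (h : ∀ u ∈ S, ⁅inSl n (slE F), u⁆ = 0 → ∃ t : F, u = t • w) : IsoAsSl n S (Irr F c) := by
  obtain ⟨φ, hφ0, hφ⟩ := exists_hom_of_primitive hE hH hw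
  have hinj : Function.Injective φ := by
    refine injective_of_primitive φ hφ (fun v => ⟨c + 1, pow_slE_irr _ v⟩) fun v hv hv' => ?_
    rw [eq_smul_mono_zero_of_lie_slE hv, map_smul, hφ0] at hv'
    rw [eq_smul_mono_zero_of_lie_slE hv, (smul_eq_zero.mp hv').resolve_right hw, zero_smul]
  have hrS : LinearMap.range φ ≤ S := by
    have hm : ∀ k, φ (mono F (c + 1) k) ∈ S := by
      intro k
      induction k with
      | zero => rwa [hφ0]
      | succ k ih =>
        rcases lt_or_ge k c with hk | hk
        · have h1 := hφ (slF F) (mono F (c + 1) k)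
          rw [lie_slF_mono, map_smul] at h1
          have h2 : ((c + 1 : ℕ) : F) - 1 - k ≠ 0 := by
            push_cast
            rw [add_sub_cancel_right, sub_ne_zero]
            exact_mod_cast hk.ne'
          rw [← Submodule.smul_mem_iff S h2, h1]
          exact hS _ _ ih
        · rw [mono_of_le (by omega), map_zero]
          exact S.zero_mem
    rintro _ ⟨v, rfl⟩
    rw [sum_coord_smul_mono v, map_sum]
    exact Submodule.sum_mem _ fun k _ => by
      rw [map_smul]
      exact S.smul_mem _ (hm k)
  refine ⟨φ, hinj, le_antisymm hrS ?_, hφ⟩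
  -- the image of `φ` as a submodule; a highest weight vector of `S` modulo this submodule would
  -- have negative weight
  let N : LieSubmodule F (SlHeis F n) U :=
    { LinearMap.range φ with
      lie_mem := by
        rintro g _ ⟨v, rfl⟩
        rw [slHeis_eq g, add_lie, hheis _ _ (hrS ⟨v, rfl⟩), zero_add, ← hφ]
        exact ⟨_, rfl⟩ }
  have hN : ∀ u, u ∈ N ↔ ∃ v, φ v = u := fun u => Iff.rfl
  intro u hu
  by_contra huN
  obtain ⟨s, hsS, hsN, hes⟩ : ∃ s ∈ S, s ∉ N ∧ ⁅inSl n (slE F), s⁆ ∈ N := by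
    by_contra! hcon
    have : ∀ K, ((LieModule.toEnd F (SlHeis F n) U (inSl n (slE F))) ^ K) u ∈ S ∧
        ((LieModule.toEnd F (SlHeis F n) U (inSl n (slE F))) ^ K) u ∉ N := by
      intro K
      induction K with
      | zero => exact ⟨hu, huN⟩
      | succ K ih =>
        rw [pow_succ', Module.End.mul_apply]
        exact ⟨hS _ _ ih.1, hcon _ ih.1 ih.2⟩
    obtain ⟨K, hK⟩ := hnil u
    exact (this K).2 (by rw [hK]; exact N.zero_mem)
  -- correct `s` so that `e s` is a multiple of the lowest weight vector
  obtain ⟨q, hq⟩ := (hN _).mp hes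
  set q' : Irr F c := ∑ k ∈ Finset.range c, (((k : F) + 1)⁻¹ * q.coord k) • mono F (c + 1) (k + 1)
    with hq'
  have hq'e : q - ⁅slE F, q'⁆ = q.coord c • mono F (c + 1) c := by
    have h1 : ⁅slE F, q'⁆ = ∑ k ∈ Finset.range c, q.coord k • mono F (c + 1) k := by
      rw [hq', ← LieModule.toEnd_apply_apply F, map_sum]
      apply Finset.sum_congr rfl
      intro k hk
      rw [Finset.mem_range] at hk
      rw [LieModule.toEnd_apply_apply, lie_smul, lie_slE_mono (by omega), smul_smul, Nat.add_sub_cancel]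
      congr 1
      have : (k : F) + 1 ≠ 0 := by exact_mod_cast Nat.succ_ne_zero k
      push_cast
      field_simp
    have h2 := sum_coord_smul_mono q
    rw [Finset.sum_range_succ] at h2
    rw [h1, sub_eq_iff_eq_add']
    exact h2
  set s' := s - φ q' with hs'
  have hs'S : s' ∈ S := S.sub_mem hsS (hrS ⟨_, rfl⟩)
  have hs'N : s' ∉ N := by
    intro h1
    apply hsN
    have : s = s' + φ q' := by rw [hs', sub_add_cancel]
    rw [this]
    exact N.add_mem h1 ⟨_, rfl⟩
  have hes' : ⁅inSl n (slE F), s'⁆ = q.coord c • φ (mono F (c + 1) c) := by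
    rw [hs', lie_sub, ← hq, ← hφ, ← map_sub, hq'e, map_smul]
  -- The vector `e s'` is a multiple of the lowest weight vector of the image, of weight `-c`, so `e
  -- h s' = h e s' - 2 e s' = -(c + 2) e s'`. Uniqueness of the highest weight vector then places
  -- `(h + c + 2) s'` in `N`.
  have hker : ⁅inSl n (slE F), ⁅inSl n (slH F), s'⁆ + ((c : F) + 2) • s'⁆ = 0 := by
    rw [lie_add, lie_smul, leibniz_lie, ← lie_skew, isSl2Triple_inSl.lie_h_e_smul F, neg_lie,
      smul_lie, hes', lie_smul, ← hφ, lie_slH_mono, map_smul, smul_smul, smul_smul, smul_smul,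
      ← neg_smul, ← add_smul, ← add_smul]
    rw [show -(2 * q.coord c) + q.coord c * (((c + 1 : ℕ) : F) - 1 - 2 * (c : F)) +
      ((c : F) + 2) * q.coord c = 0 by push_cast; ring, zero_smul]
  obtain ⟨t, ht⟩ := h _ (S.add_mem (hS _ _ hs'S) (S.smul_mem _ hs'S)) hker
  have P : (isSl2Triple_inSl (F := F) (n := n)).HasPrimitiveVectorWith
      (LieSubmodule.Quotient.mk' N s') (-((c : F) + 2)) := by
    refine ⟨?_, ?_, ?_⟩
    · rwa [Ne, LieSubmodule.Quotient.mk_eq_zero]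
    · rw [← LieModuleHom.map_lie, ← map_smul, ← sub_eq_zero, ← map_sub,
        LieSubmodule.Quotient.mk_eq_zero, neg_smul, sub_neg_eq_add, ht, hN]
      exact ⟨t • mono F (c + 1) 0, by rw [map_smul, hφ0]⟩
    · rw [← LieModuleHom.map_lie, LieSubmodule.Quotient.mk_eq_zero, hes', hN]
      exact ⟨q.coord c • mono F (c + 1) c, by rw [map_smul]⟩
  obtain ⟨k, hk⟩ := P.exists_nat
  have : ((k + c + 2 : ℕ) : F) = 0 := by
    push_cast
    rw [← hk]
    ring
  exact absurd (Nat.cast_eq_zero.mp this) (by omega)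

end Representations

/-! ### The action of the lowest weight vector of `V(m)` -/

section ArrowLast

variable {F : Type*} [Field F]

/-- For `w_m` the sum defining the structure constant has one term, so each coordinate of the image
is a multiple of a single coordinate of the argument. This makes `w_m` the convenient test vector
for invariance. -/
theorem coord_arrow_last {n a b k : ℕ} (hn : 1 ≤ n) (hk : k ≤ 2 * n - 1)
    (h : a + 2 * k = 2 * n - 1 + b) (q : Irr F b) (i : ℕ) :
    (arrow n b a (mono F (2 * n) (2 * n - 1)) q).coord i =
      if i < 2 * n - 1 - k then 0 else (-1) ^ k * (((2 * n - 1).descFactorial k *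
        (b - (i - (2 * n - 1 - k))).descFactorial k : ℕ) : F) *
          q.coord (i - (2 * n - 1 - k)) := by
  have h1 : coordL F (a + 1) i ∘ₗ arrowL F n b a (mono F (2 * n) (2 * n - 1)) =
      (if i < 2 * n - 1 - k then (0 : F) else (-1) ^ k * (((2 * n - 1).descFactorial k *
        (b - (i - (2 * n - 1 - k))).descFactorial k : ℕ) : F)) •
          coordL F (b + 1) (i - (2 * n - 1 - k)) := by
    apply linearMap_ext_mono
    intro j hj
    rw [LinearMap.comp_apply, arrowL_apply, coordL_apply, LinearMap.smul_apply, coordL_apply,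
      coord_arrow_mono h (by omega) (by omega), coord_mono, arrowCoeff_last, smul_eq_mul]
    by_cases hij : 2 * n - 1 + j = i + k
    · have e : i - (2 * n - 1 - k) = j := by omega
      rw [e, if_neg (by omega : ¬ i < 2 * n - 1 - k)]
      by_cases hia : i ≤ a
      · rw [if_pos ⟨hij, hia⟩, if_pos ⟨rfl, hj⟩, mul_one]
      · rw [if_neg (by omega : ¬ (2 * n - 1 + j = i + k ∧ i ≤ a)),
          Nat.descFactorial_of_lt (by omega : b - j < k)]
        simp
    · rw [if_neg (by omega)]
      by_cases hi : i < 2 * n - 1 - k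
      · rw [if_pos hi, zero_mul]
      · rw [if_neg (by omega : ¬ (i - (2 * n - 1 - k) = j ∧ j < b + 1)), mul_zero]
  have h2 := LinearMap.congr_fun h1 q
  rw [LinearMap.comp_apply, arrowL_apply, coordL_apply, LinearMap.smul_apply, coordL_apply,
    smul_eq_mul] at h2
  rw [h2]
  split_ifs <;> simp

end ArrowLast

/-! ### Coordinates and projections on `FU_(a₀, a₁, a₀)` -/

section Coordinates

variable {F : Type*} [Field F] [CharZero F] {n : ℕ} {V : Type*} [AddCommGroup V] [Module F V]
  [LieRingModule (SlHeis F n) V] {a₀ a₁ : ℕ} (M : FUModel F n V a₀ a₁)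

/-- The coefficients of the lowest weight vector of `V(2n-1) ⊆ h_n` on the summand `1`. -/
def lowOne (F : Type*) [Field F] (n a₁ k i : ℕ) : F :=
  if i < k then 0 else (-1) ^ (2 * n - 1 - k) * (((2 * n - 1).descFactorial (2 * n - 1 - k) *
    (a₁ - (i - k)).descFactorial (2 * n - 1 - k) : ℕ) : F)

/-- The coefficients of the lowest weight vector of `V(2n-1) ⊆ h_n` on the summand `2`. -/
def lowTwo (F : Type*) [Field F] (n a₀ k i : ℕ) : F :=
  if i < 2 * n - 1 - k then 0 else (-1) ^ k * (((2 * n - 1).descFactorial k *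
    (a₀ - (i - (2 * n - 1 - k))).descFactorial k : ℕ) : F)

namespace FUModel

/-- The highest weights of the three summands. -/
def wt (_ : FUModel F n V a₀ a₁) (I : ℕ) : ℕ := if I = 1 then a₁ else a₀

/-- The coordinate `i` of the summand `I`. -/
def crd : ℕ → ℕ → V →ₗ[F] F
  | 0, i => coordL F (a₀ + 1) i ∘ₗ LinearMap.fst F _ _ ∘ₗ M.equiv.toLinearMap
  | 1, i => coordL F (a₁ + 1) i ∘ₗ LinearMap.fst F _ _ ∘ₗ LinearMap.snd F _ _ ∘ₗ
      M.equiv.toLinearMap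
  | 2, i => coordL F (a₀ + 1) i ∘ₗ LinearMap.snd F _ _ ∘ₗ LinearMap.snd F _ _ ∘ₗ
      M.equiv.toLinearMap
  | _, _ => 0

/-- The basis vector `w_i` of the summand `I`. -/
def bas : ℕ → ℕ → V
  | 0, i => M.equiv.symm (mono F (a₀ + 1) i, 0, 0)
  | 1, i => M.equiv.symm (0, mono F (a₁ + 1) i, 0)
  | 2, i => M.equiv.symm (0, 0, mono F (a₀ + 1) i)
  | _, _ => 0

theorem crd_zero_apply (i : ℕ) (v : V) : M.crd 0 i v = (M.equiv v).1.coord i := rfl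
theorem crd_one_apply (i : ℕ) (v : V) : M.crd 1 i v = (M.equiv v).2.1.coord i := rfl
theorem crd_two_apply (i : ℕ) (v : V) : M.crd 2 i v = (M.equiv v).2.2.coord i := rfl

theorem crd_of_wt_lt {I i : ℕ} (h : M.wt I < i) : M.crd I i = 0 := by
  ext v
  rcases I with _ | _ | _ | I
  · exact BinForm.coord_of_le _ h
  · exact BinForm.coord_of_le _ h
  · exact BinForm.coord_of_le _ h
  · rfl

theorem crd_bas {I i : ℕ} (hI : I < 3) (hi : i ≤ M.wt I) (K k : ℕ) :
    M.crd K k (M.bas I i) = if K = I ∧ k = i then 1 else 0 := by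
  interval_cases I <;> rcases K with _ | _ | _ | K <;> simp [wt] at hi <;>
    simp [crd, bas, coord_mono, hi]

theorem eq_sum_crd_bas (v : V) :
    v = ∑ p ∈ Finset.range 3 ×ˢ Finset.range (a₀ + a₁ + 1), M.crd p.1 p.2 v • M.bas p.1 p.2 := by
  rw [Finset.sum_product, Finset.sum_range_succ, Finset.sum_range_succ, Finset.sum_range_one]
  have hs : ∀ (a : ℕ) (q : Irr F a) (N : ℕ), a + 1 ≤ N →
      q = ∑ i ∈ Finset.range N, q.coord i • mono F (a + 1) i := by
    intro a q N hN
    conv_lhs => rw [sum_coord_smul_mono q]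
    apply Finset.sum_subset (fun i hi => by simp at hi ⊢; omega)
    intro i _ hi
    rw [mono_of_le (by simp at hi; omega), smul_zero]
  apply M.equiv.injective
  simp only [map_add, map_sum, map_smul]
  refine Prod.ext ?_ (Prod.ext ?_ ?_)
  · simp only [bas, LinearEquiv.apply_symm_apply, Prod.fst_add, Prod.fst_sum, Prod.smul_fst,
      smul_zero, Finset.sum_const_zero, add_zero]
    exact hs a₀ _ _ (by omega)
  · simp only [bas, LinearEquiv.apply_symm_apply, Prod.snd_add, Prod.snd_sum, Prod.smul_snd,
      Prod.fst_add, Prod.fst_sum, Prod.smul_fst, smul_zero, Finset.sum_const_zero, add_zero,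
      zero_add]
    exact hs a₁ _ _ (by omega)
  · simp only [bas, LinearEquiv.apply_symm_apply, Prod.snd_add, Prod.snd_sum, Prod.smul_snd,
      smul_zero, Finset.sum_const_zero, zero_add]
    exact hs a₀ _ _ (by omega)

theorem crd_slE (I i : ℕ) (v : V) :
    M.crd I i ⁅inSl n (slE F), v⁆ = (((i : F) + 1) • M.crd I (i + 1)) v := by
  rcases I with _ | _ | _ | I
  · rw [LinearMap.smul_apply, crd_zero_apply, crd_zero_apply, M.equiv_sl, coord_lie_slE,
      smul_eq_mul]
  · rw [LinearMap.smul_apply, crd_one_apply, crd_one_apply, M.equiv_sl, coord_lie_slE,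
      smul_eq_mul]
  · rw [LinearMap.smul_apply, crd_two_apply, crd_two_apply, M.equiv_sl, coord_lie_slE,
      smul_eq_mul]
  · simp [crd]

theorem crd_slH (I i : ℕ) (v : V) :
    M.crd I i ⁅inSl n (slH F), v⁆ = (((M.wt I : F) - 2 * i) • M.crd I i) v := by
  rcases I with _ | _ | _ | I
  · rw [LinearMap.smul_apply, crd_zero_apply, crd_zero_apply, M.equiv_sl, coord_lie_slH,
      smul_eq_mul]
    simp [wt]
  · rw [LinearMap.smul_apply, crd_one_apply, crd_one_apply, M.equiv_sl, coord_lie_slH,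
      smul_eq_mul]
    simp [wt]
  · rw [LinearMap.smul_apply, crd_two_apply, crd_two_apply, M.equiv_sl, coord_lie_slH,
      smul_eq_mul]
    simp [wt]
  · simp [crd]

/-- The map `V(a₁) → V(a₀)` is the transvectant of order `m - k`, because `a₀ + 2 (m - k) = m + a₁`;
so `w_m` raises the index by `m - (m - k) = k`. -/
theorem crd_zero_low {k : ℕ} (hn : 1 ≤ n) (hk : k ≤ 2 * n - 1) (h : a₁ + 2 * k = 2 * n - 1 + a₀)
    (i : ℕ) (v : V) : M.crd 0 i ⁅heisVec (mono F (2 * n) (2 * n - 1)), v⁆ =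
      (lowOne F n a₁ k i • M.crd 1 (i - k)) v := by
  rw [crd_zero_apply, M.equiv_heis, coord_arrow_last hn (Nat.sub_le (2 * n - 1) k) (by omega),
    LinearMap.smul_apply, crd_one_apply, smul_eq_mul, lowOne, Nat.sub_sub_self hk]
  split_ifs <;> simp

theorem crd_one_low {k : ℕ} (hn : 1 ≤ n) (hk : k ≤ 2 * n - 1) (h : a₁ + 2 * k = 2 * n - 1 + a₀)
    (i : ℕ) (v : V) : M.crd 1 i ⁅heisVec (mono F (2 * n) (2 * n - 1)), v⁆ =
      (lowTwo F n a₀ k i • M.crd 2 (i - (2 * n - 1 - k))) v := by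
  rw [crd_one_apply, M.equiv_heis, coord_arrow_last hn hk (by omega),
    LinearMap.smul_apply, crd_two_apply, smul_eq_mul, lowTwo]
  split_ifs <;> simp

theorem crd_two_low (i : ℕ) (v : V) (p : BinForm F (2 * n)) :
    M.crd 2 i ⁅heisVec p, v⁆ = (0 : V →ₗ[F] F) v := by
  rw [crd_two_apply, M.equiv_heis, coord_zero, LinearMap.zero_apply]

theorem crd_zero_z (i : ℕ) (v : V) :
    M.crd 0 i ⁅heisZ F n, v⁆ = (M.zScalar • M.crd 2 i) v := by
  rw [crd_zero_apply, M.equiv_z, BinForm.coord_smul]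
  rfl

theorem crd_one_z (i : ℕ) (v : V) : M.crd 1 i ⁅heisZ F n, v⁆ = (0 : V →ₗ[F] F) v := by
  rw [crd_one_apply, M.equiv_z, coord_zero, LinearMap.zero_apply]

theorem crd_two_z (i : ℕ) (v : V) : M.crd 2 i ⁅heisZ F n, v⁆ = (0 : V →ₗ[F] F) v := by
  rw [crd_two_apply, M.equiv_z, coord_zero, LinearMap.zero_apply]

/-- The projection onto the summand `I`. -/
def proj : ℕ → V →ₗ[F] V
  | 0 => M.equiv.symm.toLinearMap ∘ₗ LinearMap.inl F _ _ ∘ₗ LinearMap.fst F _ _ ∘ₗ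
      M.equiv.toLinearMap
  | 1 => M.equiv.symm.toLinearMap ∘ₗ LinearMap.inr F _ _ ∘ₗ LinearMap.inl F _ _ ∘ₗ
      LinearMap.fst F _ _ ∘ₗ LinearMap.snd F _ _ ∘ₗ M.equiv.toLinearMap
  | 2 => M.equiv.symm.toLinearMap ∘ₗ LinearMap.inr F _ _ ∘ₗ LinearMap.inr F _ _ ∘ₗ
      LinearMap.snd F _ _ ∘ₗ LinearMap.snd F _ _ ∘ₗ M.equiv.toLinearMap
  | _ => 0

theorem equiv_proj_zero (v : V) : M.equiv (M.proj 0 v) = ((M.equiv v).1, 0, 0) :=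
  M.equiv.apply_symm_apply _

theorem equiv_proj_one (v : V) : M.equiv (M.proj 1 v) = (0, (M.equiv v).2.1, 0) :=
  M.equiv.apply_symm_apply _

theorem equiv_proj_two (v : V) : M.equiv (M.proj 2 v) = (0, 0, (M.equiv v).2.2) :=
  M.equiv.apply_symm_apply _

theorem sum_proj (v : V) : ∑ I ∈ Finset.range 3, M.proj I v = v := by
  rw [Finset.sum_range_succ, Finset.sum_range_succ, Finset.sum_range_one]
  apply M.equiv.injective
  rw [map_add, map_add, equiv_proj_zero, equiv_proj_one, equiv_proj_two]
  simp

theorem crd_proj (I K k : ℕ) (v : V) :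
    M.crd K k (M.proj I v) = if K = I then M.crd K k v else 0 := by
  rcases I with _ | _ | _ | I
  · rcases K with _ | _ | _ | K
    · rw [crd_zero_apply, equiv_proj_zero]; rfl
    · rw [crd_one_apply, zero_add, equiv_proj_zero]; exact coord_zero _
    · rw [crd_two_apply, equiv_proj_zero]; exact coord_zero _
    · simp [crd]
  · rcases K with _ | _ | _ | K
    · rw [crd_zero_apply, zero_add, equiv_proj_one]; exact coord_zero _
    · rw [crd_one_apply, zero_add, equiv_proj_one]; rfl
    · rw [crd_two_apply, zero_add, equiv_proj_one]; exact coord_zero _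
    · simp [crd]
  · rcases K with _ | _ | _ | K
    · rw [crd_zero_apply, equiv_proj_two]; exact coord_zero _
    · rw [crd_one_apply, equiv_proj_two]; exact coord_zero _
    · rw [crd_two_apply, equiv_proj_two]; rfl
    · simp [crd]
  · simp only [proj, LinearMap.zero_apply, map_zero]
    rcases K with _ | _ | _ | K <;> simp [crd]

theorem lie_proj_zero (p : BinForm F (2 * n)) (v : V) : ⁅heisVec p, M.proj 0 v⁆ = 0 := by
  apply M.equiv.injective
  rw [M.equiv_heis, equiv_proj_zero, map_zero, ← arrowL_apply, ← arrowL_apply, map_zero, map_zero]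
  rfl

/-- `V(m)` lowers the layer by exactly one. Projections with index at least three are zero by
convention, which keeps the formula uniform at the third layer. -/
theorem lie_proj_succ (p : BinForm F (2 * n)) (I : ℕ) (v : V) :
    ⁅heisVec p, M.proj (I + 1) v⁆ = M.proj I ⁅heisVec p, v⁆ := by
  apply M.equiv.injective
  rcases I with _ | _ | _ | I
  · rw [M.equiv_heis, zero_add, equiv_proj_one, equiv_proj_zero, M.equiv_heis]
    simp only [← arrowL_apply, map_zero]
  · rw [M.equiv_heis, zero_add, equiv_proj_one, equiv_proj_two, M.equiv_heis]
    simp only [← arrowL_apply, map_zero]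
  · change M.equiv ⁅heisVec p, (0 : V)⁆ = _
    rw [lie_zero, map_zero, zero_add, equiv_proj_two, M.equiv_heis]
    rfl
  · simp [proj]

end FUModel

end Coordinates

/-! ### Linear forms and operators on a tensor product -/

section Pairing

variable {F : Type*} [Field F] {V W : Type*} [AddCommGroup V] [Module F V] [AddCommGroup W]
  [Module F W]

/-- The linear form `v ⊗ w ↦ f v * g w`. -/
def pairing (f : V →ₗ[F] F) (g : W →ₗ[F] F) : V ⊗[F] W →ₗ[F] F :=
  LinearMap.mul' F F ∘ₗ TensorProduct.map f g

@[simp] theorem pairing_tmul (f : V →ₗ[F] F) (g : W →ₗ[F] F) (v : V) (w : W) :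
    pairing f g (v ⊗ₜ w) = f v * g w := rfl

theorem pairing_smul_left (c : F) (f : V →ₗ[F] F) (g : W →ₗ[F] F) (u : V ⊗[F] W) :
    pairing (c • f) g u = c * pairing f g u := by
  rw [pairing, TensorProduct.map_smul_left]
  simp [pairing]

theorem pairing_smul_right (c : F) (f : V →ₗ[F] F) (g : W →ₗ[F] F) (u : V ⊗[F] W) :
    pairing f (c • g) u = c * pairing f g u := by
  rw [pairing, TensorProduct.map_smul_right]
  simp [pairing]

theorem pairing_zero_left (g : W →ₗ[F] F) (u : V ⊗[F] W) : pairing (0 : V →ₗ[F] F) g u = 0 := by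
  simp [pairing]

theorem pairing_zero_right (f : V →ₗ[F] F) (u : V ⊗[F] W) : pairing f (0 : W →ₗ[F] F) u = 0 := by
  simp [pairing]

theorem pairing_map (f : V →ₗ[F] F) (g : W →ₗ[F] F) (f' : V →ₗ[F] V) (g' : W →ₗ[F] W)
    (u : V ⊗[F] W) : pairing f g (TensorProduct.map f' g' u) = pairing (f ∘ₗ f') (g ∘ₗ g') u := by
  rw [pairing, pairing, TensorProduct.map_comp]
  rfl

theorem eq_sum_pairing {ι κ : Type*} (s : Finset ι) (s' : Finset κ) (f : ι → V →ₗ[F] F) (x : ι → V)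
    (g : κ → W →ₗ[F] F) (y : κ → W) (hf : ∀ v, v = ∑ i ∈ s, f i v • x i)
    (hg : ∀ w, w = ∑ j ∈ s', g j w • y j) (u : V ⊗[F] W) :
    u = ∑ i ∈ s, ∑ j ∈ s', pairing (f i) (g j) u • (x i ⊗ₜ[F] y j) := by
  induction u using TensorProduct.induction_on with
  | zero => simp
  | tmul v w =>
    conv_lhs => rw [hf v, hg w, TensorProduct.sum_tmul]
    apply Finset.sum_congr rfl
    intro i _
    rw [TensorProduct.tmul_sum]
    apply Finset.sum_congr rfl
    intro j _
    rw [TensorProduct.smul_tmul_smul, pairing_tmul]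
  | add u u' hu hu' =>
    conv_lhs => rw [hu, hu', ← Finset.sum_add_distrib]
    apply Finset.sum_congr rfl
    intro i _
    rw [← Finset.sum_add_distrib]
    apply Finset.sum_congr rfl
    intro j _
    rw [map_add, add_smul]

variable {L : Type*} [LieRing L] [LieAlgebra F L] [LieRingModule L V] [LieModule F L V]
  [LieRingModule L W] [LieModule F L W]

theorem pairing_lie {x : L} {f f' : V →ₗ[F] F} {g g' : W →ₗ[F] F} (hf : ∀ v, f ⁅x, v⁆ = f' v)
    (hg : ∀ w, g ⁅x, w⁆ = g' w) (u : V ⊗[F] W) :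
    pairing f g ⁅x, u⁆ = pairing f' g u + pairing f g' u := by
  induction u using TensorProduct.induction_on with
  | zero => simp
  | tmul v w =>
    rw [TensorProduct.LieModule.lie_tmul_right, map_add, pairing_tmul, pairing_tmul, pairing_tmul,
      pairing_tmul, hf, hg]
  | add u u' hu hu' =>
    rw [lie_add, map_add, hu, hu', map_add, map_add]
    ring

theorem lie_map (x : L) (f : V →ₗ[F] V) (g : W →ₗ[F] W) (u : V ⊗[F] W) :
    ⁅x, TensorProduct.map f g u⁆ =
      TensorProduct.map (LieModule.toEnd F L V x ∘ₗ f) g u +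
        TensorProduct.map f (LieModule.toEnd F L W x ∘ₗ g) u := by
  induction u using TensorProduct.induction_on with
  | zero => simp
  | tmul v w =>
    simp only [TensorProduct.map_tmul, LinearMap.comp_apply, LieModule.toEnd_apply_apply]
    rw [TensorProduct.LieModule.lie_tmul_right]
  | add u u' hu hu' =>
    rw [map_add, lie_add, hu, hu', map_add, map_add]
    abel

theorem map_lie_tensor (x : L) (f : V →ₗ[F] V) (g : W →ₗ[F] W) (u : V ⊗[F] W) :
    TensorProduct.map f g ⁅x, u⁆ =
      TensorProduct.map (f ∘ₗ LieModule.toEnd F L V x) g u +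
        TensorProduct.map f (g ∘ₗ LieModule.toEnd F L W x) u := by
  induction u using TensorProduct.induction_on with
  | zero => simp
  | tmul v w =>
    rw [TensorProduct.LieModule.lie_tmul_right]
    simp only [map_add, TensorProduct.map_tmul, LinearMap.comp_apply, LieModule.toEnd_apply_apply]
  | add u u' hu hu' =>
    rw [lie_add, map_add, hu, hu', map_add, map_add]
    abel

end Pairing

/-! ### Testing `h_n`-invariance -/

section HeisInvariants

variable {F : Type*} [Field F] [CharZero F] {n : ℕ} {U : Type*} [AddCommGroup U] [Module F U]
  [LieRingModule (SlHeis F n) U] [LieModule F (SlHeis F n) U]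

/-- For `n ≥ 1` the central element is a commutator of elements of `V(m)`. -/
theorem inHeis_lie_eq_zero (hn : 1 ≤ n) {u : U} (h : ∀ p : BinForm F (2 * n), ⁅heisVec p, u⁆ = 0)
    (y : Heis F n) : ⁅inHeis y, u⁆ = 0 := by
  rw [inHeis_eq, add_lie, smul_lie, h, heisZ_eq_lie hn, lie_lie, h, h, lie_zero, lie_zero,
    sub_zero, smul_zero, add_zero]

/-- A highest weight vector is `h_n`-invariant if it is annihilated by the lowest weight vector of
`V(2n-1) ⊆ h_n`. -/
theorem inHeis_lie_eq_zero_of_low (hn : 1 ≤ n) {u : U} (hE : ⁅inSl n (slE F), u⁆ = 0)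
    (hlow : ⁅heisVec (mono F (2 * n) (2 * n - 1)), u⁆ = 0) (y : Heis F n) : ⁅inHeis y, u⁆ = 0 := by
  apply inHeis_lie_eq_zero hn
  -- Bracketing with `e`, which kills `u`, passes from `w_(s+1)` to a nonzero multiple of `w_s`.
  have h : ∀ t s, s + t = 2 * n - 1 → ⁅heisVec (mono F (2 * n) s), u⁆ = 0 := by
    intro t
    induction t with
    | zero => rintro s rfl; exact hlow
    | succ t ih =>
      intro s hs
      have h1 := ih (s + 1) (by omega)
      have h2 := leibniz_lie (inSl n (slE F)) (heisVec (mono F (2 * n) (s + 1))) u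
      rw [h1, hE, lie_zero, lie_zero, add_zero, lie_inSl_inHeis] at h2
      change 0 = ⁅heisVec ⁅slE F, mono F (2 * n) (s + 1)⁆, u⁆ at h2
      rw [lie_slE_mono (by omega), Nat.add_sub_cancel, heisVec_smul, smul_lie] at h2
      refine (smul_eq_zero.mp h2.symm).resolve_left ?_
      exact_mod_cast Nat.succ_ne_zero s
  intro p
  have h3 : ∀ d, d ≤ 2 * n →
      ⁅heisVec (∑ k ∈ Finset.range d, p.coord k • mono F (2 * n) k), u⁆ = 0 := by
    intro d
    induction d with
    | zero =>
      intro _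
      rw [Finset.sum_range_zero, ← zero_smul F (0 : BinForm F (2 * n)), heisVec_smul, zero_smul,
        zero_lie]
    | succ d ih =>
      intro hd
      rw [Finset.sum_range_succ, heisVec_add, add_lie, ih (by omega), heisVec_smul, smul_lie,
        h (2 * n - 1 - d) d (by omega), smul_zero, zero_add]
  rw [sum_coord_smul_mono p]
  exact h3 _ le_rfl

end HeisInvariants

/-! ### Coordinates, highest weight vectors and grading of the tensor product -/

section TensorCoordinates

variable {F : Type*} [Field F] [CharZero F] {n : ℕ} {V₁ : Type*} [AddCommGroup V₁] [Module F V₁]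
  [LieRingModule (SlHeis F n) V₁] [LieModule F (SlHeis F n) V₁]
  {V₂ : Type*} [AddCommGroup V₂] [Module F V₂]
  [LieRingModule (SlHeis F n) V₂] [LieModule F (SlHeis F n) V₂]
  {a₀ a₁ b₀ b₁ : ℕ} (M₁ : FUModel F n V₁ a₀ a₁) (M₂ : FUModel F n V₂ b₀ b₁)

/-- The coordinate of `w_i ⊗ w_j` in the product of the summands `I` and `J`. -/
def tcrd (I i J j : ℕ) : V₁ ⊗[F] V₂ →ₗ[F] F := pairing (M₁.crd I i) (M₂.crd J j)

theorem tcrd_slE (I i J j : ℕ) (u : V₁ ⊗[F] V₂) :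
    tcrd M₁ M₂ I i J j ⁅inSl n (slE F), u⁆ =
      ((i : F) + 1) * tcrd M₁ M₂ I (i + 1) J j u + ((j : F) + 1) * tcrd M₁ M₂ I i J (j + 1) u := by
  rw [tcrd, pairing_lie (M₁.crd_slE I i) (M₂.crd_slE J j), pairing_smul_left, pairing_smul_right]
  rfl

theorem tcrd_slH (I i J j : ℕ) (u : V₁ ⊗[F] V₂) :
    tcrd M₁ M₂ I i J j ⁅inSl n (slH F), u⁆ =
      ((M₁.wt I : F) + M₂.wt J - 2 * ((i : F) + j)) * tcrd M₁ M₂ I i J j u := by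
  rw [tcrd, pairing_lie (M₁.crd_slH I i) (M₂.crd_slH J j), pairing_smul_left, pairing_smul_right]
  ring

theorem tcrd_of_wt_lt_left {I i : ℕ} (h : M₁.wt I < i) (J j : ℕ) (u : V₁ ⊗[F] V₂) :
    tcrd M₁ M₂ I i J j u = 0 := by
  rw [tcrd, M₁.crd_of_wt_lt h, pairing_zero_left]

theorem tcrd_of_wt_lt_right {J j : ℕ} (h : M₂.wt J < j) (I i : ℕ) (u : V₁ ⊗[F] V₂) :
    tcrd M₁ M₂ I i J j u = 0 := by
  rw [tcrd, M₂.crd_of_wt_lt h, pairing_zero_right]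

theorem eq_sum_tcrd (u : V₁ ⊗[F] V₂) :
    u = ∑ p ∈ Finset.range 3 ×ˢ Finset.range (a₀ + a₁ + 1),
      ∑ q ∈ Finset.range 3 ×ˢ Finset.range (b₀ + b₁ + 1),
        tcrd M₁ M₂ p.1 p.2 q.1 q.2 u • (M₁.bas p.1 p.2 ⊗ₜ[F] M₂.bas q.1 q.2) :=
  eq_sum_pairing (Finset.range 3 ×ˢ Finset.range (a₀ + a₁ + 1))
    (Finset.range 3 ×ˢ Finset.range (b₀ + b₁ + 1)) (fun p : ℕ × ℕ => M₁.crd p.1 p.2)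
    (fun p => M₁.bas p.1 p.2) (fun q : ℕ × ℕ => M₂.crd q.1 q.2)
    (fun q => M₂.bas q.1 q.2) (fun v => M₁.eq_sum_crd_bas v) (fun v => M₂.eq_sum_crd_bas v) u

theorem eq_zero_of_tcrd {u : V₁ ⊗[F] V₂}
    (h : ∀ I i J j, I < 3 → J < 3 → tcrd M₁ M₂ I i J j u = 0) : u = 0 := by
  rw [eq_sum_tcrd M₁ M₂ u]
  refine Finset.sum_eq_zero fun p hp => Finset.sum_eq_zero fun q hq => ?_
  rw [Finset.mem_product, Finset.mem_range] at hp hq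
  rw [h _ _ _ _ hp.1 hq.1, zero_smul]

theorem eq_of_tcrd {u u' : V₁ ⊗[F] V₂}
    (h : ∀ I i J j, I < 3 → J < 3 → tcrd M₁ M₂ I i J j u = tcrd M₁ M₂ I i J j u') : u = u' := by
  rw [← sub_eq_zero]
  apply eq_zero_of_tcrd M₁ M₂
  intro I i J j hI hJ
  rw [map_sub, h I i J j hI hJ, sub_self]

theorem exists_pow_slE (M₁ : FUModel F n V₁ a₀ a₁) (M₂ : FUModel F n V₂ b₀ b₁)
    (u : V₁ ⊗[F] V₂) :
    ∃ N, ((LieModule.toEnd F (SlHeis F n) (V₁ ⊗[F] V₂) (inSl n (slE F))) ^ N) u = 0 := by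
  have h : ∀ N I i J j, M₁.wt I + M₂.wt J < i + j + N → tcrd M₁ M₂ I i J j
      (((LieModule.toEnd F (SlHeis F n) (V₁ ⊗[F] V₂) (inSl n (slE F))) ^ N) u) = 0 := by
    intro N
    induction N with
    | zero =>
      intro I i J j h
      rcases lt_or_ge (M₁.wt I) i with h' | h'
      · exact tcrd_of_wt_lt_left _ _ h' _ _ _
      · exact tcrd_of_wt_lt_right _ _ (by omega) _ _ _
    | succ N ih =>
      intro I i J j h
      rw [pow_succ', Module.End.mul_apply, LieModule.toEnd_apply_apply, tcrd_slE,
        ih _ _ _ _ (by omega), ih _ _ _ _ (by omega), mul_zero, mul_zero, add_zero]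
  refine ⟨a₀ + a₁ + b₀ + b₁ + 1, eq_zero_of_tcrd M₁ M₂ fun I i J j _ _ => h _ _ _ _ _ ?_⟩
  have h1 : M₁.wt I ≤ a₀ + a₁ := by unfold FUModel.wt; split_ifs <;> omega
  have h2 : M₂.wt J ≤ b₀ + b₁ := by unfold FUModel.wt; split_ifs <;> omega
  omega

/-- The coordinates of a vector annihilated by `e`. -/
theorem tcrd_of_slE {u : V₁ ⊗[F] V₂} (hE : ⁅inSl n (slE F), u⁆ = 0) (I i J j : ℕ) :
    tcrd M₁ M₂ I i J j u =
      (-1) ^ i * (((i + j).choose i : ℕ) : F) * tcrd M₁ M₂ I 0 J (i + j) u := by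
  induction i generalizing j with
  | zero => simp
  | succ i ih =>
    have h1 := tcrd_slE M₁ M₂ I i J j u
    rw [hE, map_zero, ih] at h1
    have h2 : (i : F) + 1 ≠ 0 := by exact_mod_cast Nat.succ_ne_zero i
    have h3 := Nat.choose_succ_right_eq (i + (j + 1)) i
    rw [show i + (j + 1) - i = j + 1 by omega] at h3
    have h4 := congrArg (Nat.cast : ℕ → F) h3
    push_cast at h4
    rw [show i + 1 + j = i + (j + 1) by omega]
    apply mul_left_cancel₀ h2
    linear_combination (-1 : F) * h1 + (-1) ^ i * tcrd M₁ M₂ I 0 J (i + (j + 1)) u * h4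

/-- The highest weight vector `∑ (-1)^i binom(l, i) w_i ⊗ w_(l-i)`. -/
def hwVec (I J l : ℕ) : V₁ ⊗[F] V₂ := ∑ p ∈ Finset.HasAntidiagonal.antidiagonal l,
  ((-1) ^ p.1 * ((l.choose p.1 : ℕ) : F)) • (M₁.bas I p.1 ⊗ₜ[F] M₂.bas J p.2)

theorem tcrd_hwVec {I J l : ℕ} (hI : I < 3) (hJ : J < 3) (h₁ : l ≤ M₁.wt I) (h₂ : l ≤ M₂.wt J)
    (K k L k' : ℕ) : tcrd M₁ M₂ K k L k' (hwVec M₁ M₂ I J l) =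
      if K = I ∧ L = J ∧ k + k' = l then (-1) ^ k * ((l.choose k : ℕ) : F) else 0 := by
  rw [hwVec, map_sum]
  have h : ∀ p ∈ Finset.HasAntidiagonal.antidiagonal l, tcrd M₁ M₂ K k L k'
      (((-1) ^ p.1 * ((l.choose p.1 : ℕ) : F)) • (M₁.bas I p.1 ⊗ₜ[F] M₂.bas J p.2)) =
      if p = (k, k') then (if K = I ∧ L = J then (-1) ^ k * ((l.choose k : ℕ) : F) else 0)
        else 0 := by
    intro p hp
    rw [Finset.HasAntidiagonal.mem_antidiagonal] at hp
    rw [map_smul, tcrd, pairing_tmul, M₁.crd_bas hI (by omega), M₂.crd_bas hJ (by omega)]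
    by_cases hp' : p = (k, k')
    · subst hp'
      by_cases hK : K = I <;> by_cases hL : L = J <;> simp [hK, hL]
    · rw [if_neg hp']
      have : ¬ (k = p.1 ∧ k' = p.2) := fun h => hp' (Prod.ext h.1.symm h.2.symm)
      by_cases h1 : K = I ∧ k = p.1
      · rw [if_neg (fun h2 : L = J ∧ k' = p.2 => this ⟨h1.2, h2.2⟩), mul_zero, smul_zero]
      · rw [if_neg h1, zero_mul, smul_zero]
  rw [Finset.sum_congr rfl h, Finset.sum_ite_eq']
  simp only [Finset.HasAntidiagonal.mem_antidiagonal]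
  by_cases h1 : k + k' = l <;> by_cases hK : K = I <;> by_cases hL : L = J <;> simp [h1, hK, hL]

theorem slE_hwVec {I J l : ℕ} (hI : I < 3) (hJ : J < 3) (h₁ : l ≤ M₁.wt I) (h₂ : l ≤ M₂.wt J) :
    ⁅inSl n (slE F), hwVec M₁ M₂ I J l⁆ = 0 := by
  apply eq_zero_of_tcrd M₁ M₂
  intro K k L k' _ _
  rw [tcrd_slE, tcrd_hwVec _ _ hI hJ h₁ h₂, tcrd_hwVec _ _ hI hJ h₁ h₂]
  by_cases h : K = I ∧ L = J ∧ k + k' + 1 = l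
  · rw [if_pos (by omega), if_pos (by omega)]
    have h3 := Nat.choose_succ_right_eq l k
    rw [show l - k = k' + 1 by omega] at h3
    have h4 := congrArg (Nat.cast : ℕ → F) h3
    push_cast at h4
    linear_combination (-1) * (-1) ^ k * h4
  · rw [if_neg (by omega), if_neg (by omega), mul_zero, mul_zero, add_zero]

theorem slH_hwVec {I J l : ℕ} (hI : I < 3) (hJ : J < 3) (h₁ : l ≤ M₁.wt I) (h₂ : l ≤ M₂.wt J) :
    ⁅inSl n (slH F), hwVec M₁ M₂ I J l⁆ =
      ((M₁.wt I : F) + M₂.wt J - 2 * l) • hwVec M₁ M₂ I J l := by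
  apply eq_of_tcrd M₁ M₂
  intro K k L k' _ _
  rw [tcrd_slH, map_smul, tcrd_hwVec _ _ hI hJ h₁ h₂, smul_eq_mul]
  split_ifs with h
  · obtain ⟨rfl, rfl, rfl⟩ := h
    push_cast
    ring
  · simp

/-- The projection of `V₁ ⊗ V₂` onto the summands of total degree `t`. -/
def gradedProj (t : ℕ) : V₁ ⊗[F] V₂ →ₗ[F] V₁ ⊗[F] V₂ :=
  ∑ p ∈ Finset.HasAntidiagonal.antidiagonal t, TensorProduct.map (M₁.proj p.1) (M₂.proj p.2)

theorem tcrd_gradedProj (t I i J j : ℕ) (u : V₁ ⊗[F] V₂) :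
    tcrd M₁ M₂ I i J j (gradedProj M₁ M₂ t u) =
      if I + J = t then tcrd M₁ M₂ I i J j u else 0 := by
  rw [gradedProj, LinearMap.sum_apply, map_sum]
  have h : ∀ p ∈ Finset.HasAntidiagonal.antidiagonal t, tcrd M₁ M₂ I i J j
      (TensorProduct.map (M₁.proj p.1) (M₂.proj p.2) u) =
      if p = (I, J) then tcrd M₁ M₂ I i J j u else 0 := by
    intro p _
    rw [tcrd, pairing_map]
    have e1 : M₁.crd I i ∘ₗ M₁.proj p.1 = if I = p.1 then M₁.crd I i else 0 := by
      ext v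
      rw [LinearMap.comp_apply, M₁.crd_proj]
      split_ifs <;> rfl
    have e2 : M₂.crd J j ∘ₗ M₂.proj p.2 = if J = p.2 then M₂.crd J j else 0 := by
      ext v
      rw [LinearMap.comp_apply, M₂.crd_proj]
      split_ifs <;> rfl
    rw [e1, e2]
    by_cases hp : p = (I, J)
    · subst hp
      simp
    · rw [if_neg hp]
      by_cases h1 : I = p.1
      · rw [if_neg (fun h2 : J = p.2 => hp (Prod.ext h1.symm h2.symm)), pairing_zero_right]
      · rw [if_neg h1, pairing_zero_left]
  rw [Finset.sum_congr rfl h, Finset.sum_ite_eq']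
  simp

theorem lie_gradedProj_zero (p : BinForm F (2 * n)) (u : V₁ ⊗[F] V₂) :
    ⁅heisVec p, gradedProj M₁ M₂ 0 u⁆ = 0 := by
  have z1 : LieModule.toEnd F (SlHeis F n) V₁ (heisVec p) ∘ₗ M₁.proj 0 = 0 := by
    ext v; exact M₁.lie_proj_zero p v
  have z2 : LieModule.toEnd F (SlHeis F n) V₂ (heisVec p) ∘ₗ M₂.proj 0 = 0 := by
    ext v; exact M₂.lie_proj_zero p v
  rw [gradedProj, LinearMap.sum_apply, Finset.Nat.antidiagonal_zero, Finset.sum_singleton, lie_map,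
    z1, z2, TensorProduct.map_zero_left, TensorProduct.map_zero_right, LinearMap.zero_apply,
    add_zero]

/-- `V(2n-1) ⊆ h_n` lowers the degree by one. -/
theorem lie_gradedProj_succ (p : BinForm F (2 * n)) (t : ℕ) (u : V₁ ⊗[F] V₂) :
    ⁅heisVec p, gradedProj M₁ M₂ (t + 1) u⁆ = gradedProj M₁ M₂ t ⁅heisVec p, u⁆ := by
  have z1 : LieModule.toEnd F (SlHeis F n) V₁ (heisVec p) ∘ₗ M₁.proj 0 = 0 := by
    ext v; exact M₁.lie_proj_zero p v
  have z2 : LieModule.toEnd F (SlHeis F n) V₂ (heisVec p) ∘ₗ M₂.proj 0 = 0 := by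
    ext v; exact M₂.lie_proj_zero p v
  have s1 : ∀ I, LieModule.toEnd F (SlHeis F n) V₁ (heisVec p) ∘ₗ M₁.proj (I + 1) =
      M₁.proj I ∘ₗ LieModule.toEnd F (SlHeis F n) V₁ (heisVec p) := by
    intro I; ext v; exact M₁.lie_proj_succ p I v
  have s2 : ∀ I, LieModule.toEnd F (SlHeis F n) V₂ (heisVec p) ∘ₗ M₂.proj (I + 1) =
      M₂.proj I ∘ₗ LieModule.toEnd F (SlHeis F n) V₂ (heisVec p) := by
    intro I; ext v; exact M₂.lie_proj_succ p I v
  rw [gradedProj, gradedProj, LinearMap.sum_apply, LinearMap.sum_apply,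
    ← LieModule.toEnd_apply_apply F _ _ _ (∑ p ∈ _, _), map_sum]
  simp only [LieModule.toEnd_apply_apply, lie_map]
  rw [Finset.sum_add_distrib, Finset.Nat.sum_antidiagonal_succ, Finset.Nat.sum_antidiagonal_succ']
  simp only [z1, z2, s1, s2, TensorProduct.map_zero_left, TensorProduct.map_zero_right,
    LinearMap.zero_apply, zero_add]
  simp only [← Finset.sum_add_distrib, ← map_lie_tensor]

theorem heisVec_gradedProj (p : BinForm F (2 * n)) (t : ℕ) {u : V₁ ⊗[F] V₂}
    (hu : ⁅heisVec p, u⁆ = 0) : ⁅heisVec p, gradedProj M₁ M₂ t u⁆ = 0 := by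
  rcases t with _ | t
  · exact lie_gradedProj_zero M₁ M₂ p u
  · rw [lie_gradedProj_succ, hu, map_zero]

/-- `z` sends the third layer to the first and kills the others. The coordinates of `z u` in the
layers `(0,2)`, `(0,1)`, `(1,0)` therefore read off those of `u` in `(2,2)`, `(2,1)`, `(1,2)`, and
the layer `(0,0)` couples `(2,0)` with `(0,2)`. Invariants thus have degree at most two. -/
theorem tcrd_of_heisZ {u : V₁ ⊗[F] V₂} (hz : ⁅heisZ F n, u⁆ = 0) (i j : ℕ) :
    tcrd M₁ M₂ 2 i 2 j u = 0 ∧ tcrd M₁ M₂ 2 i 1 j u = 0 ∧ tcrd M₁ M₂ 1 i 2 j u = 0 ∧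
      M₁.zScalar * tcrd M₁ M₂ 2 i 0 j u + M₂.zScalar * tcrd M₁ M₂ 0 i 2 j u = 0 := by
  have h1 := pairing_lie (M₁.crd_zero_z i) (M₂.crd_two_z j) u
  have h2 := pairing_lie (M₁.crd_zero_z i) (M₂.crd_one_z j) u
  have h3 := pairing_lie (M₁.crd_one_z i) (M₂.crd_zero_z j) u
  have h4 := pairing_lie (M₁.crd_zero_z i) (M₂.crd_zero_z j) u
  rw [hz, map_zero] at h1 h2 h3 h4
  rw [pairing_smul_left, pairing_zero_right, add_zero] at h1 h2
  rw [pairing_smul_right, pairing_zero_left, zero_add] at h3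
  rw [pairing_smul_left, pairing_smul_right] at h4
  exact ⟨(mul_eq_zero.mp h1.symm).resolve_left M₁.zScalar_ne_zero,
    (mul_eq_zero.mp h2.symm).resolve_left M₁.zScalar_ne_zero,
    (mul_eq_zero.mp h3.symm).resolve_left M₂.zScalar_ne_zero, h4.symm⟩

/-- The `h_n`-invariants are the sum of their components of degree at most two. -/
theorem eq_gradedProj_of_heisZ {u : V₁ ⊗[F] V₂} (hz : ⁅heisZ F n, u⁆ = 0) :
    u = gradedProj M₁ M₂ 0 u + gradedProj M₁ M₂ 1 u + gradedProj M₁ M₂ 2 u := by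
  apply eq_of_tcrd M₁ M₂
  intro I i J j hI hJ
  obtain ⟨h1, h2, h3, -⟩ := tcrd_of_heisZ M₁ M₂ hz i j
  rw [map_add, map_add, tcrd_gradedProj, tcrd_gradedProj, tcrd_gradedProj]
  interval_cases I <;> interval_cases J <;> simp [h1, h2, h3]

end TensorCoordinates

/-! ### Vanishing and nonvanishing of the coefficients of `w_m` -/

section LowCoefficients

variable {F : Type*} [Field F] [CharZero F] {n a₀ a₁ k : ℕ}

theorem lowOne_of_lt {i : ℕ} (hi : i < k) : lowOne F n a₁ k i = 0 := if_pos hi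

theorem lowOne_of_le {i : ℕ} (hi : k ≤ i) : lowOne F n a₁ k i =
    (-1) ^ (2 * n - 1 - k) * (((2 * n - 1).descFactorial (2 * n - 1 - k) *
      (a₁ - (i - k)).descFactorial (2 * n - 1 - k) : ℕ) : F) := if_neg (by omega)

theorem lowTwo_of_lt {i : ℕ} (hi : i < 2 * n - 1 - k) : lowTwo F n a₀ k i = 0 := if_pos hi

theorem lowTwo_of_le {i : ℕ} (hi : 2 * n - 1 - k ≤ i) : lowTwo F n a₀ k i =
    (-1) ^ k * (((2 * n - 1).descFactorial k *
      (a₀ - (i - (2 * n - 1 - k))).descFactorial k : ℕ) : F) := if_neg (by omega)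

theorem lowOne_ne_zero (hk : k ≤ 2 * n - 1) (h : a₁ + 2 * k = 2 * n - 1 + a₀) {i : ℕ} (hi : k ≤ i)
    (hi' : i ≤ a₀) : lowOne F n a₁ k i ≠ 0 := by
  rw [lowOne_of_le hi]
  refine mul_ne_zero (pow_ne_zero _ (neg_ne_zero.mpr one_ne_zero)) (Nat.cast_ne_zero.mpr ?_)
  refine mul_ne_zero ?_ ?_ <;> rw [Ne, Nat.descFactorial_eq_zero_iff_lt] <;> omega

/-- The target `V(a₀)` has no monomial of index above `a₀`; the falling factorial vanishes
accordingly. -/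
theorem lowOne_of_gt (h : a₁ + 2 * k = 2 * n - 1 + a₀) {i : ℕ} (hi : k ≤ i)
    (hi' : a₀ < i) (hlt : k < 2 * n - 1) : lowOne F n a₁ k i = 0 := by
  rw [lowOne_of_le hi, Nat.descFactorial_eq_zero_iff_lt.mpr (by omega : a₁ - (i - k) < _)]
  simp

theorem lowTwo_ne_zero (hk : k ≤ 2 * n - 1) (h : a₁ + 2 * k = 2 * n - 1 + a₀)
    {i : ℕ} (hi : 2 * n - 1 - k ≤ i) (hi' : i ≤ a₁) : lowTwo F n a₀ k i ≠ 0 := by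
  rw [lowTwo_of_le hi]
  refine mul_ne_zero (pow_ne_zero _ (neg_ne_zero.mpr one_ne_zero)) (Nat.cast_ne_zero.mpr ?_)
  refine mul_ne_zero ?_ ?_ <;> rw [Ne, Nat.descFactorial_eq_zero_iff_lt] <;> omega

end LowCoefficients

/-! ### The graded pieces of the invariants -/

section GradedInvariants

variable {F : Type*} [Field F] [CharZero F] {n : ℕ} {V : Type*} [AddCommGroup V] [Module F V]
  [LieRingModule (SlHeis F n) V] {a₀ a₁ : ℕ}

/-- The coefficients of the lowest weight vector of `V(2n-1) ⊆ h_n` on the summand `I + 1`. -/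
def lowCoeff (F : Type*) [Field F] (n a₀ a₁ k : ℕ) : ℕ → ℕ → F
  | 0, i => lowOne F n a₁ k i
  | 1, i => lowTwo F n a₀ k i
  | _, _ => 0

/-- The lowest weight vector of `V(2n-1) ⊆ h_n` maps the summand `I + 1` to the summand `I`,
increasing the index by this number. -/
def lowShift (n k : ℕ) : ℕ → ℕ
  | 0 => k
  | _ => 2 * n - 1 - k

theorem FUModel.crd_low (M : FUModel F n V a₀ a₁) {k : ℕ} (hn : 1 ≤ n) (hk : k ≤ 2 * n - 1)
    (h : a₁ + 2 * k = 2 * n - 1 + a₀) (I i : ℕ) (v : V) :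
    M.crd I i ⁅heisVec (mono F (2 * n) (2 * n - 1)), v⁆ =
      (lowCoeff F n a₀ a₁ k I i • M.crd (I + 1) (i - lowShift n k I)) v := by
  rcases I with _ | _ | _ | I
  · exact M.crd_zero_low hn hk h i v
  · exact M.crd_one_low hn hk h i v
  · rw [M.crd_two_low]; simp [lowCoeff]
  · simp [lowCoeff, FUModel.crd]

theorem FUModel.proj_lie_inSl (M : FUModel F n V a₀ a₁) (I : ℕ) (A : SL2 F) (v : V) :
    M.proj I ⁅inSl n A, v⁆ = ⁅inSl n A, M.proj I v⁆ := by
  apply M.equiv.injective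
  rcases I with _ | _ | _ | I
  · rw [M.equiv_sl, M.equiv_proj_zero, M.equiv_proj_zero, M.equiv_sl]
    simp
  · rw [M.equiv_sl, zero_add, M.equiv_proj_one, M.equiv_proj_one, M.equiv_sl]
    simp
  · rw [M.equiv_sl]
    change M.equiv (M.proj 2 _) = (⁅A, (M.equiv (M.proj 2 v)).1⁆, ⁅A, (M.equiv (M.proj 2 v)).2.1⁆,
      ⁅A, (M.equiv (M.proj 2 v)).2.2⁆)
    rw [M.equiv_proj_two, M.equiv_proj_two, M.equiv_sl]
    simp
  · simp [proj]

variable {V₁ : Type*} [AddCommGroup V₁] [Module F V₁]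
  [LieRingModule (SlHeis F n) V₁] [LieModule F (SlHeis F n) V₁]
  {V₂ : Type*} [AddCommGroup V₂] [Module F V₂]
  [LieRingModule (SlHeis F n) V₂] [LieModule F (SlHeis F n) V₂]
  {a₀ a₁ b₀ b₁ : ℕ} (M₁ : FUModel F n V₁ a₀ a₁) (M₂ : FUModel F n V₂ b₀ b₁)

theorem tcrd_low {k₁ k₂ : ℕ} (hn : 1 ≤ n) (hk₁ : k₁ ≤ 2 * n - 1)
    (h₁ : a₁ + 2 * k₁ = 2 * n - 1 + a₀) (hk₂ : k₂ ≤ 2 * n - 1)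
    (h₂ : b₁ + 2 * k₂ = 2 * n - 1 + b₀) (I i J j : ℕ) (u : V₁ ⊗[F] V₂) :
    tcrd M₁ M₂ I i J j ⁅heisVec (mono F (2 * n) (2 * n - 1)), u⁆ =
      lowCoeff F n a₀ a₁ k₁ I i * tcrd M₁ M₂ (I + 1) (i - lowShift n k₁ I) J j u +
        lowCoeff F n b₀ b₁ k₂ J j * tcrd M₁ M₂ I i (J + 1) (j - lowShift n k₂ J) u := by
  rw [tcrd, pairing_lie (M₁.crd_low hn hk₁ h₁ I i) (M₂.crd_low hn hk₂ h₂ J j), pairing_smul_left,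
    pairing_smul_right]
  rfl

theorem gradedProj_eq_self_iff (t : ℕ) (u : V₁ ⊗[F] V₂) : gradedProj M₁ M₂ t u = u ↔
    ∀ I i J j, I + J ≠ t → tcrd M₁ M₂ I i J j u = 0 := by
  constructor
  · intro h I i J j hIJ
    rw [← h, tcrd_gradedProj, if_neg hIJ]
  · intro h
    apply eq_of_tcrd M₁ M₂
    intro I i J j _ _
    rw [tcrd_gradedProj]
    split_ifs with hIJ
    · rfl
    · exact (h I i J j hIJ).symm

theorem gradedProj_lie_inSl (t : ℕ) (A : SL2 F) (u : V₁ ⊗[F] V₂) :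
    gradedProj M₁ M₂ t ⁅inSl n A, u⁆ = ⁅inSl n A, gradedProj M₁ M₂ t u⁆ := by
  have s1 : ∀ I, LieModule.toEnd F (SlHeis F n) V₁ (inSl n A) ∘ₗ M₁.proj I =
      M₁.proj I ∘ₗ LieModule.toEnd F (SlHeis F n) V₁ (inSl n A) := by
    intro I; ext v; exact (M₁.proj_lie_inSl I A v).symm
  have s2 : ∀ I, LieModule.toEnd F (SlHeis F n) V₂ (inSl n A) ∘ₗ M₂.proj I =
      M₂.proj I ∘ₗ LieModule.toEnd F (SlHeis F n) V₂ (inSl n A) := by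
    intro I; ext v; exact (M₂.proj_lie_inSl I A v).symm
  rw [gradedProj, LinearMap.sum_apply, LinearMap.sum_apply, ← LieModule.toEnd_apply_apply F _ _ _
    (∑ p ∈ _, _), map_sum]
  apply Finset.sum_congr rfl
  intro p _
  rw [LieModule.toEnd_apply_apply, map_lie_tensor, lie_map, s1, s2]

/-- The `h_n`-invariants of total degree `t` in `V₁ ⊗ V₂`. -/
def gradedInv (t : ℕ) : Submodule F (V₁ ⊗[F] V₂) where
  carrier := {u | gradedProj M₁ M₂ t u = u ∧ ∀ y : Heis F n, ⁅inHeis y, u⁆ = 0}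
  add_mem' := fun {u v} hu hv => ⟨by rw [map_add, hu.1, hv.1], fun y => by
    rw [lie_add, hu.2, hv.2, add_zero]⟩
  zero_mem' := ⟨map_zero _, fun y => lie_zero _⟩
  smul_mem' := fun c u hu => ⟨by rw [map_smul, hu.1], fun y => by
    rw [lie_smul, hu.2, smul_zero]⟩

theorem lie_mem_gradedInv {t : ℕ} (A : SL2 F) {u : V₁ ⊗[F] V₂} (hu : u ∈ gradedInv M₁ M₂ t) :
    ⁅inSl n A, u⁆ ∈ gradedInv M₁ M₂ t := by
  refine ⟨by rw [gradedProj_lie_inSl, hu.1], fun y => ?_⟩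
  have h := leibniz_lie (inSl n A) (inHeis y) u
  rw [hu.2, lie_zero, lie_inSl_inHeis, hu.2, zero_add] at h
  exact h.symm

theorem tcrd_of_mem_gradedInv {t : ℕ} {u : V₁ ⊗[F] V₂} (hu : u ∈ gradedInv M₁ M₂ t)
    {I J : ℕ} (hIJ : I + J ≠ t) (i j : ℕ) : tcrd M₁ M₂ I i J j u = 0 :=
  (gradedProj_eq_self_iff M₁ M₂ t u).mp hu.1 I i J j hIJ

/-- Being killed by `e` expresses every coordinate at `w_i ⊗ w_j` through the one at `w_0 ⊗
w_(i+j)`. -/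
theorem eq_of_tcrd_zero {u u' : V₁ ⊗[F] V₂} (hE : ⁅inSl n (slE F), u⁆ = 0)
    (hE' : ⁅inSl n (slE F), u'⁆ = 0)
    (h : ∀ I J l, I < 3 → J < 3 → tcrd M₁ M₂ I 0 J l u = tcrd M₁ M₂ I 0 J l u') : u = u' := by
  apply eq_of_tcrd M₁ M₂
  intro I i J j hI hJ
  rw [tcrd_of_slE M₁ M₂ hE, tcrd_of_slE M₁ M₂ hE', h I J _ hI hJ]

/-- Up to sign the coordinate at `w_0 ⊗ w_l` equals the one at `w_l ⊗ w_0`, so `l` is also bounded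
by the weight of the left factor. -/
theorem tcrd_zero_of_wt_lt {u : V₁ ⊗[F] V₂} (hE : ⁅inSl n (slE F), u⁆ = 0) {I l : ℕ}
    (hl : M₁.wt I < l) (J : ℕ) : tcrd M₁ M₂ I 0 J l u = 0 := by
  have h := tcrd_of_slE M₁ M₂ hE I l J 0
  rw [tcrd_of_wt_lt_left _ _ hl, add_zero, Nat.choose_self, Nat.cast_one, mul_one] at h
  exact (mul_eq_zero.mp h.symm).resolve_left (pow_ne_zero _ (neg_ne_zero.mpr one_ne_zero))

/-- A highest weight vector of total degree `t + 1` is an `h_n`-invariant if the coordinates of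
degree `t` of its image under the lowest weight vector of `V(2n-1) ⊆ h_n` vanish. -/
theorem mem_gradedInv_of_low {k₁ k₂ : ℕ} (hn : 1 ≤ n) (hk₁ : k₁ ≤ 2 * n - 1)
    (h₁ : a₁ + 2 * k₁ = 2 * n - 1 + a₀) (hk₂ : k₂ ≤ 2 * n - 1)
    (h₂ : b₁ + 2 * k₂ = 2 * n - 1 + b₀) {t : ℕ} {u : V₁ ⊗[F] V₂}
    (hE : ⁅inSl n (slE F), u⁆ = 0) (hdeg : ∀ I i J j, I + J ≠ t + 1 → tcrd M₁ M₂ I i J j u = 0)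
    (hlow : ∀ I i J j, I + J = t →
      lowCoeff F n a₀ a₁ k₁ I i * tcrd M₁ M₂ (I + 1) (i - lowShift n k₁ I) J j u +
        lowCoeff F n b₀ b₁ k₂ J j * tcrd M₁ M₂ I i (J + 1) (j - lowShift n k₂ J) u = 0) :
    u ∈ gradedInv M₁ M₂ (t + 1) := by
  refine ⟨(gradedProj_eq_self_iff M₁ M₂ _ u).mpr hdeg, ?_⟩
  apply inHeis_lie_eq_zero_of_low hn hE
  apply eq_zero_of_tcrd M₁ M₂
  intro I i J j _ _
  rw [tcrd_low M₁ M₂ hn hk₁ h₁ hk₂ h₂]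
  by_cases h : I + J = t
  · exact hlow I i J j h
  · rw [hdeg _ _ _ _ (by omega), hdeg _ _ _ _ (by omega), mul_zero, mul_zero, add_zero]

theorem isoAsSl_gradedInv [FiniteDimensional F V₁] [FiniteDimensional F V₂] {t c : ℕ}
    {w : V₁ ⊗[F] V₂} (hwS : w ∈ gradedInv M₁ M₂ t) (hw : w ≠ 0) (hE : ⁅inSl n (slE F), w⁆ = 0)
    (hH : ⁅inSl n (slH F), w⁆ = (c : F) • w)
    (h : ∀ u ∈ gradedInv M₁ M₂ t, ⁅inSl n (slE F), u⁆ = 0 → ∃ s : F, u = s • w) :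
    IsoAsSl n (gradedInv M₁ M₂ t) (Irr F c) :=
  isoAsSl_of_primitive (fun A _ hu => lie_mem_gradedInv M₁ M₂ A hu) (fun y _ hu => hu.2 y)
    (exists_pow_slE M₁ M₂) hwS hw hE hH h

theorem gradedInv_eq_bot {t : ℕ}
    (h : ∀ u ∈ gradedInv M₁ M₂ t, ⁅inSl n (slE F), u⁆ = 0 → u = 0) : gradedInv M₁ M₂ t = ⊥ :=
  eq_bot_of_primitive (fun _ hu => lie_mem_gradedInv M₁ M₂ _ hu) (exists_pow_slE M₁ M₂) h

/-! ### Exchanging the factors -/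

theorem comm_lie (x : SlHeis F n) (u : V₁ ⊗[F] V₂) :
    TensorProduct.comm F V₁ V₂ ⁅x, u⁆ = ⁅x, TensorProduct.comm F V₁ V₂ u⁆ := by
  induction u using TensorProduct.induction_on with
  | zero => simp
  | tmul v w =>
    simp only [TensorProduct.LieModule.lie_tmul_right, map_add, TensorProduct.comm_tmul]
    rw [add_comm]
  | add u u' hu hu' => rw [lie_add, map_add, hu, hu', map_add, lie_add]

theorem tcrd_comm (I i J j : ℕ) (u : V₁ ⊗[F] V₂) :
    tcrd M₂ M₁ J j I i (TensorProduct.comm F V₁ V₂ u) = tcrd M₁ M₂ I i J j u := by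
  induction u using TensorProduct.induction_on with
  | zero => simp
  | tmul v w => rw [TensorProduct.comm_tmul, tcrd, tcrd, pairing_tmul, pairing_tmul, mul_comm]
  | add u u' hu hu' => rw [map_add, map_add, map_add, hu, hu']

theorem comm_mem_gradedInv {t : ℕ} {u : V₁ ⊗[F] V₂} (hu : u ∈ gradedInv M₁ M₂ t) :
    TensorProduct.comm F V₁ V₂ u ∈ gradedInv M₂ M₁ t := by
  refine ⟨(gradedProj_eq_self_iff M₂ M₁ _ _).mpr fun J j I i h => ?_, fun y => ?_⟩
  · rw [tcrd_comm]
    exact tcrd_of_mem_gradedInv M₁ M₂ hu (by omega) _ _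
  · rw [← comm_lie, hu.2, map_zero]

theorem gradedInv_eq_map_comm (t : ℕ) : gradedInv M₂ M₁ t =
    (gradedInv M₁ M₂ t).map (TensorProduct.comm F V₁ V₂).toLinearMap := by
  ext u
  constructor
  · intro hu
    exact ⟨_, comm_mem_gradedInv M₂ M₁ hu, TensorProduct.comm_comm F V₁ V₂ u⟩
  · rintro ⟨u, hu, rfl⟩
    exact comm_mem_gradedInv M₁ M₂ hu

theorem IsoAsSl.gradedInv_comm {t : ℕ} {M : Type*} [AddCommGroup M] [Module F M]
    [LieRingModule (SL2 F) M] (h : IsoAsSl n (gradedInv M₁ M₂ t) M) :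
    IsoAsSl n (gradedInv M₂ M₁ t) M := by
  obtain ⟨φ, hφ, hr, he⟩ := h
  refine ⟨(TensorProduct.comm F V₁ V₂).toLinearMap ∘ₗ φ,
    (TensorProduct.comm F V₁ V₂).injective.comp hφ, ?_, fun A v => ?_⟩
  · rw [LinearMap.range_comp, hr, gradedInv_eq_map_comm M₁ M₂]
  · rw [LinearMap.comp_apply, he]
    exact comm_lie _ _

theorem gradedInv_comm_eq_bot {t : ℕ} (h : gradedInv M₁ M₂ t = ⊥) : gradedInv M₂ M₁ t = ⊥ := by
  rw [gradedInv_eq_map_comm M₁ M₂, h, Submodule.map_bot]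

end GradedInvariants

/-! ### A nonvanishing determinant -/

section Determinant

variable {F : Type*} [Field F] [CharZero F] {n : ℕ}

/-- Up to a common nonzero factor the two products are products of falling factorials, and `x ↦
x.descFactorial m` is strictly increasing where it is positive. This is the determinant of the
system for `S_1` in the case `k₁ = k₂ = 0`. -/
theorem lowOne_det_ne_zero (hn : 1 ≤ n) {a b l : ℕ} (ha : 2 * n - 1 ≤ a) (hb : 2 * n - 1 ≤ b)
    (hl : l ≠ 0) :
    lowOne F n a 0 0 * lowOne F n b 0 0 - lowOne F n a 0 l * lowOne F n b 0 l ≠ 0 := by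
  rw [lowOne_of_le le_rfl, lowOne_of_le le_rfl, lowOne_of_le (Nat.zero_le _),
    lowOne_of_le (Nat.zero_le _)]
  simp only [Nat.sub_zero]
  have lt : ∀ c, 2 * n - 1 ≤ c →
      (c - l).descFactorial (2 * n - 1) < c.descFactorial (2 * n - 1) := by
    intro c hc
    obtain ⟨m, hm⟩ : ∃ m, 2 * n - 1 = m + 1 := ⟨2 * n - 2, by omega⟩
    rw [hm] at hc ⊢
    obtain ⟨d, rfl⟩ : ∃ d, c = d + 1 := ⟨c - 1, by omega⟩
    calc (d + 1 - l).descFactorial (m + 1) ≤ d.descFactorial (m + 1) :=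
          Nat.descFactorial_le _ (by omega)
      _ = (d - m) * d.descFactorial m := Nat.descFactorial_succ _ _
      _ < (d + 1) * d.descFactorial m := by
          apply Nat.mul_lt_mul_of_pos_right (by omega)
          exact Nat.pos_of_ne_zero (by rw [Ne, Nat.descFactorial_eq_zero_iff_lt]; omega)
      _ = _ := (Nat.succ_descFactorial_succ _ _).symm
  have l3 := Nat.mul_lt_mul'' (lt a ha) (lt b hb)
  generalize (a - l).descFactorial (2 * n - 1) = x' at l3 ⊢
  generalize (b - l).descFactorial (2 * n - 1) = y' at l3 ⊢
  generalize a.descFactorial (2 * n - 1) = x at l3 ⊢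
  generalize b.descFactorial (2 * n - 1) = y at l3 ⊢
  have l4 : (2 * n - 1).descFactorial (2 * n - 1) ≠ 0 := by
    rw [Ne, Nat.descFactorial_eq_zero_iff_lt]; omega
  generalize (2 * n - 1).descFactorial (2 * n - 1) = d at l4 ⊢
  have hs : (-1 : F) ^ (2 * n - 1) ≠ 0 := pow_ne_zero _ (neg_ne_zero.mpr one_ne_zero)
  generalize (-1 : F) ^ (2 * n - 1) = s at hs ⊢
  intro h
  have h' : (s * d) ^ 2 * (((x * y : ℕ) : F) - ((x' * y' : ℕ) : F)) = 0 := by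
    push_cast at h ⊢
    linear_combination h
  rcases mul_eq_zero.mp h' with h | h
  · exact pow_ne_zero 2 (mul_ne_zero hs (Nat.cast_ne_zero.mpr l4)) h
  · exact l3.ne' (Nat.cast_injective (sub_eq_zero.mp h))

end Determinant

/-! ### The invariants `S_1` -/

section DegreeOne

variable {F : Type*} [Field F] [CharZero F] {n : ℕ} {V₁ : Type*} [AddCommGroup V₁] [Module F V₁]
  [LieRingModule (SlHeis F n) V₁] [LieModule F (SlHeis F n) V₁]
  {V₂ : Type*} [AddCommGroup V₂] [Module F V₂]
  [LieRingModule (SlHeis F n) V₂] [LieModule F (SlHeis F n) V₂]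
  {a₀ a₁ b₀ b₁ k₁ k₂ : ℕ} (M₁ : FUModel F n V₁ a₀ a₁) (M₂ : FUModel F n V₂ b₀ b₁)

/-- Invariance under `w_m`, rewritten in the coordinates at `w_0 ⊗ w_l` only. Each choice of `(i,
j)` relates one coordinate of the layer `(I + 1, J)` to one of `(I, J + 1)`; the later arguments
choose `(i, j)` so that one coefficient vanishes or two relations become independent. -/
theorem tcrd_relation (hn : 1 ≤ n) (hk₁ : k₁ ≤ 2 * n - 1)
    (h₁ : a₁ + 2 * k₁ = 2 * n - 1 + a₀) (hk₂ : k₂ ≤ 2 * n - 1)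
    (h₂ : b₁ + 2 * k₂ = 2 * n - 1 + b₀) {t : ℕ} {u : V₁ ⊗[F] V₂} (hu : u ∈ gradedInv M₁ M₂ t)
    (hE : ⁅inSl n (slE F), u⁆ = 0) (I J i j : ℕ) :
    lowCoeff F n a₀ a₁ k₁ I i * ((-1) ^ (i - lowShift n k₁ I) *
        (((i - lowShift n k₁ I + j).choose (i - lowShift n k₁ I) : ℕ) : F) *
        tcrd M₁ M₂ (I + 1) 0 J (i - lowShift n k₁ I + j) u) +
      lowCoeff F n b₀ b₁ k₂ J j * ((-1) ^ i *
        (((i + (j - lowShift n k₂ J)).choose i : ℕ) : F) *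
        tcrd M₁ M₂ I 0 (J + 1) (i + (j - lowShift n k₂ J)) u) = 0 := by
  have h := tcrd_low M₁ M₂ hn hk₁ h₁ hk₂ h₂ I i J j u
  rw [hu.2, map_zero] at h
  rw [← tcrd_of_slE M₁ M₂ hE, ← tcrd_of_slE M₁ M₂ hE]
  exact h.symm

theorem tcrd_zero_hwVec {I J l : ℕ} (hI : I < 3) (hJ : J < 3) (h₁ : l ≤ M₁.wt I)
    (h₂ : l ≤ M₂.wt J) (K L k' : ℕ) : tcrd M₁ M₂ K 0 L k' (hwVec M₁ M₂ I J l) =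
      if K = I ∧ L = J ∧ k' = l then 1 else 0 := by
  rw [tcrd_hwVec M₁ M₂ hI hJ h₁ h₂]
  simp

theorem FUModel.wt_zero {V : Type*} [AddCommGroup V] [Module F V] [LieRingModule (SlHeis F n) V]
    (M : FUModel F n V a₀ a₁) : M.wt 0 = a₀ := rfl

theorem FUModel.wt_one {V : Type*} [AddCommGroup V] [Module F V] [LieRingModule (SlHeis F n) V]
    (M : FUModel F n V a₀ a₁) : M.wt 1 = a₁ := rfl

theorem FUModel.wt_two {V : Type*} [AddCommGroup V] [Module F V] [LieRingModule (SlHeis F n) V]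
    (M : FUModel F n V a₀ a₁) : M.wt 2 = a₀ := rfl

/-- A vector of degree one annihilated by `e` is determined by its coordinates
`w_0 ⊗ w_l`. -/
theorem eq_of_tcrd_degree_one {u u' : V₁ ⊗[F] V₂} (hu : u ∈ gradedInv M₁ M₂ 1)
    (hu' : u' ∈ gradedInv M₁ M₂ 1) (hE : ⁅inSl n (slE F), u⁆ = 0) (hE' : ⁅inSl n (slE F), u'⁆ = 0)
    (hβ : ∀ l, tcrd M₁ M₂ 0 0 1 l u = tcrd M₁ M₂ 0 0 1 l u')
    (hγ : ∀ l, tcrd M₁ M₂ 1 0 0 l u = tcrd M₁ M₂ 1 0 0 l u') : u = u' := by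
  apply eq_of_tcrd_zero M₁ M₂ hE hE'
  intro I J l _ _
  by_cases h : I + J = 1
  · have : I = 0 ∧ J = 1 ∨ I = 1 ∧ J = 0 := by omega
    rcases this with ⟨rfl, rfl⟩ | ⟨rfl, rfl⟩
    · exact hβ l
    · exact hγ l
  · rw [tcrd_of_mem_gradedInv M₁ M₂ hu h, tcrd_of_mem_gradedInv M₁ M₂ hu' h]

/-- `S_1` is irreducible as soon as its highest weight vectors are the multiples of
`γ v + β v'`, where `v` and `v'` are highest weight vectors of the two summands. -/
theorem isoAsSl_gradedInv_one [FiniteDimensional F V₁] [FiniteDimensional F V₂] (hn : 1 ≤ n)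
    (hk₁ : k₁ ≤ 2 * n - 1) (h₁ : a₁ + 2 * k₁ = 2 * n - 1 + a₀) (hk₂ : k₂ ≤ 2 * n - 1)
    (h₂ : b₁ + 2 * k₂ = 2 * n - 1 + b₀) {c l l' : ℕ} (hl : l ≤ a₁) (hl₂ : l ≤ b₀) (hl' : l' ≤ a₀)
    (hl₂' : l' ≤ b₁) (hc : a₁ + b₀ = c + 2 * l) (hc' : a₀ + b₁ = c + 2 * l') {γ β : F} (hγ : γ ≠ 0)
    (hlow : ∀ i j, lowOne F n a₁ k₁ i * (if i - k₁ + j = l then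
        γ * ((-1) ^ (i - k₁) * ((l.choose (i - k₁) : ℕ) : F)) else 0) +
      lowOne F n b₁ k₂ j * (if i + (j - k₂) = l' then
        β * ((-1) ^ i * ((l'.choose i : ℕ) : F)) else 0) = 0)
    (huniq : ∀ u ∈ gradedInv M₁ M₂ 1, ⁅inSl n (slE F), u⁆ = 0 →
      (∀ x, x ≠ l → tcrd M₁ M₂ 1 0 0 x u = 0) ∧ (∀ x, x ≠ l' → tcrd M₁ M₂ 0 0 1 x u = 0) ∧
        γ * tcrd M₁ M₂ 0 0 1 l' u = β * tcrd M₁ M₂ 1 0 0 l u) :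
    IsoAsSl n (gradedInv M₁ M₂ 1) (Irr F c) := by
  have t1 := tcrd_hwVec M₁ M₂ (I := 1) (J := 0) (by omega) (by omega) hl hl₂
  have t2 := tcrd_hwVec M₁ M₂ (I := 0) (J := 1) (by omega) (by omega) hl' hl₂'
  have z1 := tcrd_zero_hwVec M₁ M₂ (I := 1) (J := 0) (by omega) (by omega) hl hl₂
  have z2 := tcrd_zero_hwVec M₁ M₂ (I := 0) (J := 1) (by omega) (by omega) hl' hl₂'
  have e1 := slE_hwVec M₁ M₂ (I := 1) (J := 0) (by omega) (by omega) hl hl₂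
  have e2 := slE_hwVec M₁ M₂ (I := 0) (J := 1) (by omega) (by omega) hl' hl₂'
  have c1 := slH_hwVec M₁ M₂ (I := 1) (J := 0) (by omega) (by omega) hl hl₂
  have c2 := slH_hwVec M₁ M₂ (I := 0) (J := 1) (by omega) (by omega) hl' hl₂'
  rw [M₁.wt_one, M₂.wt_zero, show (a₁ : F) + b₀ - 2 * l = c by
    rw [← Nat.cast_add, hc]; push_cast; ring] at c1
  rw [M₁.wt_zero, M₂.wt_one, show (a₀ : F) + b₁ - 2 * l' = c by
    rw [← Nat.cast_add, hc']; push_cast; ring] at c2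
  generalize hwVec M₁ M₂ 1 0 l = x at t1 z1 e1 c1
  generalize hwVec M₁ M₂ 0 1 l' = y at t2 z2 e2 c2
  have hE : ⁅inSl n (slE F), γ • x + β • y⁆ = 0 := by
    rw [lie_add, lie_smul, lie_smul, e1, e2, smul_zero, smul_zero, add_zero]
  have hwS : γ • x + β • y ∈ gradedInv M₁ M₂ 1 := by
    refine mem_gradedInv_of_low M₁ M₂ hn hk₁ h₁ hk₂ h₂ hE ?_ ?_
    · intro I i J j h
      rw [map_add, map_smul, map_smul, t1, t2, if_neg (by omega), if_neg (by omega), smul_zero,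
        smul_zero, add_zero]
    · intro I i J j h
      obtain ⟨rfl, rfl⟩ : I = 0 ∧ J = 0 := by omega
      have := hlow i j
      simpa [t1, t2, lowCoeff, lowShift] using this
  have hx : ∀ k, tcrd M₁ M₂ 1 0 0 k (γ • x + β • y) = if k = l then γ else 0 := by
    intro k
    simp [z1, z2]
  have hy : ∀ k, tcrd M₁ M₂ 0 0 1 k (γ • x + β • y) = if k = l' then β else 0 := by
    intro k
    simp [z1, z2]
  refine isoAsSl_gradedInv M₁ M₂ hwS ?_ hE ?_ ?_
  · intro h0
    have := hx l
    rw [h0, map_zero, if_pos rfl] at this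
    exact hγ this.symm
  · rw [lie_add, lie_smul, lie_smul, c1, c2, smul_add, smul_comm γ, smul_comm β]
  · intro u hu hEu
    obtain ⟨u1, u2, u3⟩ := huniq u hu hEu
    refine ⟨tcrd M₁ M₂ 1 0 0 l u / γ, eq_of_tcrd_degree_one M₁ M₂ hu
      (Submodule.smul_mem _ _ hwS) hEu (by rw [lie_smul, hE, smul_zero]) ?_ ?_⟩
    · intro k
      rw [map_smul, hy, smul_eq_mul]
      split_ifs with hk
      · subst hk
        field_simp
        linear_combination u3
      · rw [u2 k hk, mul_zero]
    · intro k
      rw [map_smul, hx, smul_eq_mul]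
      split_ifs with hk
      · subst hk
        field_simp
      · rw [u1 k hk, mul_zero]

/-- For `l ≠ 0` the relations at `(0, l)` and `(l, 0)` form a system in two unknowns with nonzero
determinant, so both coordinates vanish. At `l = 0` the two relations coincide and leave a line, of
weight `a₁ + b₀ = a₀ + b₀ + m`. -/
theorem isoAsSl_gradedInv_one_zero_zero [FiniteDimensional F V₁] [FiniteDimensional F V₂]
    (hn : 1 ≤ n) (h₁ : a₁ = 2 * n - 1 + a₀) (h₂ : b₁ = 2 * n - 1 + b₀) :
    IsoAsSl n (gradedInv M₁ M₂ 1) (Irr F (a₀ + b₀ + (2 * n - 1))) := by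
  have h₁' : a₁ + 2 * 0 = 2 * n - 1 + a₀ := by omega
  have h₂' : b₁ + 2 * 0 = 2 * n - 1 + b₀ := by omega
  have hB : lowOne F n b₁ 0 0 ≠ 0 := lowOne_ne_zero (Nat.zero_le _) h₂' le_rfl (Nat.zero_le _)
  refine isoAsSl_gradedInv_one M₁ M₂ (l := 0) (l' := 0) (β := -lowOne F n a₁ 0 0) hn
    (Nat.zero_le _) h₁' (Nat.zero_le _) h₂' (Nat.zero_le _) (Nat.zero_le _) (Nat.zero_le _)
    (Nat.zero_le _) (by omega) (by omega) hB ?_ ?_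
  · intro i j
    by_cases hij : i = 0 ∧ j = 0
    · obtain ⟨rfl, rfl⟩ := hij
      simp
      ring
    · rw [if_neg (by omega), if_neg (by omega), mul_zero, mul_zero, add_zero]
  · intro u hu hEu
    have R := tcrd_relation M₁ M₂ hn (Nat.zero_le _) h₁' (Nat.zero_le _) h₂' hu hEu 0 0
    simp only [lowCoeff, lowShift, Nat.sub_zero, zero_add] at R
    have h0 := R 0 0
    simp only [pow_zero, Nat.choose_self, Nat.cast_one, one_mul, add_zero] at h0
    have hz : ∀ l, l ≠ 0 → tcrd M₁ M₂ 1 0 0 l u = 0 ∧ tcrd M₁ M₂ 0 0 1 l u = 0 := by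
      intro l hl
      have r1 := R 0 l
      have r2 := R l 0
      simp only [pow_zero, Nat.choose_self, Nat.choose_zero_right, Nat.cast_one, one_mul, mul_one,
        add_zero, zero_add] at r1 r2
      have r3 : lowOne F n a₁ 0 l * tcrd M₁ M₂ 1 0 0 l u +
          lowOne F n b₁ 0 0 * tcrd M₁ M₂ 0 0 1 l u = 0 := by
        have : (-1 : F) ^ l ≠ 0 := pow_ne_zero _ (neg_ne_zero.mpr one_ne_zero)
        apply mul_left_cancel₀ this
        linear_combination r2
      have hdet := lowOne_det_ne_zero (F := F) hn (by omega : 2 * n - 1 ≤ a₁)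
        (by omega : 2 * n - 1 ≤ b₁) hl
      constructor
      · apply mul_left_cancel₀ hdet
        linear_combination lowOne F n b₁ 0 0 * r1 - lowOne F n b₁ 0 l * r3
      · apply mul_left_cancel₀ hdet
        linear_combination lowOne F n a₁ 0 0 * r3 - lowOne F n a₁ 0 l * r1
    refine ⟨fun l hl => (hz l hl).1, fun l hl => (hz l hl).2, ?_⟩
    linear_combination h0

/-! ### `S_1` when `k₁ = 0` and `k₂ = 1` -/

section ZeroOne

/-- The coordinates of the highest weight vectors of `S_1` when `a₁ = a₀ + m`,
`b₁ = b₀ + m - 2`. -/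
theorem tcrd_degree_one_zero_one (hn : 1 ≤ n) (h₁ : a₁ = 2 * n - 1 + a₀) (hb : 1 ≤ b₀)
    (h₂ : b₁ + 2 = 2 * n - 1 + b₀) {u : V₁ ⊗[F] V₂} (hu : u ∈ gradedInv M₁ M₂ 1)
    (hE : ⁅inSl n (slE F), u⁆ = 0) :
    (∀ l, l ≠ a₀ + 1 → tcrd M₁ M₂ 1 0 0 l u = 0) ∧ (∀ l, l ≠ a₀ → tcrd M₁ M₂ 0 0 1 l u = 0) ∧
      lowOne F n a₁ 0 a₀ * (a₀ + 1) * tcrd M₁ M₂ 1 0 0 (a₀ + 1) u +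
        lowOne F n b₁ 1 1 * tcrd M₁ M₂ 0 0 1 a₀ u = 0 := by
  have h₁' : a₁ + 2 * 0 = 2 * n - 1 + a₀ := by omega
  have h₂' : b₁ + 2 * 1 = 2 * n - 1 + b₀ := by omega
  have R := tcrd_relation M₁ M₂ hn (Nat.zero_le _) h₁' (by omega) h₂' hu hE 0 0
  simp only [lowCoeff, lowShift, Nat.sub_zero, zero_add] at R
  have hsign : ∀ l, (-1 : F) ^ l ≠ 0 := fun l => pow_ne_zero _ (neg_ne_zero.mpr one_ne_zero)
  have hA : ∀ i, i ≤ a₀ → lowOne F n a₁ 0 i ≠ 0 := fun i hi =>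
    lowOne_ne_zero (Nat.zero_le _) h₁' (Nat.zero_le _) hi
  have hB : lowOne F n b₁ 1 1 ≠ 0 := lowOne_ne_zero (by omega) h₂' le_rfl hb
  -- At `j = 0` the second coefficient vanishes, because on the second factor `w_m` raises the index
  -- by `k₂ = 1`.
  have g1 : ∀ l, l ≤ a₀ → tcrd M₁ M₂ 1 0 0 l u = 0 := by
    intro l hl
    have r := R l 0
    rw [lowOne_of_lt Nat.zero_lt_one, zero_mul, add_zero, add_zero, Nat.choose_self, Nat.cast_one,
      mul_one] at r
    exact ((mul_eq_zero.mp r).resolve_left (hA l hl) |> mul_eq_zero.mp).resolve_left (hsign l)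
  -- The relation at `(l, 1)` links the coordinate `l + 1` of the layer `(1, 0)` with the coordinate
  -- `l` of `(0, 1)`.
  have r1 : ∀ l, lowOne F n a₁ 0 l * (l + 1) * tcrd M₁ M₂ 1 0 0 (l + 1) u +
      lowOne F n b₁ 1 1 * tcrd M₁ M₂ 0 0 1 l u = 0 := by
    intro l
    have r := R l 1
    rw [Nat.sub_self, add_zero, Nat.choose_self, Nat.choose_succ_self_right] at r
    apply mul_left_cancel₀ (hsign l)
    push_cast at r
    linear_combination r
  have g2 : ∀ l, l ≠ a₀ → tcrd M₁ M₂ 0 0 1 l u = 0 := by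
    intro l hl
    rcases lt_or_gt_of_ne hl with h | h
    · have r := r1 l
      rw [g1 _ (by omega), mul_zero, zero_add] at r
      exact (mul_eq_zero.mp r).resolve_left hB
    · exact tcrd_zero_of_wt_lt M₁ M₂ hE h 1
  refine ⟨fun l hl => ?_, g2, r1 a₀⟩
  rcases le_or_gt l a₀ with h | h
  · exact g1 l h
  · have r := R 0 l
    rw [zero_add, zero_add, g2 _ (by omega), mul_zero, mul_zero, add_zero, Nat.choose_zero_right,
      pow_zero, Nat.cast_one, one_mul, one_mul] at r
    exact (mul_eq_zero.mp r).resolve_left (hA 0 (Nat.zero_le _))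

/-- The only possible index in `V(a₁) ⊗ V(b₀)` is `a₀ + 1`, which exceeds `b₀`; the linked
coordinate in `V(a₀) ⊗ V(b₁)` vanishes with it. -/
theorem gradedInv_one_zero_one_eq_bot (hn : 1 ≤ n) (h₁ : a₁ = 2 * n - 1 + a₀) (hb : 1 ≤ b₀)
    (h₂ : b₁ + 2 = 2 * n - 1 + b₀) (hab : b₀ ≤ a₀) : gradedInv M₁ M₂ 1 = ⊥ := by
  apply gradedInv_eq_bot
  intro u hu hE
  obtain ⟨u1, u2, u3⟩ := tcrd_degree_one_zero_one M₁ M₂ hn h₁ hb h₂ hu hE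
  have hB : lowOne F n b₁ 1 1 ≠ 0 :=
    lowOne_ne_zero (by omega) (by omega : b₁ + 2 * 1 = 2 * n - 1 + b₀) le_rfl hb
  have h0 : tcrd M₁ M₂ 1 0 0 (a₀ + 1) u = 0 :=
    tcrd_of_wt_lt_right _ _ (Nat.lt_succ_of_le hab) _ _ _
  rw [h0, mul_zero, zero_add] at u3
  refine eq_of_tcrd_degree_one M₁ M₂ hu (Submodule.zero_mem _) hE (lie_zero _) ?_ ?_
  · intro l
    rw [map_zero]
    by_cases hl : l = a₀
    · rw [hl]
      exact (mul_eq_zero.mp u3).resolve_left hB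
    · exact u2 l hl
  · intro l
    rw [map_zero]
    by_cases hl : l = a₀ + 1
    · rw [hl, h0]
    · exact u1 l hl

/-- The indices `a₀ + 1` in `V(a₁) ⊗ V(b₀)` and `a₀` in `V(a₀) ⊗ V(b₁)` survive, with the common
weight `m + b₀ - a₀ - 2`. Invariance of the combination reduces to `binom(a₀ + 1, i) (a₀ + 1 - i) =
binom(a₀, i) (a₀ + 1)`. -/
theorem isoAsSl_gradedInv_one_zero_one [FiniteDimensional F V₁] [FiniteDimensional F V₂]
    (hn : 1 ≤ n) (h₁ : a₁ = 2 * n - 1 + a₀) (h₂ : b₁ + 2 = 2 * n - 1 + b₀) (hab : a₀ < b₀)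
    (h : n = 1 ∨ a₀ = 0 ∧ b₀ = 1) {c : ℕ} (hc : c + a₀ + 2 = 2 * n - 1 + b₀) :
    IsoAsSl n (gradedInv M₁ M₂ 1) (Irr F c) := by
  have h₁' : a₁ + 2 * 0 = 2 * n - 1 + a₀ := by omega
  have h₂' : b₁ + 2 * 1 = 2 * n - 1 + b₀ := by omega
  have hB : lowOne F n b₁ 1 1 ≠ 0 := lowOne_ne_zero (by omega) h₂' le_rfl (by omega)
  refine isoAsSl_gradedInv_one M₁ M₂ (l := a₀ + 1) (l' := a₀)
    (β := -(lowOne F n a₁ 0 a₀ * (a₀ + 1))) hn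
    (Nat.zero_le _) h₁' (by omega) h₂' (by omega) (by omega) le_rfl (by omega) (by omega)
    (by omega) hB ?_ ?_
  · intro i j
    rw [Nat.sub_zero]
    rcases Nat.eq_zero_or_pos j with rfl | hj
    · rw [lowOne_of_lt Nat.zero_lt_one, zero_mul, add_zero]
      split_ifs with hi
      · have : lowOne F n a₁ 0 i = 0 := lowOne_of_gt h₁' (Nat.zero_le _) (by omega) (by omega)
        rw [this, zero_mul]
      · exact mul_zero _
    · by_cases hij : i + j = a₀ + 1
      · rw [if_pos hij, if_pos (by omega)]
        -- For `n = 1` the coefficient is linear in `i`; otherwise `a₀ = 0` and `i + j = 1` with `j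
        -- > 0` leave only `i = 0`.
        have hA : lowOne F n a₁ 0 i = lowOne F n a₁ 0 a₀ * (a₀ + 1 - i) := by
          rcases h with rfl | ⟨h, -⟩
          · rw [lowOne_of_le (Nat.zero_le _), lowOne_of_le (Nat.zero_le _)]
            have e1 : a₁ - (i - 0) = a₀ + 1 - i := by omega
            have e2 : a₁ - (a₀ - 0) = 1 := by omega
            have e3 : ((a₀ + 1 - i : ℕ) : F) = a₀ + 1 - i := by
              rw [Nat.cast_sub (by omega)]; push_cast; ring
            rw [e1, e2]
            simp [e3]
          · have : i = 0 := by omega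
            subst this
            rw [h]
            simp
        have hB' : lowOne F n b₁ 1 j = lowOne F n b₁ 1 1 := by
          rcases h with rfl | ⟨h, -⟩
          · rw [lowOne_of_le hj, lowOne_of_le le_rfl]
            simp
          · rw [show j = 1 by omega]
        have h3 : (((a₀ + 1).choose i : ℕ) : F) * (a₀ + 1 - i) = (a₀.choose i : ℕ) * (a₀ + 1) := by
          have h3 := Nat.choose_mul_succ_eq a₀ i
          have h4 := congrArg (Nat.cast : ℕ → F) h3
          rw [Nat.cast_mul, Nat.cast_mul, Nat.cast_sub (by omega)] at h4
          push_cast at h4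
          exact h4.symm
        rw [hA, hB']
        linear_combination lowOne F n a₁ 0 a₀ * lowOne F n b₁ 1 1 * (-1) ^ i * h3
      · rw [if_neg hij, if_neg (by omega), mul_zero, mul_zero, add_zero]
  · intro u hu hE
    obtain ⟨u1, u2, u3⟩ := tcrd_degree_one_zero_one M₁ M₂ hn h₁ (by omega) h₂ hu hE
    exact ⟨u1, u2, by linear_combination u3⟩

end ZeroOne

/-! ### `S_1` when `k₁ = k₂ = 1` -/

section OneOne

/-- The coordinates of the highest weight vectors of `S_1` when `a₁ = a₀ + m - 2`,
`b₁ = b₀ + m - 2`. -/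
theorem tcrd_degree_one_one_one (hn : 1 ≤ n)
    (h₁ : a₁ + 2 = 2 * n - 1 + a₀) (h₂ : b₁ + 2 = 2 * n - 1 + b₀) {u : V₁ ⊗[F] V₂}
    (hu : u ∈ gradedInv M₁ M₂ 1) (hE : ⁅inSl n (slE F), u⁆ = 0) :
    (∀ l, l < a₀ → tcrd M₁ M₂ 1 0 0 l u = 0) ∧ (∀ l, l < b₀ → tcrd M₁ M₂ 0 0 1 l u = 0) ∧
      lowOne F n a₁ 1 1 * tcrd M₁ M₂ 1 0 0 1 u - lowOne F n b₁ 1 1 * tcrd M₁ M₂ 0 0 1 1 u = 0 := by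
  have h₁' : a₁ + 2 * 1 = 2 * n - 1 + a₀ := by omega
  have h₂' : b₁ + 2 * 1 = 2 * n - 1 + b₀ := by omega
  have R := tcrd_relation M₁ M₂ hn (by omega) h₁' (by omega) h₂' hu hE 0 0
  simp only [lowCoeff, lowShift, zero_add] at R
  have hsign : ∀ l, (-1 : F) ^ l ≠ 0 := fun l => pow_ne_zero _ (neg_ne_zero.mpr one_ne_zero)
  -- On both factors `w_m` raises the index by one, so the relations at `(l + 1, 0)` and `(0, l +
  -- 1)` have one term each; the relation at `(1, 1)` links the two layers.
  refine ⟨fun l hl => ?_, fun l hl => ?_, ?_⟩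
  · have r := R (l + 1) 0
    rw [lowOne_of_lt Nat.zero_lt_one, zero_mul, add_zero, add_zero, Nat.add_sub_cancel,
      Nat.choose_self, Nat.cast_one, mul_one] at r
    exact ((mul_eq_zero.mp r).resolve_left (lowOne_ne_zero (by omega) h₁' (by omega) (by omega)) |>
      mul_eq_zero.mp).resolve_left (hsign l)
  · have r := R 0 (l + 1)
    rw [lowOne_of_lt Nat.zero_lt_one, zero_mul, zero_add, zero_add, Nat.add_sub_cancel,
      Nat.choose_zero_right, Nat.cast_one, pow_zero, one_mul, one_mul] at r
    exact (mul_eq_zero.mp r).resolve_left (lowOne_ne_zero (by omega) h₂' (by omega) (by omega))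
  · have r := R 1 1
    simp at r
    linear_combination r

/-- For `n = 1` the middle weights are `a₀ - 1` and `b₀ - 1`, so every admissible index lies in the
range where the coordinates vanish. -/
theorem gradedInv_one_one_one_eq_bot (hn : n = 1) (h₁ : a₁ + 1 = a₀) (h₂ : b₁ + 1 = b₀) :
    gradedInv M₁ M₂ 1 = ⊥ := by
  apply gradedInv_eq_bot
  intro u hu hE
  obtain ⟨u1, u2, -⟩ := tcrd_degree_one_one_one M₁ M₂ hn.ge (by omega) (by omega) hu hE
  refine eq_of_tcrd_degree_one M₁ M₂ hu (Submodule.zero_mem _) hE (lie_zero _) ?_ ?_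
  · intro l
    rw [map_zero]
    rcases lt_or_ge l b₀ with h | h
    · exact u2 l h
    · exact tcrd_of_wt_lt_right _ _ (by rw [M₂.wt_one]; omega) _ _ _
  · intro l
    rw [map_zero]
    rcases lt_or_ge l a₀ with h | h
    · exact u1 l h
    · exact tcrd_zero_of_wt_lt M₁ M₂ hE (by rw [M₁.wt_one]; omega) _

/-- With `a₀ = b₀ = 1` the index is at most one and index zero is excluded. The remaining relation
at `(1, 1)` leaves a line, of weight `a₁ + b₀ - 2 = m - 2`. -/
theorem isoAsSl_gradedInv_one_one_one [FiniteDimensional F V₁] [FiniteDimensional F V₂]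
    (hn : 1 < n) (h₁ : a₁ + 2 = 2 * n - 1 + a₀) (h₂ : b₁ + 2 = 2 * n - 1 + b₀) (ha : a₀ = 1)
    (hb : b₀ = 1) : IsoAsSl n (gradedInv M₁ M₂ 1) (Irr F (2 * n - 1 - 2)) := by
  have h₁' : a₁ + 2 * 1 = 2 * n - 1 + a₀ := by omega
  have h₂' : b₁ + 2 * 1 = 2 * n - 1 + b₀ := by omega
  have hB : lowOne F n b₁ 1 1 ≠ 0 := lowOne_ne_zero (by omega) h₂' le_rfl (by omega)
  refine isoAsSl_gradedInv_one M₁ M₂ (l := 1) (l' := 1) (β := lowOne F n a₁ 1 1) hn.le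
    (by omega) h₁' (by omega) h₂' (by omega) (by omega) (by omega) (by omega) (by omega)
    (by omega) hB ?_ ?_
  · intro i j
    rcases Nat.eq_zero_or_pos j with rfl | hj
    · rw [lowOne_of_lt Nat.zero_lt_one, zero_mul, add_zero]
      split_ifs with hi
      · rw [lowOne_of_gt h₁' (by omega) (by omega) (by omega), zero_mul]
      · exact mul_zero _
    rcases Nat.eq_zero_or_pos i with rfl | hi
    · rw [lowOne_of_lt Nat.zero_lt_one, zero_mul, zero_add]
      split_ifs with hj'
      · rw [lowOne_of_gt h₂' (by omega) (by omega) (by omega), zero_mul]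
      · exact mul_zero _
    by_cases hij : i = 1 ∧ j = 1
    · obtain ⟨rfl, rfl⟩ := hij
      simp
      ring
    · rw [if_neg (by omega), if_neg (by omega), mul_zero, mul_zero, add_zero]
  · intro u hu hE
    obtain ⟨u1, u2, u3⟩ := tcrd_degree_one_one_one M₁ M₂ hn.le h₁ h₂ hu hE
    refine ⟨fun x hx => ?_, fun x hx => ?_, by linear_combination -u3⟩
    · rcases lt_or_ge x a₀ with h | h
      · exact u1 x h
      · exact tcrd_of_wt_lt_right _ _ (by rw [M₂.wt_zero]; omega) _ _ _
    · rcases lt_or_ge x b₀ with h | h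
      · exact u2 x h
      · exact tcrd_zero_of_wt_lt M₁ M₂ hE (by rw [M₁.wt_zero]; omega) _

end OneOne

end DegreeOne


/-! ### The invariants `S_2` -/

section DegreeTwo

variable {F : Type*} [Field F] [CharZero F] {n : ℕ} {V₁ : Type*} [AddCommGroup V₁] [Module F V₁]
  [LieRingModule (SlHeis F n) V₁] [LieModule F (SlHeis F n) V₁]
  {V₂ : Type*} [AddCommGroup V₂] [Module F V₂]
  [LieRingModule (SlHeis F n) V₂] [LieModule F (SlHeis F n) V₂]
  {a₀ a₁ b₀ b₁ k₁ k₂ : ℕ} (M₁ : FUModel F n V₁ a₀ a₁) (M₂ : FUModel F n V₂ b₀ b₁)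

/-- For an invariant, the coordinates in `V(a₀) ⊗ V(b₀)` (bottom times top) and (top times
bottom) determine each other. -/
theorem tcrd_zero_two_eq_zero_iff {t : ℕ} {u : V₁ ⊗[F] V₂} (hu : u ∈ gradedInv M₁ M₂ t)
    (l : ℕ) : tcrd M₁ M₂ 0 0 2 l u = 0 ↔ tcrd M₁ M₂ 2 0 0 l u = 0 := by
  obtain ⟨-, -, -, h⟩ := tcrd_of_heisZ M₁ M₂ (hu.2 _) 0 l
  constructor
  · intro h0
    rw [h0, mul_zero, add_zero] at h
    exact (mul_eq_zero.mp h).resolve_left M₁.zScalar_ne_zero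
  · intro h0
    rw [h0, mul_zero, zero_add] at h
    exact (mul_eq_zero.mp h).resolve_left M₂.zScalar_ne_zero

/-- Exchanging the factors turns the layer `(0, 2)` into `(2, 0)`, up to sign on highest weight
vectors, and `z` couples these two layers. -/
theorem tcrd_zero_two_of_comm {t : ℕ} {u : V₁ ⊗[F] V₂} (hu : u ∈ gradedInv M₁ M₂ t)
    (hE : ⁅inSl n (slE F), u⁆ = 0) {l : ℕ}
    (h : tcrd M₂ M₁ 0 0 2 l (TensorProduct.comm F V₁ V₂ u) = 0) : tcrd M₁ M₂ 0 0 2 l u = 0 := by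
  rw [tcrd_zero_two_eq_zero_iff M₁ M₂ hu]
  rw [tcrd_comm, tcrd_of_slE M₁ M₂ hE, add_zero, Nat.choose_self, Nat.cast_one, mul_one] at h
  exact (mul_eq_zero.mp h).resolve_left (pow_ne_zero _ (neg_ne_zero.mpr one_ne_zero))

/-- A highest weight vector in `S_2` is determined by its component in
`V(a₀) ⊗ V(b₀)` (bottom times top). -/
theorem eq_zero_of_tcrd_zero_two (hn : 1 ≤ n) (hk₁ : k₁ ≤ 2 * n - 1) (hka : k₁ ≤ a₀)
    (h₁ : a₁ + 2 * k₁ = 2 * n - 1 + a₀) (hk₂ : k₂ ≤ 2 * n - 1)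
    (h₂ : b₁ + 2 * k₂ = 2 * n - 1 + b₀) {u : V₁ ⊗[F] V₂} (hu : u ∈ gradedInv M₁ M₂ 2)
    (hE : ⁅inSl n (slE F), u⁆ = 0) (h : ∀ l, tcrd M₁ M₂ 0 0 2 l u = 0) : u = 0 := by
  apply eq_of_tcrd_zero M₁ M₂ hE (lie_zero _)
  intro I J l hI hJ
  rw [map_zero]
  by_cases hIJ : I + J = 2
  · have : I = 0 ∧ J = 2 ∨ I = 1 ∧ J = 1 ∨ I = 2 ∧ J = 0 := by omega
    rcases this with ⟨rfl, rfl⟩ | ⟨rfl, rfl⟩ | ⟨rfl, rfl⟩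
    · exact h l
    · have r := tcrd_relation M₁ M₂ hn hk₁ h₁ hk₂ h₂ hu hE 0 1 k₁ l
      rw [h, mul_zero, mul_zero, add_zero] at r
      simp only [lowCoeff, lowShift, Nat.sub_self, zero_add, pow_zero, Nat.choose_zero_right,
        Nat.cast_one, one_mul] at r
      exact (mul_eq_zero.mp r).resolve_left (lowOne_ne_zero hk₁ h₁ le_rfl hka)
    · exact (tcrd_zero_two_eq_zero_iff M₁ M₂ hu l).mp (h l)
  · exact tcrd_of_mem_gradedInv M₁ M₂ hu hIJ _ _

/-- The relation at `(l + 1, m - 1)` has no second term, since the shift onto `V(b₁)` is `m`; it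
kills the coordinate `l + m` of the layer `(1, 1)`. The relation at `(0, l + m)` then kills the
coordinate `l` of `(0, 2)`. -/
theorem tcrd_zero_two_of_zero_zero (hn : 1 ≤ n) (h₁ : a₁ = 2 * n - 1 + a₀)
    (h₂ : b₁ = 2 * n - 1 + b₀) {u : V₁ ⊗[F] V₂} (hu : u ∈ gradedInv M₁ M₂ 2)
    (hE : ⁅inSl n (slE F), u⁆ = 0) {l : ℕ} (hl : l < a₀) : tcrd M₁ M₂ 0 0 2 l u = 0 := by
  have h₁' : a₁ + 2 * 0 = 2 * n - 1 + a₀ := by omega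
  have h₂' : b₁ + 2 * 0 = 2 * n - 1 + b₀ := by omega
  have R := tcrd_relation M₁ M₂ hn (Nat.zero_le _) h₁' (Nat.zero_le _) h₂' hu hE 0 1
  simp only [lowCoeff, lowShift, Nat.sub_zero, zero_add] at R
  rcases lt_or_ge b₀ l with hb | hb
  · exact tcrd_of_wt_lt_right _ _ hb _ _ _
  have hγ : tcrd M₁ M₂ 1 0 1 (l + 1 + (2 * n - 1 - 1)) u = 0 := by
    have r := R (l + 1) (2 * n - 1 - 1)
    rw [lowTwo_of_lt (by omega), zero_mul, add_zero] at r
    refine (mul_eq_zero.mp ((mul_eq_zero.mp r).resolve_left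
      (lowOne_ne_zero (Nat.zero_le _) h₁' (Nat.zero_le _) (by omega)))).resolve_left ?_
    exact mul_ne_zero (pow_ne_zero _ (neg_ne_zero.mpr one_ne_zero))
      (Nat.cast_ne_zero.mpr (Nat.choose_pos (Nat.le_add_right _ _)).ne')
  have r := R 0 (l + (2 * n - 1))
  rw [zero_add, zero_add, show l + (2 * n - 1) = l + 1 + (2 * n - 1 - 1) by omega, hγ, mul_zero,
    mul_zero, zero_add, show l + 1 + (2 * n - 1 - 1) - (2 * n - 1) = l by omega, pow_zero,
    Nat.choose_zero_right, Nat.cast_one, one_mul, one_mul] at r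
  exact (mul_eq_zero.mp r).resolve_left (lowTwo_ne_zero (Nat.zero_le _) h₂' (by omega) (by omega))

/-- At `i = 0` the first coefficient vanishes because `k₁ = 1`, and the relation at `(0, l + m - 1)`
has one term left. -/
theorem tcrd_zero_two_of_one_one (hn : 1 ≤ n) (h₁ : a₁ + 2 = 2 * n - 1 + a₀)
    (h₂ : b₁ + 2 = 2 * n - 1 + b₀) {u : V₁ ⊗[F] V₂} (hu : u ∈ gradedInv M₁ M₂ 2)
    (hE : ⁅inSl n (slE F), u⁆ = 0) {l : ℕ} (hl : l < b₀) : tcrd M₁ M₂ 0 0 2 l u = 0 := by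
  have h₁' : a₁ + 2 * 1 = 2 * n - 1 + a₀ := by omega
  have h₂' : b₁ + 2 * 1 = 2 * n - 1 + b₀ := by omega
  have r := tcrd_relation M₁ M₂ hn (by omega) h₁' (by omega) h₂' hu hE 0 1 0 (l + (2 * n - 1 - 1))
  simp only [lowCoeff, lowShift, zero_add, Nat.add_sub_cancel, pow_zero, Nat.choose_zero_right,
    Nat.cast_one, one_mul] at r
  rw [lowOne_of_lt Nat.zero_lt_one, zero_mul, zero_add] at r
  exact (mul_eq_zero.mp r).resolve_left (lowTwo_ne_zero (by omega) h₂' (by omega) (by omega))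

/-- In the relation landing in the layer `(1, 0)` at `(l + m, 0)` the second coefficient vanishes
because `k₂ = 1`. This kills the layer `(2, 0)`, and `z` carries the conclusion to `(0, 2)`. -/
theorem tcrd_zero_two_of_zero_one (hn : 1 ≤ n) (h₁ : a₁ = 2 * n - 1 + a₀)
    (h₂ : b₁ + 2 = 2 * n - 1 + b₀) {u : V₁ ⊗[F] V₂} (hu : u ∈ gradedInv M₁ M₂ 2)
    (hE : ⁅inSl n (slE F), u⁆ = 0) (l : ℕ) : tcrd M₁ M₂ 0 0 2 l u = 0 := by
  have h₁' : a₁ + 2 * 0 = 2 * n - 1 + a₀ := by omega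
  have h₂' : b₁ + 2 * 1 = 2 * n - 1 + b₀ := by omega
  rcases lt_or_ge a₀ l with ha | ha
  · exact tcrd_zero_of_wt_lt M₁ M₂ hE ha _
  rw [tcrd_zero_two_eq_zero_iff M₁ M₂ hu]
  have r := tcrd_relation M₁ M₂ hn (Nat.zero_le _) h₁' (by omega) h₂' hu hE 1 0
    (l + (2 * n - 1)) 0
  simp only [lowCoeff, lowShift, Nat.sub_zero, add_zero, Nat.add_sub_cancel, Nat.choose_self,
    Nat.cast_one, mul_one] at r
  rw [lowOne_of_lt Nat.zero_lt_one, zero_mul, add_zero] at r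
  exact (mul_eq_zero.mp ((mul_eq_zero.mp r).resolve_left (lowTwo_ne_zero (Nat.zero_le _) h₁'
    (by omega) (by omega)))).resolve_left (pow_ne_zero _ (neg_ne_zero.mpr one_ne_zero))

theorem gradedInv_two_zero_one_eq_bot (hn : 1 ≤ n) (h₁ : a₁ = 2 * n - 1 + a₀)
    (h₂ : b₁ + 2 = 2 * n - 1 + b₀) : gradedInv M₁ M₂ 2 = ⊥ := by
  have h₁' : a₁ + 2 * 0 = 2 * n - 1 + a₀ := by omega
  have h₂' : b₁ + 2 * 1 = 2 * n - 1 + b₀ := by omega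
  exact gradedInv_eq_bot M₁ M₂ fun u hu hE => eq_zero_of_tcrd_zero_two M₁ M₂ hn (Nat.zero_le _)
    (Nat.zero_le _) h₁' (by omega) h₂' hu hE (tcrd_zero_two_of_zero_one M₁ M₂ hn h₁ h₂ hu hE)

theorem lie_comm_eq_zero {x : SlHeis F n} {u : V₁ ⊗[F] V₂} (h : ⁅x, u⁆ = 0) :
    ⁅x, TensorProduct.comm F V₁ V₂ u⁆ = 0 := by
  rw [← comm_lie, h, map_zero]

/-- Each one-sided vanishing result has a mirror image under exchange of the factors, so only `l =
a₀ = b₀` can survive. -/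
theorem tcrd_zero_two_of_same (hn : 1 ≤ n) {k : ℕ} (hk : k = 0 ∨ k = 1)
    (h₁ : a₁ + 2 * k = 2 * n - 1 + a₀) (h₂ : b₁ + 2 * k = 2 * n - 1 + b₀) {u : V₁ ⊗[F] V₂}
    (hu : u ∈ gradedInv M₁ M₂ 2) (hE : ⁅inSl n (slE F), u⁆ = 0) {l : ℕ}
    (hl : l ≠ a₀ ∨ l ≠ b₀) : tcrd M₁ M₂ 0 0 2 l u = 0 := by
  rcases lt_or_ge a₀ l with ha | ha
  · exact tcrd_zero_of_wt_lt M₁ M₂ hE ha _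
  rcases lt_or_ge b₀ l with hb | hb
  · exact tcrd_of_wt_lt_right _ _ hb _ _ _
  have hu' := comm_mem_gradedInv M₁ M₂ hu
  have hE' := lie_comm_eq_zero hE
  have hl' : l < a₀ ∨ l < b₀ := by omega
  rcases hk with rfl | rfl <;> rcases hl' with hl | hl
  · exact tcrd_zero_two_of_zero_zero M₁ M₂ hn (by omega) (by omega) hu hE hl
  · exact tcrd_zero_two_of_comm M₁ M₂ hu hE
      (tcrd_zero_two_of_zero_zero M₂ M₁ hn (by omega) (by omega) hu' hE' hl)
  · exact tcrd_zero_two_of_comm M₁ M₂ hu hE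
      (tcrd_zero_two_of_one_one M₂ M₁ hn (by omega) (by omega) hu' hE' hl)
  · exact tcrd_zero_two_of_one_one M₁ M₂ hn (by omega) (by omega) hu hE hl

theorem gradedInv_two_eq_bot_of_ne (hn : 1 ≤ n) {k : ℕ} (hk : k = 0 ∨ k = 1) (hka : k ≤ a₀)
    (h₁ : a₁ + 2 * k = 2 * n - 1 + a₀) (h₂ : b₁ + 2 * k = 2 * n - 1 + b₀) (hne : a₀ ≠ b₀) :
    gradedInv M₁ M₂ 2 = ⊥ :=
  gradedInv_eq_bot M₁ M₂ fun _ hu hE => eq_zero_of_tcrd_zero_two M₁ M₂ hn (by omega) hka h₁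
    (by omega) h₂ hu hE fun _ => tcrd_zero_two_of_same M₁ M₂ hn hk h₁ h₂ hu hE (by omega)

/-- After cancellation both sides contain the symmetric quantity `a₀! a₁! / (x! y!)` with `x = i -
k` and `y = j - (m - k)`. The point is that the ratio of the two coefficients does not depend on
`(i, j)`, so the images under `w_m` of adjacent layers can cancel. -/
theorem lowOne_mul_choose {k : ℕ} (hk : k ≤ 2 * n - 1)
    (h : a₁ + 2 * k = 2 * n - 1 + a₀) (i j : ℕ) :
    lowOne F n a₁ k i * (if i - k + j = a₁ then ((a₁.choose (i - k) : ℕ) : F) else 0) *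
        ((2 * n - 1).descFactorial k * a₀.factorial : ℕ) * (-1) ^ k =
      lowTwo F n a₀ k j * (if i + (j - (2 * n - 1 - k)) = a₀ then ((a₀.choose i : ℕ) : F) else 0) *
        ((2 * n - 1).descFactorial (2 * n - 1 - k) * a₁.factorial : ℕ) *
        (-1) ^ (2 * n - 1 - k) := by
  obtain ⟨p, hp⟩ : ∃ p, 2 * n - 1 = p + k := ⟨2 * n - 1 - k, by omega⟩
  rcases lt_or_ge i k with hi | hi
  · rw [lowOne_of_lt hi]
    rcases lt_or_ge j (2 * n - 1 - k) with hj | hj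
    · rw [lowTwo_of_lt hj]
      ring
    · rw [lowTwo_of_le hj]
      split_ifs with h1 h2 h2
      · rw [Nat.descFactorial_eq_zero_iff_lt.mpr (by omega : a₀ - (j - (2 * n - 1 - k)) < k)]
        simp
      · simp
      · rw [Nat.descFactorial_eq_zero_iff_lt.mpr (by omega : a₀ - (j - (2 * n - 1 - k)) < k)]
        simp
      · simp
  rcases lt_or_ge j (2 * n - 1 - k) with hj | hj
  · rw [lowTwo_of_lt hj, lowOne_of_le hi, zero_mul, zero_mul, zero_mul]
    split_ifs with h1
    · rw [Nat.descFactorial_eq_zero_iff_lt.mpr (by omega : a₁ - (i - k) < 2 * n - 1 - k)]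
      simp
    · simp
  rw [lowOne_of_le hi, lowTwo_of_le hj]
  by_cases h1 : i - k + j = a₁
  · rw [if_pos h1, if_pos (by omega)]
    obtain ⟨x, rfl⟩ : ∃ x, i = x + k := ⟨i - k, by omega⟩
    obtain ⟨y, rfl⟩ : ∃ y, j = y + p := ⟨j - p, by omega⟩
    have e0 : 2 * n - 1 - k = p := by omega
    have e1 : a₁ - (x + k - k) = y + p := by omega
    have e2 : a₀ - (y + p - p) = x + k := by omega
    have e3 : x + k - k = x := by omega
    rw [e0, e1, e2, e3]
    have f1 : y.factorial * (y + p).descFactorial p = (y + p).factorial := by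
      have := Nat.factorial_mul_descFactorial (Nat.le_add_left p y)
      rwa [Nat.add_sub_cancel] at this
    have f2 : x.factorial * (x + k).descFactorial k = (x + k).factorial := by
      have := Nat.factorial_mul_descFactorial (Nat.le_add_left k x)
      rwa [Nat.add_sub_cancel] at this
    have f3 := Nat.add_choose_mul_factorial_mul_factorial x (y + p)
    have f4 := Nat.add_choose_mul_factorial_mul_factorial (x + k) y
    rw [← Nat.choose_symm_add, show x + (y + p) = a₁ by omega, ← f1] at f3
    rw [← Nat.choose_symm_add, show x + k + y = a₀ by omega, ← f2] at f4
    have key : a₁.choose x * (y + p).descFactorial p * a₀.factorial =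
        a₀.choose (x + k) * (x + k).descFactorial k * a₁.factorial := by
      apply Nat.eq_of_mul_eq_mul_left (Nat.mul_pos x.factorial_pos y.factorial_pos)
      rw [← f3, ← f4]
      ring
    have key' := congrArg (Nat.cast : ℕ → F) key
    push_cast at key' ⊢
    linear_combination (-1) ^ p * (-1) ^ k * ((2 * n - 1).descFactorial p : F) *
      ((2 * n - 1).descFactorial k : F) * key'
  · rw [if_neg h1, if_neg (by omega)]
    simp

/-- Each of `V(a₀) ⊗ V(a₀)` (bottom with top), `V(a₁) ⊗ V(a₁)` and `V(a₀) ⊗ V(a₀)` (top with bottom)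
has a unique line of weight-zero highest weight vectors. A suitable combination of the three is
`h_n`-invariant. -/
theorem isoAsSl_gradedInv_two [FiniteDimensional F V₁] [FiniteDimensional F V₂] (hn : 1 ≤ n)
    {k : ℕ} (hk : k = 0 ∨ k = 1) (hka : k ≤ a₀) (h₁ : a₁ + 2 * k = 2 * n - 1 + a₀)
    (M₂ : FUModel F n V₂ a₀ a₁) : IsoAsSl n (gradedInv M₁ M₂ 2) (Irr F 0) := by
  have hkm : k ≤ 2 * n - 1 := by omega
  have key := lowOne_mul_choose (F := F) hkm h₁
  set γ : F := (((2 * n - 1).descFactorial k * a₀.factorial : ℕ) : F) with hγ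
  set ε : F := (((2 * n - 1).descFactorial (2 * n - 1 - k) * a₁.factorial : ℕ) : F) with hε
  have hε0 : ε ≠ 0 := by
    refine Nat.cast_ne_zero.mpr (mul_ne_zero ?_ (Nat.factorial_ne_zero _))
    rw [Ne, Nat.descFactorial_eq_zero_iff_lt]
    omega
  have t1 := tcrd_hwVec M₁ M₂ (I := 0) (J := 2) (l := a₀) (by omega) (by omega) le_rfl le_rfl
  have t2 := tcrd_hwVec M₁ M₂ (I := 1) (J := 1) (l := a₁) (by omega) (by omega) le_rfl le_rfl
  have t3 := tcrd_hwVec M₁ M₂ (I := 2) (J := 0) (l := a₀) (by omega) (by omega) le_rfl le_rfl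
  have e1 := slE_hwVec M₁ M₂ (I := 0) (J := 2) (l := a₀) (by omega) (by omega) le_rfl le_rfl
  have e2 := slE_hwVec M₁ M₂ (I := 1) (J := 1) (l := a₁) (by omega) (by omega) le_rfl le_rfl
  have e3 := slE_hwVec M₁ M₂ (I := 2) (J := 0) (l := a₀) (by omega) (by omega) le_rfl le_rfl
  have c1 := slH_hwVec M₁ M₂ (I := 0) (J := 2) (l := a₀) (by omega) (by omega) le_rfl le_rfl
  have c2 := slH_hwVec M₁ M₂ (I := 1) (J := 1) (l := a₁) (by omega) (by omega) le_rfl le_rfl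
  have c3 := slH_hwVec M₁ M₂ (I := 2) (J := 0) (l := a₀) (by omega) (by omega) le_rfl le_rfl
  have hz : ∀ c : F, c + c - 2 * c = 0 := fun c => by ring
  rw [M₁.wt_zero, M₂.wt_two, hz, zero_smul] at c1
  rw [M₁.wt_one, M₂.wt_one, hz, zero_smul] at c2
  rw [M₁.wt_two, M₂.wt_zero, hz, zero_smul] at c3
  generalize hwVec M₁ M₂ 0 2 a₀ = x at t1 e1 c1
  generalize hwVec M₁ M₂ 1 1 a₁ = y at t2 e2 c2
  generalize hwVec M₁ M₂ 2 0 a₀ = z at t3 e3 c3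
  -- The ratio of the coefficients of `x` and `y` is forced by cancellation in the layer `(0, 1)`,
  -- and that of `z` and `y` by cancellation in `(1, 0)`; both cancellations come from `key`, with
  -- `i` and `j` exchanged in the second.
  obtain ⟨w, hw⟩ : ∃ w, w = (-((-1) ^ (2 * n - 1 - k) * ε)) • x + γ • y +
    (-((-1) ^ k * ε)) • z := ⟨_, rfl⟩
  have tw : ∀ I i J j, tcrd M₁ M₂ I i J j w = -((-1) ^ (2 * n - 1 - k) * ε) * tcrd M₁ M₂ I i J j x +
      γ * tcrd M₁ M₂ I i J j y + -((-1) ^ k * ε) * tcrd M₁ M₂ I i J j z := by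
    intro I i J j
    rw [hw, map_add, map_add, map_smul, map_smul, map_smul]
    rfl
  have hE : ⁅inSl n (slE F), w⁆ = 0 := by
    rw [hw, lie_add, lie_add, lie_smul, lie_smul, lie_smul, e1, e2, e3]
    simp only [smul_zero, add_zero]
  have hH : ⁅inSl n (slH F), w⁆ = ((0 : ℕ) : F) • w := by
    rw [hw, lie_add, lie_add, lie_smul, lie_smul, lie_smul, c1, c2, c3]
    simp
  have hβ : ∀ l, tcrd M₁ M₂ 0 0 2 l w = if l = a₀ then -((-1) ^ (2 * n - 1 - k) * ε) else 0 := by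
    intro l
    rw [tw, t1, t2, t3]
    simp
  have hs : ∀ l, (-1 : F) ^ l ≠ 0 := fun l => pow_ne_zero _ (neg_ne_zero.mpr one_ne_zero)
  have hwS : w ∈ gradedInv M₁ M₂ 2 := by
    refine mem_gradedInv_of_low M₁ M₂ hn hkm h₁ hkm h₁ hE ?_ ?_
    · intro I i J j h
      rw [tw, t1, t2, t3, if_neg (by omega), if_neg (by omega), if_neg (by omega)]
      ring
    · intro I i J j h
      have hsq : ∀ l, ((-1 : F) ^ l) * (-1) ^ l = 1 := fun l => by
        rw [← mul_pow, neg_one_mul, neg_neg, one_pow]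
      have : I = 0 ∧ J = 1 ∨ I = 1 ∧ J = 0 := by omega
      rcases this with ⟨rfl, rfl⟩ | ⟨rfl, rfl⟩
      · have r := key i j
        simp only [lowCoeff, lowShift, tw, t1, t2, t3]
        simp only [zero_add, Nat.reduceAdd, one_ne_zero, zero_ne_one, OfNat.ofNat_ne_zero,
          OfNat.zero_ne_ofNat, OfNat.one_ne_ofNat, OfNat.ofNat_ne_one, true_and, false_and,
          and_false, if_false, mul_zero, add_zero]
        have s1 : lowOne F n a₁ k i * (if i - k + j = a₁ then
            (-1) ^ (i - k) * ((a₁.choose (i - k) : ℕ) : F) else 0) = (-1) ^ i * (-1) ^ k *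
            (lowOne F n a₁ k i * if i - k + j = a₁ then ((a₁.choose (i - k) : ℕ) : F) else 0) := by
          rcases lt_or_ge i k with hi | hi
          · rw [lowOne_of_lt hi]
            ring
          · split_ifs
            · have h3 : (-1 : F) ^ i = (-1) ^ (i - k) * (-1) ^ k := by
                rw [← pow_add, Nat.sub_add_cancel hi]
              rw [h3]
              linear_combination (-lowOne F n a₁ k i * (-1) ^ (i - k) *
                ((a₁.choose (i - k) : ℕ) : F)) * hsq k
            · ring
        have s2 : (if i + (j - (2 * n - 1 - k)) = a₀ then (-1) ^ i * ((a₀.choose i : ℕ) : F) else 0) =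
            (-1) ^ i * if i + (j - (2 * n - 1 - k)) = a₀ then ((a₀.choose i : ℕ) : F) else 0 := by
          split_ifs <;> simp
        linear_combination γ * s1 -
          lowTwo F n a₀ k j * ((-1) ^ (2 * n - 1 - k) * ε) * s2 + (-1) ^ i * r
      · have r := key j i
        simp only [lowCoeff, lowShift, tw, t1, t2, t3]
        simp only [zero_add, Nat.reduceAdd, one_ne_zero, zero_ne_one, OfNat.ofNat_ne_zero,
          OfNat.zero_ne_ofNat, OfNat.one_ne_ofNat, OfNat.ofNat_ne_one, true_and, false_and,
          and_false, if_false, mul_zero, add_zero]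
        have s1 : lowTwo F n a₀ k i * (if i - (2 * n - 1 - k) + j = a₀ then
            (-1) ^ (i - (2 * n - 1 - k)) *
            ((a₀.choose (i - (2 * n - 1 - k)) : ℕ) : F) else 0) = (-1) ^ i * (-1) ^ (2 * n - 1 - k) *
            (lowTwo F n a₀ k i * if j + (i - (2 * n - 1 - k)) = a₀ then
              ((a₀.choose j : ℕ) : F) else 0) := by
          rcases lt_or_ge i (2 * n - 1 - k) with hi | hi
          · rw [lowTwo_of_lt hi]
            ring
          · by_cases hij : i - (2 * n - 1 - k) + j = a₀
            · rw [if_pos hij, if_pos (by omega), ← Nat.choose_symm_of_eq_add hij.symm]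
              have h3 : (-1 : F) ^ i = (-1) ^ (i - (2 * n - 1 - k)) * (-1) ^ (2 * n - 1 - k) := by
                rw [← pow_add, Nat.sub_add_cancel hi]
              rw [h3]
              linear_combination (-lowTwo F n a₀ k i * (-1) ^ (i - (2 * n - 1 - k)) *
                ((a₀.choose (i - (2 * n - 1 - k)) : ℕ) : F)) * hsq (2 * n - 1 - k)
            · rw [if_neg hij, if_neg (by omega)]
              ring
        have s2 : (if i + (j - k) = a₁ then (-1) ^ i * ((a₁.choose i : ℕ) : F) else 0) =
            (-1) ^ i * if j - k + i = a₁ then ((a₁.choose (j - k) : ℕ) : F) else 0 := by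
          by_cases hij : j - k + i = a₁
          · rw [if_pos hij, if_pos (by omega), Nat.choose_symm_of_eq_add hij.symm]
          · rw [if_neg hij, if_neg (by omega), mul_zero]
        linear_combination -((-1) ^ k * ε) * s1 + lowOne F n a₁ k j * γ * s2 +
          (-1) ^ i * (-1) ^ k * r - (lowOne F n a₁ k j *
            (if j - k + i = a₁ then ((a₁.choose (j - k) : ℕ) : F) else 0) * γ * (-1) ^ i) * hsq k
  refine isoAsSl_gradedInv M₁ M₂ hwS ?_ hE hH ?_
  · intro h0
    have := hβ a₀
    rw [h0, map_zero, if_pos rfl] at this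
    exact neg_ne_zero.mpr (mul_ne_zero (hs _) hε0) this.symm
  · intro u hu hEu
    refine ⟨tcrd M₁ M₂ 0 0 2 a₀ u / -((-1) ^ (2 * n - 1 - k) * ε), ?_⟩
    rw [← sub_eq_zero]
    apply eq_zero_of_tcrd_zero_two M₁ M₂ hn hkm hka h₁ hkm h₁
      (Submodule.sub_mem _ hu (Submodule.smul_mem _ _ hwS))
    · rw [lie_sub, lie_smul, hE, hEu, smul_zero, sub_zero]
    · intro l
      rw [map_sub, map_smul, hβ, smul_eq_mul]
      split_ifs with hl
      · rw [hl, div_mul_cancel₀ _ (neg_ne_zero.mpr (mul_ne_zero (hs _) hε0)), sub_self]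
      · rw [tcrd_zero_two_of_same M₁ M₂ hn hk h₁ h₁ hu hEu (Or.inl hl), mul_zero, sub_zero]

end DegreeTwo

/-! ### Irreducibility of `V(c)` -/

section Irreducible

variable {F : Type*} [Field F] [CharZero F] {c : ℕ}

theorem mono_mem_of_lie_slF {U : Type*} [AddCommGroup U] [Module F U] (φ : Irr F c →ₗ[F] U)
    {S : Submodule F U} (hF : ∀ v, φ v ∈ S → φ ⁅slF F, v⁆ ∈ S)
    (h0 : φ (mono F (c + 1) 0) ∈ S) (v : Irr F c) : φ v ∈ S := by
  have h : ∀ k, k ≤ c → φ (mono F (c + 1) k) ∈ S := by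
    intro k
    induction k with
    | zero => exact fun _ => h0
    | succ k ih =>
      intro hk
      have h1 := hF _ (ih (by omega))
      rw [lie_slF_mono, map_smul] at h1
      refine (Submodule.smul_mem_iff S ?_).mp h1
      have h2 : ((c - k : ℕ) : F) ≠ 0 := Nat.cast_ne_zero.mpr (by omega)
      rw [Nat.cast_sub (by omega)] at h2
      push_cast
      intro h3
      exact h2 (by linear_combination h3)
  rw [sum_coord_smul_mono v, map_sum]
  refine Submodule.sum_mem _ fun k hk => ?_
  rw [map_smul]
  exact Submodule.smul_mem _ _ (h k (by have := Finset.mem_range.mp hk; omega))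

/-- `V(c)` is irreducible. -/
theorem irr_eq_top {P : Submodule F (Irr F c)} (hP : ∀ (A : SL2 F), ∀ v ∈ P, ⁅A, v⁆ ∈ P)
    (hne : P ≠ ⊥) : P = ⊤ := by
  obtain ⟨v, hv, hv0⟩ := Submodule.exists_mem_ne_zero_of_ne_bot hne
  have hex : ∃ N, ((LieModule.toEnd F (SL2 F) (Irr F c) (slE F)) ^ N) v = 0 := ⟨_, pow_slE_irr _ v⟩
  classical
  obtain ⟨N, hN⟩ : ∃ N, Nat.find hex = N + 1 := by
    refine ⟨Nat.find hex - 1, ?_⟩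
    have : Nat.find hex ≠ 0 := by
      intro h
      have := Nat.find_spec hex
      rw [h] at this
      exact hv0 this
    omega
  -- The last nonzero vector among the `e^N v` is a highest weight vector in `P`.
  set w := ((LieModule.toEnd F (SL2 F) (Irr F c) (slE F)) ^ N) v with hw
  have hw0 : w ≠ 0 := Nat.find_min hex (by omega)
  have hEw : ⁅slE F, w⁆ = 0 := by
    have := Nat.find_spec hex
    rw [hN, pow_succ', Module.End.mul_apply] at this
    exact this
  have hwP : w ∈ P := by
    rw [hw]
    clear hN hw0 hEw hw w
    induction N with
    | zero => exact hv
    | succ N ih =>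
      rw [pow_succ', Module.End.mul_apply]
      exact hP _ _ ih
  have h1 : w = w.coord 0 • mono F (c + 1) 0 := eq_smul_mono_zero_of_lie_slE hEw
  have h2 : mono F (c + 1) 0 ∈ P := by
    rw [h1] at hwP
    refine (Submodule.smul_mem_iff P ?_).mp hwP
    intro h
    rw [h, zero_smul] at h1
    exact hw0 h1
  rw [eq_top_iff]
  exact fun v _ => mono_mem_of_lie_slF LinearMap.id (fun v hv => hP _ v hv) h2 v

end Irreducible

theorem lieSubmodule_exists_mem_ne_zero {R L M : Type*} [CommRing R] [LieRing L] [AddCommGroup M]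
    [Module R M] [LieRingModule L M] {N : LieSubmodule R L M} (h : N ≠ ⊥) : ∃ u ∈ N, u ≠ 0 := by
  by_contra! h'
  exact h ((LieSubmodule.eq_bot_iff N).mpr h')

/-! ### Invariants of `h_n` and the socle -/

section Invariants

variable {F : Type*} [Field F] [CharZero F] {n : ℕ} {U : Type*} [AddCommGroup U] [Module F U]
  [LieRingModule (SlHeis F n) U] [LieModule F (SlHeis F n) U]

theorem lie_inHeis_inSl_lie {u : U} (hu : ∀ y : Heis F n, ⁅inHeis y, u⁆ = 0) (y : Heis F n)
    (A : SL2 F) : ⁅inHeis y, ⁅inSl n A, u⁆⁆ = 0 := by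
  have h := leibniz_lie (inSl n A) (inHeis y) u
  rw [hu, lie_zero, lie_inSl_inHeis, hu, zero_add] at h
  exact h.symm

variable (F n U) in
/-- The `h_n`-invariants of a module. -/
def heisInvariants : LieSubmodule F (SlHeis F n) U where
  carrier := {u | ∀ y : Heis F n, ⁅inHeis y, u⁆ = 0}
  add_mem' := fun hu hv y => by rw [lie_add, hu, hv, add_zero]
  zero_mem' := fun y => lie_zero _
  smul_mem' := fun c u hu y => by rw [lie_smul, hu, smul_zero]
  lie_mem := fun {x u} hu y => by
    rw [slHeis_eq x, add_lie, hu, zero_add]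
    exact lie_inHeis_inSl_lie hu y _

/-- If `U` is graded and `V(2n-1) ⊆ h_n` lowers the degree by one, then every nonzero submodule
of `U` contains nonzero `h_n`-invariants. -/
theorem exists_mem_heisInvariants (hn : 1 ≤ n) {π : ℕ → U →ₗ[F] U}
    (hπ : ∀ (p : BinForm F (2 * n)) t u, ⁅heisVec p, π (t + 1) u⁆ = π t ⁅heisVec p, u⁆) {L : ℕ}
    (hL : ∀ t, L ≤ t → π t = 0) (h0 : ∀ u, (∀ t, π t u = 0) → u = 0)
    {N : LieSubmodule F (SlHeis F n) U} (hN : N ≠ ⊥) :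
    ∃ u ∈ N, u ≠ 0 ∧ u ∈ heisInvariants F n U := by
  -- A nonzero vector of `N` of least possible top degree is invariant, because `V(m)` would send it
  -- to a vector of smaller top degree.
  have hex : ∃ k, ∃ u ∈ N, u ≠ 0 ∧ ∀ t, k ≤ t → π t u = 0 := by
    obtain ⟨u, hu, hu0⟩ := lieSubmodule_exists_mem_ne_zero hN
    exact ⟨L, u, hu, hu0, fun t ht => by rw [hL t ht, LinearMap.zero_apply]⟩
  classical
  obtain ⟨u, hu, hu0, hk⟩ := Nat.find_spec hex
  refine ⟨u, hu, hu0, inHeis_lie_eq_zero hn fun p => ?_⟩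
  by_contra hp
  have hne : Nat.find hex ≠ 0 := by
    intro h
    rw [h] at hk
    exact hu0 (h0 u fun t => hk t (Nat.zero_le _))
  refine Nat.find_min hex (Nat.sub_one_lt hne) ⟨_, N.lie_mem hu, hp, fun t ht => ?_⟩
  rw [← hπ, hk _ (by omega), lie_zero]

/-- The invariants form a submodule, since `h_n` is an ideal. An irreducible submodule meeting it
nontrivially is contained in it. -/
theorem socle_le_heisInvariants
    (h : ∀ N : LieSubmodule F (SlHeis F n) U, N ≠ ⊥ → ∃ u ∈ N, u ≠ 0 ∧ u ∈ heisInvariants F n U) :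
    socle F (SlHeis F n) U ≤ heisInvariants F n U := by
  refine sSup_le fun N hN => ?_
  have hN' : LieModule.IsIrreducible F (SlHeis F n) N := hN
  have hne : N ≠ ⊥ := by
    rintro rfl
    obtain ⟨x, y, hxy⟩ := LieModule.nontrivial_of_isIrreducible F (SlHeis F n)
      (⊥ : LieSubmodule F (SlHeis F n) U)
    exact hxy (Subsingleton.elim _ _)
  obtain ⟨u, hu, hu0, hinv⟩ := h N hne
  have htop : (heisInvariants F n U).comap N.incl = ⊤ := by
    refine (IsSimpleOrder.eq_bot_or_eq_top _).resolve_left fun h => hu0 ?_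
    exact congrArg Subtype.val ((LieSubmodule.eq_bot_iff _).mp h ⟨u, hu⟩ hinv)
  intro v hv
  have : (⟨v, hv⟩ : N) ∈ (heisInvariants F n U).comap N.incl := by
    rw [htop]
    exact LieSubmodule.mem_top _
  exact this

/-- Where `h_n` acts by zero the submodules are the `sl(2)`-submodules, so a copy of `V(c)` there is
irreducible for the whole algebra. -/
theorem IsoAsSl.le_socle {S : Submodule F U} {c : ℕ} (h : IsoAsSl n S (Irr F c))
    (hS : S ≤ (heisInvariants F n U).toSubmodule) : S ≤ (socle F (SlHeis F n) U).toSubmodule := by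
  obtain ⟨φ, hφ, hr, he⟩ := h
  have hmem : ∀ v, φ v ∈ S := fun v => hr ▸ LinearMap.mem_range_self φ v
  let N : LieSubmodule F (SlHeis F n) U :=
    { S with
      lie_mem := by
        intro x u hu
        have hu' : u ∈ LinearMap.range φ := hr.symm ▸ hu
        obtain ⟨v, rfl⟩ := hu'
        rw [slHeis_eq x, add_lie, hS hu, zero_add, ← he]
        exact hmem _ }
  have hN : LieModule.IsIrreducible F (SlHeis F n) N := by
    have : Nontrivial N := by
      refine ⟨⟨⟨φ (mono F (c + 1) 0), hmem _⟩, 0, fun h => ?_⟩⟩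
      have h1 : φ (mono F (c + 1) 0) = φ 0 := (congrArg Subtype.val h).trans (map_zero φ).symm
      have h2 := congrArg (fun v => BinForm.coord v 0) (hφ h1)
      simp only [coord_mono, coord_zero] at h2
      simp at h2
    apply LieModule.IsIrreducible.mk
    intro N' hN'
    obtain ⟨x, hx, hx0⟩ := lieSubmodule_exists_mem_ne_zero hN'
    let P : Submodule F (Irr F c) := (N'.toSubmodule.map (N.incl : N →ₗ[F] U)).comap φ
    have hP : P = ⊤ := by
      apply irr_eq_top
      · rintro A v ⟨y, hy, hyv⟩
        exact ⟨⁅inSl n A, (y : N)⁆, N'.lie_mem hy, by rw [he, ← hyv]; rfl⟩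
      · rw [Submodule.ne_bot_iff]
        have hx' : x.1 ∈ LinearMap.range φ := hr.symm ▸ x.2
        obtain ⟨v, hv⟩ := hx'
        refine ⟨v, ⟨x, hx, hv.symm⟩, fun h => hx0 ?_⟩
        rw [h, map_zero] at hv
        exact Subtype.ext hv.symm
    rw [eq_top_iff]
    intro y _
    have hy' : y.1 ∈ LinearMap.range φ := hr.symm ▸ y.2
    obtain ⟨v, hv⟩ := hy'
    have hvP : v ∈ P := hP ▸ Submodule.mem_top
    obtain ⟨z, hz, hzv⟩ := hvP
    have : z = y := Subtype.ext (hzv.trans hv)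
    exact this ▸ hz
  exact (le_sSup hN : N ≤ socle F (SlHeis F n) U)

theorem IsoAsSl.range_lof {ι : Type*} [DecidableEq ι] {c : ι → ℕ} {φ : (⨁ i, Irr F (c i)) →ₗ[F] U}
    (hφ : Function.Injective φ) (he : ∀ (A : SL2 F) v, φ ⁅A, v⁆ = ⁅inSl n A, φ v⁆) (i : ι) :
    IsoAsSl n (LinearMap.range (φ ∘ₗ DirectSum.lof F ι (fun i => Irr F (c i)) i))
      (Irr F (c i)) := by
  refine ⟨_, hφ.comp (DirectSum.of_injective i), rfl, fun A v => ?_⟩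
  rw [LinearMap.comp_apply, LinearMap.comp_apply, ← he]
  congr 1
  exact (DirectSum.lieModuleOf F ι (SL2 F) (fun i => Irr F (c i)) i).map_lie A v

theorem IsoAsSl.exists_le {ι : Type*} {c : ι → ℕ} {S : Submodule F U}
    (h : IsoAsSl n S (⨁ i, Irr F (c i))) (i : ι) : ∃ P ≤ S, IsoAsSl n P (Irr F (c i)) := by
  classical
  obtain ⟨φ, hφ, rfl, he⟩ := h
  exact ⟨_, LinearMap.range_comp_le_range _ _, IsoAsSl.range_lof hφ he i⟩

theorem IsoAsSl.directSum_le_socle {ι : Type*} {c : ι → ℕ} {S : Submodule F U}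
    (h : IsoAsSl n S (⨁ i, Irr F (c i))) (hS : S ≤ (heisInvariants F n U).toSubmodule) :
    S ≤ (socle F (SlHeis F n) U).toSubmodule := by
  classical
  obtain ⟨φ, hφ, rfl, he⟩ := h
  rintro _ ⟨x, rfl⟩
  induction x using DirectSum.induction_on with
  | zero => rw [map_zero]; exact Submodule.zero_mem _
  | of i v =>
    exact (IsoAsSl.range_lof hφ he i).le_socle
      ((LinearMap.range_comp_le_range _ _).trans hS) ⟨v, rfl⟩
  | add x y hx hy => rw [map_add]; exact Submodule.add_mem _ hx hy

theorem IsoAsSl.ne_bot {S : Submodule F U} {c : ℕ} (h : IsoAsSl n S (Irr F c)) : S ≠ ⊥ := by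
  obtain ⟨φ, hφ, rfl, -⟩ := h
  intro h0
  rw [LinearMap.range_eq_bot] at h0
  have h1 : φ (mono F (c + 1) 0) = φ 0 := by rw [h0]; rfl
  have h2 := congrArg (fun v => BinForm.coord v 0) (hφ h1)
  simp only [coord_mono, coord_zero] at h2
  simp at h2

end Invariants

/-! ### The socle of `FU_(a₀, a₁, a₀)` -/

section SocleOfModel

variable {F : Type*} [Field F] [CharZero F] {n : ℕ} {V : Type*} [AddCommGroup V] [Module F V]
  [LieRingModule (SlHeis F n) V] {a₀ a₁ : ℕ}

namespace FUModel

theorem proj_of_le (M : FUModel F n V a₀ a₁) {I : ℕ} (h : 3 ≤ I) : M.proj I = 0 := by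
  rcases I with _ | _ | _ | I
  · omega
  · omega
  · omega
  · rfl

theorem eq_zero_of_proj (M : FUModel F n V a₀ a₁) {v : V} (h : ∀ I, M.proj I v = 0) : v = 0 := by
  rw [← M.sum_proj v]
  exact Finset.sum_eq_zero fun I _ => h I

theorem proj_proj (M : FUModel F n V a₀ a₁) (I K : ℕ) (v : V) :
    M.proj K (M.proj I v) = if K = I then M.proj K v else 0 := by
  by_cases hI : I < 3
  · by_cases hK : K < 3
    · apply M.equiv.injective
      interval_cases I <;> interval_cases K <;>
        simp [equiv_proj_zero, equiv_proj_one, equiv_proj_two]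
    · rw [M.proj_of_le (by omega : 3 ≤ K)]
      simp
  · rw [M.proj_of_le (by omega : 3 ≤ I)]
    split_ifs with h
    · rw [h, M.proj_of_le (by omega : 3 ≤ I)]
      rfl
    · simp

variable [LieModule F (SlHeis F n) V]

/-- `z` excludes a component in the third layer. In the middle layer the index `k` of `w_m v` reads
off the coordinate `0` of `v`; the higher coordinates follow because `e v` is again invariant and
`e` lowers the index. -/
theorem mem_range_proj_zero_of_invariant (M : FUModel F n V a₀ a₁) {k : ℕ} (hn : 1 ≤ n)
    (hk : k ≤ 2 * n - 1) (hka : k ≤ a₀) (h : a₁ + 2 * k = 2 * n - 1 + a₀) {v : V}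
    (hv : v ∈ heisInvariants F n V) : v ∈ LinearMap.range (M.proj 0) := by
  have h2 : M.proj 2 v = 0 := by
    apply M.equiv.injective
    rw [M.equiv_proj_two, map_zero]
    have h2 : M.equiv ⁅heisZ F n, v⁆ = 0 := by
      have : ⁅heisZ F n, v⁆ = 0 := hv _
      rw [this, map_zero]
    rw [M.equiv_z] at h2
    have h3 := (smul_eq_zero.mp (congrArg Prod.fst h2)).resolve_left M.zScalar_ne_zero
    rw [h3]
    rfl
  have h1 : ∀ j, ∀ v ∈ heisInvariants F n V, M.crd 1 j v = 0 := by
    intro j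
    induction j with
    | zero =>
      intro v hv
      have h0 := M.crd_zero_low hn hk h k v
      have hv0 : ⁅heisVec (mono F (2 * n) (2 * n - 1)), v⁆ = 0 := hv _
      rw [hv0, map_zero, Nat.sub_self, LinearMap.smul_apply, smul_eq_mul] at h0
      exact (mul_eq_zero.mp h0.symm).resolve_left (lowOne_ne_zero hk h le_rfl hka)
    | succ j ih =>
      intro v hv
      have h0 := M.crd_slE 1 j v
      rw [ih _ ((heisInvariants F n V).lie_mem hv), LinearMap.smul_apply, smul_eq_mul] at h0
      exact (mul_eq_zero.mp h0.symm).resolve_left (by exact_mod_cast Nat.succ_ne_zero j)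
  have h1' : M.proj 1 v = 0 := by
    apply M.equiv.injective
    rw [M.equiv_proj_one, map_zero]
    have : (M.equiv v).2.1 = 0 := BinForm.ext_coord fun j => by
      rw [coord_zero]
      exact h1 j v hv
    rw [this]
    rfl
  have h3 := M.sum_proj v
  rw [Finset.sum_range_succ, Finset.sum_range_succ, Finset.sum_range_one, h1', h2, add_zero,
    add_zero] at h3
  exact ⟨v, h3⟩

theorem range_proj_zero_le (M : FUModel F n V a₀ a₁) (hn : 1 ≤ n) :
    LinearMap.range (M.proj 0) ≤ (heisInvariants F n V).toSubmodule := by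
  rintro _ ⟨v, rfl⟩
  exact inHeis_lie_eq_zero hn fun p => M.lie_proj_zero p v

theorem isoAsSl_range_proj_zero (M : FUModel F n V a₀ a₁) :
    IsoAsSl n (LinearMap.range (M.proj 0)) (Irr F a₀) := by
  refine ⟨M.equiv.symm.toLinearMap ∘ₗ LinearMap.inl F _ _, ?_, ?_, ?_⟩
  · exact M.equiv.symm.injective.comp LinearMap.inl_injective
  · apply le_antisymm
    · rintro _ ⟨x, rfl⟩
      refine ⟨M.equiv.symm (x, 0, 0), ?_⟩
      apply M.equiv.injective
      rw [M.equiv_proj_zero, LinearEquiv.apply_symm_apply]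
      exact (M.equiv.apply_symm_apply _).symm
    · rintro _ ⟨v, rfl⟩
      exact ⟨(M.equiv v).1, rfl⟩
  · intro A x
    apply M.equiv.injective
    rw [M.equiv_sl]
    change M.equiv (M.equiv.symm (⁅A, x⁆, 0, 0)) = (⁅A, (M.equiv (M.equiv.symm (x, 0, 0))).1⁆,
      ⁅A, (M.equiv (M.equiv.symm (x, 0, 0))).2.1⁆, ⁅A, (M.equiv (M.equiv.symm (x, 0, 0))).2.2⁆)
    rw [LinearEquiv.apply_symm_apply, LinearEquiv.apply_symm_apply, lie_zero, lie_zero]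

/-- The socle of `FU_(a₀, a₁, a₀)` is the first summand. -/
theorem socle_eq (M : FUModel F n V a₀ a₁) {k : ℕ} (hn : 1 ≤ n) (hk : k ≤ 2 * n - 1)
    (hka : k ≤ a₀) (h : a₁ + 2 * k = 2 * n - 1 + a₀) :
    (socle F (SlHeis F n) V).toSubmodule = LinearMap.range (M.proj 0) := by
  apply le_antisymm
  · intro v hv
    refine M.mem_range_proj_zero_of_invariant hn hk hka h (socle_le_heisInvariants ?_ hv)
    intro N hN
    exact exists_mem_heisInvariants hn (π := M.proj) (L := 3) (fun p t u => M.lie_proj_succ p t u)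
      (fun t ht => M.proj_of_le ht) (fun u hu => M.eq_zero_of_proj hu) hN
  · exact M.isoAsSl_range_proj_zero.le_socle (M.range_proj_zero_le hn)

end FUModel

end SocleOfModel

/-! ### The socle of the tensor product and the piece `S_0` -/

section SocleOfTensor

variable {F : Type*} [Field F] [CharZero F] {n : ℕ} {V₁ : Type*} [AddCommGroup V₁] [Module F V₁]
  [LieRingModule (SlHeis F n) V₁] [LieModule F (SlHeis F n) V₁]
  {V₂ : Type*} [AddCommGroup V₂] [Module F V₂]
  [LieRingModule (SlHeis F n) V₂] [LieModule F (SlHeis F n) V₂]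
  {a₀ a₁ b₀ b₁ : ℕ} (M₁ : FUModel F n V₁ a₀ a₁) (M₂ : FUModel F n V₂ b₀ b₁)

theorem gradedProj_mem_gradedInv (hn : 1 ≤ n) (t : ℕ) {u : V₁ ⊗[F] V₂}
    (hu : u ∈ heisInvariants F n (V₁ ⊗[F] V₂)) : gradedProj M₁ M₂ t u ∈ gradedInv M₁ M₂ t := by
  refine ⟨?_, inHeis_lie_eq_zero hn fun p => heisVec_gradedProj M₁ M₂ p t (hu _)⟩
  rw [gradedProj_eq_self_iff]
  intro I i J j h
  rw [tcrd_gradedProj, if_neg h]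

theorem gradedProj_of_le {t : ℕ} (ht : 5 ≤ t) : gradedProj M₁ M₂ t = 0 := by
  rw [gradedProj]
  refine Finset.sum_eq_zero fun p hp => ?_
  rw [Finset.HasAntidiagonal.mem_antidiagonal] at hp
  rcases le_or_gt 3 p.1 with h | h
  · rw [M₁.proj_of_le h, TensorProduct.map_zero_left]
  · rw [M₂.proj_of_le (by omega), TensorProduct.map_zero_right]

theorem eq_zero_of_gradedProj {u : V₁ ⊗[F] V₂} (h : ∀ t, gradedProj M₁ M₂ t u = 0) : u = 0 := by
  apply eq_zero_of_tcrd M₁ M₂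
  intro I i J j _ _
  have h1 := tcrd_gradedProj M₁ M₂ (I + J) I i J j u
  rw [h, map_zero, if_pos rfl] at h1
  exact h1.symm

/-- The homogeneous components of an invariant are invariants because `V(m)` is homogeneous of
degree `-1`, and `z` leaves only the degrees `0, 1, 2`. -/
theorem heisInvariants_tensor (hn : 1 ≤ n) : (heisInvariants F n (V₁ ⊗[F] V₂)).toSubmodule =
    ⨆ t : Fin 3, gradedInv M₁ M₂ t := by
  apply le_antisymm
  · intro u hu
    rw [eq_gradedProj_of_heisZ M₁ M₂ (hu _)]
    have h : ∀ t : Fin 3, gradedProj M₁ M₂ t u ∈ ⨆ t : Fin 3, gradedInv M₁ M₂ t := fun t =>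
      Submodule.mem_iSup_of_mem t (gradedProj_mem_gradedInv M₁ M₂ hn t hu)
    exact Submodule.add_mem _ (Submodule.add_mem _ (h 0) (h 1)) (h 2)
  · exact iSup_le fun t u hu => hu.2

theorem iSupIndep_gradedInv : iSupIndep (fun t : Fin 3 => gradedInv M₁ M₂ t) := by
  intro t
  have h : ⨆ s, ⨆ _ : s ≠ t, gradedInv M₁ M₂ s ≤ LinearMap.ker (gradedProj M₁ M₂ t) := by
    refine iSup_le fun s => iSup_le fun hs u hu => ?_
    rw [LinearMap.mem_ker]
    apply eq_zero_of_tcrd M₁ M₂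
    intro I i J j _ _
    rw [tcrd_gradedProj]
    split_ifs with hIJ
    · refine tcrd_of_mem_gradedInv M₁ M₂ hu (fun h => hs ?_) _ _
      exact Fin.ext (h.symm.trans hIJ)
    · rfl
  rw [Submodule.disjoint_def]
  intro u hu hu'
  rw [← hu.1]
  exact h hu'

theorem gradedInv_le_heisInvariants (t : ℕ) :
    gradedInv M₁ M₂ t ≤ (heisInvariants F n (V₁ ⊗[F] V₂)).toSubmodule := fun _ hu => hu.2

/-- If the `S_t` are contained in the socle, then the socle is their sum. -/
theorem socle_tensor (hn : 1 ≤ n)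
    (h : ∀ t : Fin 3, gradedInv M₁ M₂ t ≤ (socle F (SlHeis F n) (V₁ ⊗[F] V₂)).toSubmodule) :
    (socle F (SlHeis F n) (V₁ ⊗[F] V₂)).toSubmodule = ⨆ t : Fin 3, gradedInv M₁ M₂ t := by
  apply le_antisymm
  · rw [← heisInvariants_tensor M₁ M₂ hn]
    refine socle_le_heisInvariants fun N hN => ?_
    exact exists_mem_heisInvariants hn (π := gradedProj M₁ M₂) (L := 5)
      (fun p t u => lie_gradedProj_succ M₁ M₂ p t u) (fun t ht => gradedProj_of_le M₁ M₂ ht)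
      (fun u hu => eq_zero_of_gradedProj M₁ M₂ hu) hN
  · exact iSup_le h

/-- This passes from the `S_t` of the socle decompositions to the description by projections, in
which all computations are made. -/
theorem gradedInvariants_eq (D₁ : SocleDecomposition F n V₁ 3) (D₂ : SocleDecomposition F n V₂ 3)
    (h₁ : ∀ I : Fin 3, D₁.comp I = LinearMap.range (M₁.proj I))
    (h₂ : ∀ J : Fin 3, D₂.comp J = LinearMap.range (M₂.proj J)) (t : ℕ) :
    gradedInvariants D₁ D₂ t = gradedInv M₁ M₂ t := by
  have hle : (⨆ i : Fin 3, ⨆ j : Fin 3, ⨆ _ : (i : ℕ) + (j : ℕ) = t,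
      Submodule.map₂ (TensorProduct.mk F V₁ V₂) (D₁.comp i) (D₂.comp j)) ≤
      LinearMap.eqLocus (gradedProj M₁ M₂ t) LinearMap.id := by
    refine iSup_le fun i => iSup_le fun j => iSup_le fun hij => Submodule.map₂_le.mpr ?_
    rw [h₁, h₂]
    rintro _ ⟨v, rfl⟩ _ ⟨w, rfl⟩
    rw [LinearMap.mem_eqLocus, LinearMap.id_apply, gradedProj_eq_self_iff]
    intro I a J b h
    rw [TensorProduct.mk_apply, tcrd, pairing_tmul, M₁.crd_proj, M₂.crd_proj]
    by_cases hI : I = i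
    · rw [if_neg (fun hJ : J = j => h (by omega)), mul_zero]
    · rw [if_neg hI, zero_mul]
  ext u
  constructor
  · rintro ⟨hu, hinv⟩
    exact ⟨hle hu, hinv⟩
  · rintro ⟨hu, hinv⟩
    refine ⟨?_, hinv⟩
    rw [← hu, gradedProj, LinearMap.sum_apply]
    refine Submodule.sum_mem _ fun p hp => ?_
    rw [Finset.HasAntidiagonal.mem_antidiagonal] at hp
    rcases le_or_gt 3 p.1 with h | h
    · rw [M₁.proj_of_le h, TensorProduct.map_zero_left]
      exact Submodule.zero_mem _
    rcases le_or_gt 3 p.2 with h' | h'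
    · rw [M₂.proj_of_le h', TensorProduct.map_zero_right]
      exact Submodule.zero_mem _
    refine Submodule.mem_iSup_of_mem ⟨p.1, h⟩ (Submodule.mem_iSup_of_mem ⟨p.2, h'⟩
      (Submodule.mem_iSup_of_mem hp ?_))
    rw [h₁, h₂, ← TensorProduct.range_map]
    exact LinearMap.mem_range_self _ _

theorem gradedInv_zero (hn : 1 ≤ n) : gradedInv M₁ M₂ 0 =
    Submodule.map₂ (TensorProduct.mk F V₁ V₂) (LinearMap.range (M₁.proj 0))
      (LinearMap.range (M₂.proj 0)) := by
  rw [← TensorProduct.range_map]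
  have h : TensorProduct.map (M₁.proj 0) (M₂.proj 0) = gradedProj M₁ M₂ 0 := by
    rw [gradedProj, Finset.Nat.antidiagonal_zero, Finset.sum_singleton]
  rw [h]
  apply le_antisymm
  · exact fun u hu => ⟨u, hu.1⟩
  · rintro _ ⟨u, rfl⟩
    refine ⟨?_, inHeis_lie_eq_zero hn fun p => lie_gradedProj_zero M₁ M₂ p u⟩
    rw [gradedProj_eq_self_iff]
    intro I i J j h
    rw [tcrd_gradedProj, if_neg h]

theorem mem_gradedInv_zero (hn : 1 ≤ n) {u : V₁ ⊗[F] V₂} : u ∈ gradedInv M₁ M₂ 0 ↔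
    ∀ I i J j, I + J ≠ 0 → tcrd M₁ M₂ I i J j u = 0 := by
  rw [← gradedProj_eq_self_iff]
  refine ⟨fun h => h.1, fun h => ⟨h, inHeis_lie_eq_zero hn fun p => ?_⟩⟩
  rw [← h]
  exact lie_gradedProj_zero M₁ M₂ p u

theorem finrank_gradedInv_zero_le (hn : 1 ≤ n) :
    Module.finrank F (gradedInv M₁ M₂ 0) ≤ (a₀ + 1) * (b₀ + 1) := by
  let α : Irr F a₀ →ₗ[F] V₁ := M₁.equiv.symm.toLinearMap ∘ₗ LinearMap.inl F _ _
  let β : Irr F b₀ →ₗ[F] V₂ := M₂.equiv.symm.toLinearMap ∘ₗ LinearMap.inl F _ _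
  have h : gradedInv M₁ M₂ 0 ≤ LinearMap.range (TensorProduct.map α β) := by
    rw [gradedInv_zero M₁ M₂ hn, TensorProduct.range_map]
    apply Submodule.map₂_le_map₂
    · rintro _ ⟨v, rfl⟩
      exact ⟨(M₁.equiv v).1, rfl⟩
    · rintro _ ⟨v, rfl⟩
      exact ⟨(M₂.equiv v).1, rfl⟩
  calc Module.finrank F (gradedInv M₁ M₂ 0) ≤ Module.finrank F (LinearMap.range
        (TensorProduct.map α β)) := Submodule.finrank_mono h
    _ ≤ Module.finrank F (Irr F a₀ ⊗[F] Irr F b₀) := LinearMap.finrank_range_le _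
    _ = (a₀ + 1) * (b₀ + 1) := by
      rw [Module.finrank_tensorProduct, finrank_binForm, finrank_binForm]

/-- The dimension count that makes the Clebsch-Gordan map onto. The partial sums satisfy `Σ + r (r -
1) = r (a + b + 1)`, written without subtracting on the right. -/
theorem sum_clebschGordan (a b : ℕ) :
    ∑ k ∈ Finset.range (min a b + 1), (a + b - 2 * k + 1) = (a + 1) * (b + 1) := by
  have h : ∀ r, r ≤ min a b + 1 →
      ∑ k ∈ Finset.range r, (a + b - 2 * k + 1) + r * (r - 1) = r * (a + b + 1) := by
    intro r
    induction r with
    | zero => simp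
    | succ r ih =>
      intro hr
      rw [Finset.sum_range_succ]
      have h1 := ih (by omega)
      have h2 : a + b - 2 * r + 2 * r = a + b := by omega
      rcases r with _ | r
      · simp
      · simp only [Nat.add_sub_cancel] at h1 ⊢
        nlinarith
  have h1 := h (min a b + 1) le_rfl
  rw [Nat.add_sub_cancel] at h1
  rcases le_total a b with hab | hab
  · rw [min_eq_left hab] at h1 ⊢
    nlinarith
  · rw [min_eq_right hab] at h1 ⊢
    nlinarith

/-- The Clebsch-Gordan decomposition of `S_0 = V(a₀) ⊗ V(b₀)`. -/
theorem isoAsSl_gradedInv_zero [FiniteDimensional F V₁] [FiniteDimensional F V₂] (hn : 1 ≤ n) :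
    IsoAsSl n (gradedInv M₁ M₂ 0)
      (⨁ k : Fin (min a₀ b₀ + 1), Irr F (a₀ + b₀ - 2 * (k : ℕ))) := by
  have hl : ∀ k : Fin (min a₀ b₀ + 1), (k : ℕ) ≤ M₁.wt 0 ∧ (k : ℕ) ≤ M₂.wt 0 := by
    intro k
    rw [M₁.wt_zero, M₂.wt_zero]
    have := k.isLt
    omega
  have hex : ∀ k : Fin (min a₀ b₀ + 1), ∃ φ : Irr F (a₀ + b₀ - 2 * (k : ℕ)) →ₗ[F] V₁ ⊗[F] V₂,
      φ (mono F (a₀ + b₀ - 2 * (k : ℕ) + 1) 0) = hwVec M₁ M₂ 0 0 k ∧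
      ∀ (A : SL2 F) v, φ ⁅A, v⁆ = ⁅inSl n A, φ v⁆ := by
    intro k
    apply exists_hom_of_primitive
    · exact slE_hwVec M₁ M₂ (by omega) (by omega) (hl k).1 (hl k).2
    · rw [slH_hwVec M₁ M₂ (by omega) (by omega) (hl k).1 (hl k).2, M₁.wt_zero, M₂.wt_zero,
        Nat.cast_sub (by have := hl k; rw [M₁.wt_zero, M₂.wt_zero] at this; omega)]
      push_cast
      rfl
    · intro h
      have h1 := tcrd_zero_hwVec M₁ M₂ (I := 0) (J := 0) (by omega) (by omega) (hl k).1 (hl k).2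
        0 0 k
      rw [h, map_zero, if_pos ⟨rfl, rfl, rfl⟩] at h1
      exact zero_ne_one h1
  choose φ hφ0 hφ using hex
  let ψ := DirectSum.toModule F (Fin (min a₀ b₀ + 1)) (V₁ ⊗[F] V₂) φ
  have hψ : ∀ x, ψ x = ∑ k, φ k (x k) := by
    intro x
    induction x using DirectSum.induction_on with
    | zero =>
      rw [map_zero]
      exact (Finset.sum_eq_zero fun k _ => map_zero (φ k)).symm
    | of k v =>
      rw [Finset.sum_eq_single k]
      · rw [DirectSum.of_eq_same]
        exact DirectSum.toModule_lof F
          (M := fun k : Fin (min a₀ b₀ + 1) => Irr F (a₀ + b₀ - 2 * (k : ℕ))) (φ := φ) k v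
      · intro j _ hj
        rw [DirectSum.of_eq_of_ne _ _ _ hj, map_zero]
      · exact fun h => absurd (Finset.mem_univ k) h
    | add x y hx hy =>
      rw [map_add, hx, hy, ← Finset.sum_add_distrib]
      refine Finset.sum_congr rfl fun k _ => ?_
      rw [DirectSum.add_apply, map_add]
  have hequiv : ∀ (A : SL2 F) x, ψ ⁅A, x⁆ = ⁅inSl n A, ψ x⁆ := by
    intro A x
    rw [hψ, hψ, ← LieModule.toEnd_apply_apply F _ _ (inSl n A), map_sum]
    refine Finset.sum_congr rfl fun k _ => ?_
    rw [DirectSum.lie_module_bracket_apply, hφ]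
    rfl
  have hinj : Function.Injective ψ := by
    apply injective_of_primitive ψ hequiv
    · intro x
      have h : ∀ N k, ((LieModule.toEnd F (SL2 F)
          (⨁ k : Fin (min a₀ b₀ + 1), Irr F (a₀ + b₀ - 2 * (k : ℕ))) (slE F) ^ N) x) k =
          (LieModule.toEnd F (SL2 F) (Irr F (a₀ + b₀ - 2 * (k : ℕ))) (slE F) ^ N) (x k) := by
        intro N k
        induction N with
        | zero => rfl
        | succ N ih =>
          rw [pow_succ', pow_succ', Module.End.mul_apply, Module.End.mul_apply,
            LieModule.toEnd_apply_apply, LieModule.toEnd_apply_apply,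
            DirectSum.lie_module_bracket_apply, ih]
      refine ⟨a₀ + b₀ + 1, ?_⟩
      ext k : 1
      rw [h, show a₀ + b₀ + 1 = 2 * (k : ℕ) + (a₀ + b₀ - 2 * (k : ℕ) + 1) by
        have := hl k; rw [M₁.wt_zero, M₂.wt_zero] at this; omega, pow_add, Module.End.mul_apply,
        pow_slE_irr, map_zero]
      rfl
    · intro x hx h0
      have hk : ∀ k, x k = (x k).coord 0 • mono F _ 0 := by
        intro k
        apply eq_smul_mono_zero_of_lie_slE
        rw [← DirectSum.lie_module_bracket_apply, hx]
        rfl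
      rw [hψ] at h0
      -- The coordinate at `w_0 ⊗ w_k` is nonzero on the `k`-th highest weight vector only.
      have hc : ∀ k, (x k).coord 0 = 0 := by
        intro k
        have h1 := congrArg (tcrd M₁ M₂ 0 0 0 k) h0
        rw [map_sum, map_zero, Finset.sum_eq_single k] at h1
        · rw [hk k, map_smul, hφ0, map_smul, tcrd_zero_hwVec M₁ M₂ (by omega) (by omega)
            (hl k).1 (hl k).2, if_pos ⟨rfl, rfl, rfl⟩, smul_eq_mul, mul_one] at h1
          exact h1
        · intro j _ hj
          rw [hk j, map_smul, hφ0, map_smul, tcrd_zero_hwVec M₁ M₂ (by omega) (by omega)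
            (hl j).1 (hl j).2, if_neg (fun h => hj (Fin.ext h.2.2.symm)), smul_zero]
        · exact fun h => absurd (Finset.mem_univ k) h
      ext k
      rw [hk k, hc k, zero_smul]
      rfl
  refine ⟨ψ, hinj, ?_, hequiv⟩
  have hle : LinearMap.range ψ ≤ gradedInv M₁ M₂ 0 := by
    rintro _ ⟨x, rfl⟩
    rw [hψ]
    refine Submodule.sum_mem _ fun k _ => ?_
    apply mono_mem_of_lie_slF (φ k)
    · intro v hv
      rw [hφ]
      exact lie_mem_gradedInv M₁ M₂ _ hv
    · rw [hφ0, mem_gradedInv_zero M₁ M₂ hn]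
      intro I i J j h
      rw [tcrd_hwVec M₁ M₂ (by omega) (by omega) (hl k).1 (hl k).2, if_neg (by omega)]
  -- Surjectivity onto `S_0` follows from injectivity by comparing dimensions.
  refine Submodule.eq_of_le_of_finrank_le hle ((finrank_gradedInv_zero_le M₁ M₂ hn).trans ?_)
  rw [LinearMap.finrank_range_of_inj hinj, ← sum_clebschGordan, Finset.sum_range]
  apply le_of_eq
  rw [Module.finrank_directSum]
  simp only [finrank_binForm]

end SocleOfTensor

/-! ### The tables -/

section Models

variable {F : Type*} [Field F] [CharZero F] {n : ℕ}

/-- A standard faithful uniserial module with a socle decomposition of length three is one of the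
modules `FU_(a₀, a₁, a₀)`, compatibly with the decomposition. -/
theorem exists_standard_model {V : Type*} [AddCommGroup V] [Module F V]
    [LieRingModule (SlHeis F n) V] [LieModule F (SlHeis F n) V] (hn : 1 ≤ n)
    (hV : IsStandardFaithfulUniserial F n V) (D : SocleDecomposition F n V 3) :
    ∃ k, (k = 0 ∨ k = 1) ∧ k ≤ D.wt 0 ∧ D.wt 1 + 2 * k = 2 * n - 1 + D.wt 0 ∧
      (1 < n → k = 0 ∧ D.wt 0 ≤ 1 ∨ k = 1 ∧ D.wt 0 = 1) ∧
      ∃ M : FUModel F n V (D.wt 0) (D.wt 1),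
        ∀ I : Fin 3, D.comp I = LinearMap.range (M.proj I) := by
  obtain ⟨-, k, hk, hka, h, M, c0, c1, c2⟩ := exists_fuModel hn hV.faithful D
  have hw : 1 < n → k = 0 ∧ D.wt 0 ≤ 1 ∨ k = 1 ∧ D.wt 0 = 1 := by
    intro hn'
    rcases M.weights hn' hk hka h with h | h | ⟨h1, h2, h3⟩
    · exact Or.inl h
    · exact Or.inr h
    · have := M.isFU
      rw [h2, h3] at this
      exact absurd ⟨h1, this⟩ hV.ne_exceptional
  refine ⟨k, ?_, hka, h, hw, M, fun I => ?_⟩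
  -- For `n = 1` the bound `k ≤ m = 1` suffices.
  · rcases hn.eq_or_lt with h1 | h1
    · omega
    · have := hw h1
      omega
  · have hr : ∀ I v, v ∈ LinearMap.range (M.proj I) ↔ M.proj I v = v := by
      refine fun I v => ⟨?_, fun h => ⟨v, h⟩⟩
      rintro ⟨w, rfl⟩
      rw [M.proj_proj, if_pos rfl]
    ext v
    rw [hr, ← M.equiv.injective.eq_iff]
    fin_cases I
    · refine (c0 v).trans ?_
      change _ ↔ M.equiv (M.proj 0 v) = M.equiv v
      rw [M.equiv_proj_zero]
      constructor
      · rintro ⟨h1, h2⟩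
        exact Prod.ext rfl (Prod.ext h1.symm h2.symm)
      · intro h
        exact ⟨(congrArg (fun x => x.2.1) h).symm, (congrArg (fun x => x.2.2) h).symm⟩
    · refine (c1 v).trans ?_
      change _ ↔ M.equiv (M.proj 1 v) = M.equiv v
      rw [M.equiv_proj_one]
      constructor
      · rintro ⟨h1, h2⟩
        exact Prod.ext h1.symm (Prod.ext rfl h2.symm)
      · intro h
        exact ⟨(congrArg (fun x => x.1) h).symm, (congrArg (fun x => x.2.2) h).symm⟩
    · refine (c2 v).trans ?_
      change _ ↔ M.equiv (M.proj 2 v) = M.equiv v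
      rw [M.equiv_proj_two]
      constructor
      · rintro ⟨h1, h2⟩
        exact Prod.ext h1.symm (Prod.ext h2.symm rfl)
      · intro h
        exact ⟨(congrArg (fun x => x.1) h).symm, (congrArg (fun x => x.2.1) h).symm⟩

variable {V₁ : Type*} [AddCommGroup V₁] [Module F V₁]
  [LieRingModule (SlHeis F n) V₁] [LieModule F (SlHeis F n) V₁]
  {V₂ : Type*} [AddCommGroup V₂] [Module F V₂]
  [LieRingModule (SlHeis F n) V₂] [LieModule F (SlHeis F n) V₂]
  {a₀ a₁ b₀ b₁ k₁ k₂ : ℕ} (M₁ : FUModel F n V₁ a₀ a₁) (M₂ : FUModel F n V₂ b₀ b₁)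

/-- The module `FU_(a₀, a₁, a₀)` is unique up to isomorphism. -/
theorem FUModel.nonempty_equiv (hn : 1 ≤ n) (M₁ : FUModel F n V₁ a₀ a₁)
    (M₂ : FUModel F n V₂ a₀ a₁) : Nonempty (V₁ ≃ₗ⁅F, SlHeis F n⁆ V₂) := by
  let Ψ := M₁.equiv.trans M₂.equiv.symm
  have hΨ : ∀ v, M₂.equiv (Ψ v) = M₁.equiv v := fun v => M₂.equiv.apply_symm_apply _
  have hsl : ∀ (A : SL2 F) v, Ψ ⁅inSl n A, v⁆ = ⁅inSl n A, Ψ v⁆ := by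
    intro A v
    apply M₂.equiv.injective
    rw [M₂.equiv_sl, hΨ, hΨ, M₁.equiv_sl]
  have hvec : ∀ (p : BinForm F (2 * n)) v, Ψ ⁅heisVec p, v⁆ = ⁅heisVec p, Ψ v⁆ := by
    intro p v
    apply M₂.equiv.injective
    rw [M₂.equiv_heis, hΨ, hΨ, M₁.equiv_heis]
  -- As `z` is a commutator, compatibility with it follows from that with `V(m)`; the two scalars of
  -- `z` need not be compared beforehand.
  have hz : ∀ v, Ψ ⁅heisZ F n, v⁆ = ⁅heisZ F n, Ψ v⁆ := by
    intro v
    rw [heisZ_eq_lie hn, lie_lie, lie_lie, map_sub, hvec, hvec, hvec, hvec]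
  have hall : ∀ (x : SlHeis F n) v, Ψ ⁅x, v⁆ = ⁅x, Ψ v⁆ := by
    intro x v
    rw [slHeis_eq x, inHeis_eq, add_lie, add_lie, add_lie, add_lie, map_add, map_add, hsl, hvec,
      smul_lie, smul_lie, map_smul, hz]
  exact ⟨{ Ψ with map_lie' := fun {x v} => hall x v }⟩

/-- Isomorphic modules have equal dimension `3 a₀ + m + 3 - 2 k₁ = 3 b₀ + m + 3 - 2 k₂`, and
reduction modulo `3` gives `k₁ = k₂`. -/
theorem FUModel.nonempty_equiv_iff [FiniteDimensional F V₁] [FiniteDimensional F V₂] (hn : 1 ≤ n)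
    (hk₁ : k₁ = 0 ∨ k₁ = 1) (h₁ : a₁ + 2 * k₁ = 2 * n - 1 + a₀) (hk₂ : k₂ = 0 ∨ k₂ = 1)
    (h₂ : b₁ + 2 * k₂ = 2 * n - 1 + b₀) (M₁ : FUModel F n V₁ a₀ a₁) (M₂ : FUModel F n V₂ b₀ b₁) :
    Nonempty (V₁ ≃ₗ⁅F, SlHeis F n⁆ V₂) ↔ k₁ = k₂ ∧ a₀ = b₀ := by
  constructor
  · rintro ⟨e⟩
    have h := (e : V₁ ≃ₗ[F] V₂).finrank_eq
    rw [finrank_of_isFU M₁.isFU, finrank_of_isFU M₂.isFU] at h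
    omega
  · rintro ⟨rfl, rfl⟩
    obtain rfl : a₁ = b₁ := by omega
    exact M₁.nonempty_equiv hn M₂

theorem isoAsSl_gradedInv_two_of_eq [FiniteDimensional F V₁] [FiniteDimensional F V₂] (hn : 1 ≤ n)
    (hk₁ : k₁ = 0 ∨ k₁ = 1) (hka : k₁ ≤ a₀) (h₁ : a₁ + 2 * k₁ = 2 * n - 1 + a₀)
    (h₂ : b₁ + 2 * k₂ = 2 * n - 1 + b₀) (h : k₁ = k₂ ∧ a₀ = b₀) :
    IsoAsSl n (gradedInv M₁ M₂ 2) (Irr F 0) := by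
  obtain ⟨rfl, rfl⟩ := h
  obtain rfl : a₁ = b₁ := by omega
  exact isoAsSl_gradedInv_two M₁ hn hk₁ hka h₁ M₂

theorem gradedInv_two_eq_bot (hn : 1 ≤ n) (hk₁ : k₁ = 0 ∨ k₁ = 1) (hka : k₁ ≤ a₀)
    (h₁ : a₁ + 2 * k₁ = 2 * n - 1 + a₀) (hk₂ : k₂ = 0 ∨ k₂ = 1)
    (h₂ : b₁ + 2 * k₂ = 2 * n - 1 + b₀) (h : ¬ (k₁ = k₂ ∧ a₀ = b₀)) : gradedInv M₁ M₂ 2 = ⊥ := by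
  by_cases hk : k₁ = k₂
  · subst hk
    exact gradedInv_two_eq_bot_of_ne M₁ M₂ hn hk₁ hka h₁ h₂ fun h' => h ⟨rfl, h'⟩
  · rcases hk₁ with rfl | rfl
    · exact gradedInv_two_zero_one_eq_bot M₁ M₂ hn (by omega) (by omega)
    · exact gradedInv_comm_eq_bot M₂ M₁
        (gradedInv_two_zero_one_eq_bot M₂ M₁ hn (by omega) (by omega))

/-- In each case for `(k₁, k₂)` the piece `S_1` is zero or a single `V(c)`. For `n > 1` the mixed
cases with `S_1` nonzero have bottom weights `0` and `1`. -/
theorem gradedInv_one_le_socle [FiniteDimensional F V₁] [FiniteDimensional F V₂] (hn : 1 ≤ n)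
    (hk₁ : k₁ = 0 ∨ k₁ = 1) (hka : k₁ ≤ a₀) (h₁ : a₁ + 2 * k₁ = 2 * n - 1 + a₀)
    (hw₁ : 1 < n → k₁ = 0 ∧ a₀ ≤ 1 ∨ k₁ = 1 ∧ a₀ = 1) (hk₂ : k₂ = 0 ∨ k₂ = 1) (hkb : k₂ ≤ b₀)
    (h₂ : b₁ + 2 * k₂ = 2 * n - 1 + b₀) (hw₂ : 1 < n → k₂ = 0 ∧ b₀ ≤ 1 ∨ k₂ = 1 ∧ b₀ = 1) :
    gradedInv M₁ M₂ 1 ≤ (socle F (SlHeis F n) (V₁ ⊗[F] V₂)).toSubmodule := by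
  have hiso : ∀ c, IsoAsSl n (gradedInv M₁ M₂ 1) (Irr F c) →
      gradedInv M₁ M₂ 1 ≤ (socle F (SlHeis F n) (V₁ ⊗[F] V₂)).toSubmodule :=
    fun c h => h.le_socle (gradedInv_le_heisInvariants M₁ M₂ 1)
  have hbot : gradedInv M₁ M₂ 1 = ⊥ →
      gradedInv M₁ M₂ 1 ≤ (socle F (SlHeis F n) (V₁ ⊗[F] V₂)).toSubmodule :=
    fun h => h ▸ bot_le
  rcases hk₁ with rfl | rfl <;> rcases hk₂ with rfl | rfl
  · exact hiso _ (isoAsSl_gradedInv_one_zero_zero M₁ M₂ hn (by omega) (by omega))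
  · rcases le_or_gt b₀ a₀ with h | h
    · exact hbot (gradedInv_one_zero_one_eq_bot M₁ M₂ hn (by omega) hkb (by omega) h)
    · exact hiso _ (isoAsSl_gradedInv_one_zero_one M₁ M₂ (c := 2 * n - 1 + b₀ - (a₀ + 2)) hn
        (by omega) (by omega) h (by omega) (by omega))
  · rcases le_or_gt a₀ b₀ with h | h
    · exact hbot (gradedInv_comm_eq_bot M₂ M₁
        (gradedInv_one_zero_one_eq_bot M₂ M₁ hn (by omega) hka (by omega) h))
    · exact hiso _ (IsoAsSl.gradedInv_comm M₂ M₁ (isoAsSl_gradedInv_one_zero_one M₂ M₁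
        (c := 2 * n - 1 + a₀ - (b₀ + 2)) hn (by omega) (by omega) h (by omega) (by omega)))
  · rcases hn.eq_or_lt with h | h
    · exact hbot (gradedInv_one_one_one_eq_bot M₁ M₂ h.symm (by omega) (by omega))
    · exact hiso _ (isoAsSl_gradedInv_one_one_one M₁ M₂ h (by omega) (by omega) (by omega)
        (by omega))

/-- The socle of `FU_(a₀, a₁, a₀) ⊗ FU_(a₀, a₁, a₀)` contains two copies of `V(0)`, one in `S_0`
and one in `S_2`. -/
theorem not_multiplicityFree [FiniteDimensional F V₁] [FiniteDimensional F V₂] (hn : 1 ≤ n)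
    (hab : a₀ = b₀) (h2 : IsoAsSl n (gradedInv M₁ M₂ 2) (Irr F 0)) {S : Submodule F (V₁ ⊗[F] V₂)}
    (hS : ∀ t : Fin 3, gradedInv M₁ M₂ t ≤ S) : ¬ MultiplicityFree n S := by
  intro hfree
  -- The last Clebsch-Gordan summand, at index `a₀ = b₀`, has weight zero.
  obtain ⟨P, hP, hPi⟩ := (isoAsSl_gradedInv_zero M₁ M₂ hn).exists_le ⟨a₀, by omega⟩
  rw [show a₀ + b₀ - 2 * a₀ = 0 by omega] at hPi
  have hPQ := hfree 0 P _ (hP.trans (hS 0)) (hS 2) hPi h2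
  have hdis := (iSupIndep_gradedInv M₁ M₂).pairwiseDisjoint (show (0 : Fin 3) ≠ 2 by decide)
  exact hPi.ne_bot (eq_bot_iff.mpr (hdis hP hPQ.le))

theorem finrank_eq_of_isFU {c₀ c₁ : ℕ} (M₁ : FUModel F n V₁ a₀ a₁)
    (h : IsFU (F := F) n V₁ c₀ c₁) : 2 * (c₀ + 1) + (c₁ + 1) = 2 * (a₀ + 1) + (a₁ + 1) :=
  (finrank_of_isFU h).symm.trans (finrank_of_isFU M₁.isFU)

/-- The labels in the `IsFU` hypotheses are matched with those of the models by dimension, which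
fixes `k₁` and `k₂`; each entry is then one of the computations of `S_1` and `S_2`, up to exchange
of the factors. -/
theorem socle_table_of_eq_one [FiniteDimensional F V₁] [FiniteDimensional F V₂] (hn1 : n = 1)
    (hk₁ : k₁ = 0 ∨ k₁ = 1) (hka : k₁ ≤ a₀) (h₁ : a₁ + 2 * k₁ = 2 * n - 1 + a₀)
    (hk₂ : k₂ = 0 ∨ k₂ = 1) (h₂ : b₁ + 2 * k₂ = 2 * n - 1 + b₀) :
    (IsFU (F := F) n V₁ a₀ (a₀ + 1) → IsFU (F := F) n V₂ b₀ (b₀ + 1) →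
      IsoAsSl n (gradedInv M₁ M₂ 1) (Irr F (a₀ + b₀ + 1)) ∧
      (a₀ = b₀ → IsoAsSl n (gradedInv M₁ M₂ 2) (Irr F 0)) ∧
      (a₀ ≠ b₀ → gradedInv M₁ M₂ 2 = ⊥)) ∧
    (IsFU (F := F) n V₁ a₀ (a₀ + 1) → 1 ≤ b₀ → IsFU (F := F) n V₂ b₀ (b₀ - 1) →
      (a₁ ≤ b₀ → IsoAsSl n (gradedInv M₁ M₂ 1) (Irr F (b₀ - a₁))) ∧
      (¬ a₁ ≤ b₀ → gradedInv M₁ M₂ 1 = ⊥) ∧ gradedInv M₁ M₂ 2 = ⊥) ∧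
    (1 ≤ a₀ → IsFU (F := F) n V₁ a₀ (a₀ - 1) → IsFU (F := F) n V₂ b₀ (b₀ + 1) →
      (b₁ ≤ a₀ → IsoAsSl n (gradedInv M₁ M₂ 1) (Irr F (a₀ - b₁))) ∧
      (¬ b₁ ≤ a₀ → gradedInv M₁ M₂ 1 = ⊥) ∧ gradedInv M₁ M₂ 2 = ⊥) ∧
    (1 ≤ a₀ → IsFU (F := F) n V₁ a₀ (a₀ - 1) → 1 ≤ b₀ → IsFU (F := F) n V₂ b₀ (b₀ - 1) →
      gradedInv M₁ M₂ 1 = ⊥ ∧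
      (a₀ = b₀ → IsoAsSl n (gradedInv M₁ M₂ 2) (Irr F 0)) ∧
      (a₀ ≠ b₀ → gradedInv M₁ M₂ 2 = ⊥)) := by
  have hn : 1 ≤ n := hn1.ge
  refine ⟨fun f₁ f₂ => ?_, fun f₁ hb f₂ => ?_, fun ha f₁ f₂ => ?_, fun ha f₁ hb f₂ => ?_⟩
  · have e₁ := finrank_eq_of_isFU M₁ f₁
    have e₂ := finrank_eq_of_isFU M₂ f₂
    refine ⟨?_, fun h => isoAsSl_gradedInv_two_of_eq M₁ M₂ hn hk₁ hka h₁ h₂ (by omega),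
      fun h => gradedInv_two_eq_bot M₁ M₂ hn hk₁ hka h₁ hk₂ h₂ (by omega)⟩
    have := isoAsSl_gradedInv_one_zero_zero M₁ M₂ hn (by omega) (by omega)
    rwa [show 2 * n - 1 = 1 by omega] at this
  · have e₁ := finrank_eq_of_isFU M₁ f₁
    have e₂ := finrank_eq_of_isFU M₂ f₂
    exact ⟨fun h => isoAsSl_gradedInv_one_zero_one M₁ M₂ hn (by omega) (by omega) (by omega)
      (Or.inl hn1) (by omega), fun h => gradedInv_one_zero_one_eq_bot M₁ M₂ hn (by omega) hb
      (by omega) (by omega), gradedInv_two_eq_bot M₁ M₂ hn hk₁ hka h₁ hk₂ h₂ (by omega)⟩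
  · have e₁ := finrank_eq_of_isFU M₁ f₁
    have e₂ := finrank_eq_of_isFU M₂ f₂
    exact ⟨fun h => IsoAsSl.gradedInv_comm M₂ M₁ (isoAsSl_gradedInv_one_zero_one M₂ M₁ hn
      (by omega) (by omega) (by omega) (Or.inl hn1) (by omega)),
      fun h => gradedInv_comm_eq_bot M₂ M₁ (gradedInv_one_zero_one_eq_bot M₂ M₁ hn (by omega) ha
      (by omega) (by omega)), gradedInv_two_eq_bot M₁ M₂ hn hk₁ hka h₁ hk₂ h₂ (by omega)⟩
  · have e₁ := finrank_eq_of_isFU M₁ f₁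
    have e₂ := finrank_eq_of_isFU M₂ f₂
    exact ⟨gradedInv_one_one_one_eq_bot M₁ M₂ hn1 (by omega) (by omega),
      fun h => isoAsSl_gradedInv_two_of_eq M₁ M₂ hn hk₁ hka h₁ h₂ (by omega),
      fun h => gradedInv_two_eq_bot M₁ M₂ hn hk₁ hka h₁ hk₂ h₂ (by omega)⟩

theorem socle_table_of_one_lt [FiniteDimensional F V₁] [FiniteDimensional F V₂] (hn1 : 1 < n)
    (w₁ : k₁ = 0 ∧ a₀ ≤ 1 ∨ k₁ = 1 ∧ a₀ = 1) (h₁ : a₁ + 2 * k₁ = 2 * n - 1 + a₀)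
    (w₂ : k₂ = 0 ∧ b₀ ≤ 1 ∨ k₂ = 1 ∧ b₀ = 1) (h₂ : b₁ + 2 * k₂ = 2 * n - 1 + b₀) :
    (a₀ ≤ 1 → IsFU (F := F) n V₁ a₀ (a₀ + (2 * n - 1)) →
      b₀ ≤ 1 → IsFU (F := F) n V₂ b₀ (b₀ + (2 * n - 1)) →
      IsoAsSl n (gradedInv M₁ M₂ 1) (Irr F (a₀ + b₀ + (2 * n - 1))) ∧
      (a₀ = b₀ → IsoAsSl n (gradedInv M₁ M₂ 2) (Irr F 0)) ∧
      (a₀ ≠ b₀ → gradedInv M₁ M₂ 2 = ⊥)) ∧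
    (a₀ ≤ 1 → IsFU (F := F) n V₁ a₀ (a₀ + (2 * n - 1)) → IsFU (F := F) n V₂ 1 (2 * n - 1 - 1) →
      (a₀ = 0 → IsoAsSl n (gradedInv M₁ M₂ 1) (Irr F (2 * n - 1 - 1))) ∧
      (a₀ ≠ 0 → gradedInv M₁ M₂ 1 = ⊥) ∧ gradedInv M₁ M₂ 2 = ⊥) ∧
    (IsFU (F := F) n V₁ 1 (2 * n - 1 - 1) → b₀ ≤ 1 → IsFU (F := F) n V₂ b₀ (b₀ + (2 * n - 1)) →
      (b₀ = 0 → IsoAsSl n (gradedInv M₁ M₂ 1) (Irr F (2 * n - 1 - 1))) ∧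
      (b₀ ≠ 0 → gradedInv M₁ M₂ 1 = ⊥) ∧ gradedInv M₁ M₂ 2 = ⊥) ∧
    (IsFU (F := F) n V₁ 1 (2 * n - 1 - 1) → IsFU (F := F) n V₂ 1 (2 * n - 1 - 1) →
      IsoAsSl n (gradedInv M₁ M₂ 1) (Irr F (2 * n - 1 - 2)) ∧
      IsoAsSl n (gradedInv M₁ M₂ 2) (Irr F 0)) := by
  have hn : 1 ≤ n := hn1.le
  have hk₁ : k₁ = 0 ∨ k₁ = 1 := by omega
  have hk₂ : k₂ = 0 ∨ k₂ = 1 := by omega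
  have hka : k₁ ≤ a₀ := by omega
  refine ⟨fun ha f₁ hb f₂ => ?_, fun ha f₁ f₂ => ?_, fun f₁ hb f₂ => ?_, fun f₁ f₂ => ?_⟩
  · have e₁ := finrank_eq_of_isFU M₁ f₁
    have e₂ := finrank_eq_of_isFU M₂ f₂
    exact ⟨isoAsSl_gradedInv_one_zero_zero M₁ M₂ hn (by omega) (by omega),
      fun h => isoAsSl_gradedInv_two_of_eq M₁ M₂ hn hk₁ hka h₁ h₂ (by omega),
      fun h => gradedInv_two_eq_bot M₁ M₂ hn hk₁ hka h₁ hk₂ h₂ (by omega)⟩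
  · have e₁ := finrank_eq_of_isFU M₁ f₁
    have e₂ := finrank_eq_of_isFU M₂ f₂
    exact ⟨fun h => isoAsSl_gradedInv_one_zero_one M₁ M₂ hn (by omega) (by omega) (by omega)
      (by omega) (by omega), fun h => gradedInv_one_zero_one_eq_bot M₁ M₂ hn (by omega)
      (by omega) (by omega) (by omega), gradedInv_two_eq_bot M₁ M₂ hn hk₁ hka h₁ hk₂ h₂ (by omega)⟩
  · have e₁ := finrank_eq_of_isFU M₁ f₁
    have e₂ := finrank_eq_of_isFU M₂ f₂
    exact ⟨fun h => IsoAsSl.gradedInv_comm M₂ M₁ (isoAsSl_gradedInv_one_zero_one M₂ M₁ hn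
      (by omega) (by omega) (by omega) (by omega) (by omega)),
      fun h => gradedInv_comm_eq_bot M₂ M₁ (gradedInv_one_zero_one_eq_bot M₂ M₁ hn (by omega)
      (by omega) (by omega) (by omega)), gradedInv_two_eq_bot M₁ M₂ hn hk₁ hka h₁ hk₂ h₂ (by omega)⟩
  · have e₁ := finrank_eq_of_isFU M₁ f₁
    have e₂ := finrank_eq_of_isFU M₂ f₂
    exact ⟨isoAsSl_gradedInv_one_one_one M₁ M₂ hn1 (by omega) (by omega) (by omega) (by omega),
      isoAsSl_gradedInv_two_of_eq M₁ M₂ hn hk₁ hka h₁ h₂ (by omega)⟩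

end Models
end UniserialTensor


theorem theorem4p8 {F : Type*} [Field F] [CharZero F] (n : ℕ) (hn : 1 ≤ n)
    (V₁ : Type*) [AddCommGroup V₁] [Module F V₁] [FiniteDimensional F V₁]
    [LieRingModule (SlHeis F n) V₁] [LieModule F (SlHeis F n) V₁]
    (V₂ : Type*) [AddCommGroup V₂] [Module F V₂] [FiniteDimensional F V₂]
    [LieRingModule (SlHeis F n) V₂] [LieModule F (SlHeis F n) V₂]
    (hV₁ : IsStandardFaithfulUniserial F n V₁) (hV₂ : IsStandardFaithfulUniserial F n V₂)
    (D₁ : SocleDecomposition F n V₁ 3) (D₂ : SocleDecomposition F n V₂ 3) :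
    let m : ℕ := 2 * n - 1
    let a : Fin 3 → ℕ := D₁.wt
    let b : Fin 3 → ℕ := D₂.wt
    let S : ℕ → Submodule F (V₁ ⊗[F] V₂) := gradedInvariants D₁ D₂
    -- `soc(V₁ ⊗ V₂) = S_0 ⊕ S_1 ⊕ S_2`
    ((socle F (SlHeis F n) (V₁ ⊗[F] V₂)).toSubmodule = ⨆ t : Fin 3, S t ∧
      iSupIndep (fun t : Fin 3 => S t)) ∧
    -- `S_0`
    (S 0 = Submodule.map₂ (TensorProduct.mk F V₁ V₂) (socle F (SlHeis F n) V₁).toSubmodule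
        (socle F (SlHeis F n) V₂).toSubmodule ∧
      IsoAsSl n (S 0) (⨁ k : Fin (min (a 0) (b 0) + 1), Irr F (a 0 + b 0 - 2 * (k : ℕ)))) ∧
    -- the rows and columns of the tables exhaust the possibilities for `V₁` and `V₂`
    (n = 1 →
      (IsFU (F := F) n V₁ (a 0) (a 0 + 1) ∨ 1 ≤ a 0 ∧ IsFU (F := F) n V₁ (a 0) (a 0 - 1)) ∧
      (IsFU (F := F) n V₂ (b 0) (b 0 + 1) ∨ 1 ≤ b 0 ∧ IsFU (F := F) n V₂ (b 0) (b 0 - 1))) ∧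
    (1 < n →
      (a 0 ≤ 1 ∧ IsFU (F := F) n V₁ (a 0) (a 0 + m) ∨ IsFU (F := F) n V₁ 1 (m - 1)) ∧
      (b 0 ≤ 1 ∧ IsFU (F := F) n V₂ (b 0) (b 0 + m) ∨ IsFU (F := F) n V₂ 1 (m - 1))) ∧
    -- the tables for `n = 1`
    (n = 1 →
      (IsFU (F := F) n V₁ (a 0) (a 0 + 1) → IsFU (F := F) n V₂ (b 0) (b 0 + 1) →
        IsoAsSl n (S 1) (Irr F (a 0 + b 0 + 1)) ∧
        (a 0 = b 0 → IsoAsSl n (S 2) (Irr F 0)) ∧ (a 0 ≠ b 0 → S 2 = ⊥)) ∧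
      (IsFU (F := F) n V₁ (a 0) (a 0 + 1) → 1 ≤ b 0 → IsFU (F := F) n V₂ (b 0) (b 0 - 1) →
        (a 1 ≤ b 0 → IsoAsSl n (S 1) (Irr F (b 0 - a 1))) ∧ (¬ a 1 ≤ b 0 → S 1 = ⊥) ∧
        S 2 = ⊥) ∧
      (1 ≤ a 0 → IsFU (F := F) n V₁ (a 0) (a 0 - 1) → IsFU (F := F) n V₂ (b 0) (b 0 + 1) →
        (b 1 ≤ a 0 → IsoAsSl n (S 1) (Irr F (a 0 - b 1))) ∧ (¬ b 1 ≤ a 0 → S 1 = ⊥) ∧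
        S 2 = ⊥) ∧
      (1 ≤ a 0 → IsFU (F := F) n V₁ (a 0) (a 0 - 1) →
        1 ≤ b 0 → IsFU (F := F) n V₂ (b 0) (b 0 - 1) →
        S 1 = ⊥ ∧
        (a 0 = b 0 → IsoAsSl n (S 2) (Irr F 0)) ∧ (a 0 ≠ b 0 → S 2 = ⊥))) ∧
    -- the tables for `n > 1`
    (1 < n →
      (a 0 ≤ 1 → IsFU (F := F) n V₁ (a 0) (a 0 + m) →
        b 0 ≤ 1 → IsFU (F := F) n V₂ (b 0) (b 0 + m) →
        IsoAsSl n (S 1) (Irr F (a 0 + b 0 + m)) ∧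
        (a 0 = b 0 → IsoAsSl n (S 2) (Irr F 0)) ∧ (a 0 ≠ b 0 → S 2 = ⊥)) ∧
      (a 0 ≤ 1 → IsFU (F := F) n V₁ (a 0) (a 0 + m) → IsFU (F := F) n V₂ 1 (m - 1) →
        (a 0 = 0 → IsoAsSl n (S 1) (Irr F (m - 1))) ∧ (a 0 ≠ 0 → S 1 = ⊥) ∧
        S 2 = ⊥) ∧
      (IsFU (F := F) n V₁ 1 (m - 1) → b 0 ≤ 1 → IsFU (F := F) n V₂ (b 0) (b 0 + m) →
        (b 0 = 0 → IsoAsSl n (S 1) (Irr F (m - 1))) ∧ (b 0 ≠ 0 → S 1 = ⊥) ∧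
        S 2 = ⊥) ∧
      (IsFU (F := F) n V₁ 1 (m - 1) → IsFU (F := F) n V₂ 1 (m - 1) →
        IsoAsSl n (S 1) (Irr F (m - 2)) ∧ IsoAsSl n (S 2) (Irr F 0))) ∧
    -- `S_2 ≃ V(0)` exactly when `V₁ ≃ V₂`, and then the socle is not multiplicity free
    (IsoAsSl n (S 2) (Irr F 0) ↔ Nonempty (V₁ ≃ₗ⁅F, SlHeis F n⁆ V₂)) ∧
    (¬ Nonempty (V₁ ≃ₗ⁅F, SlHeis F n⁆ V₂) → S 2 = ⊥) ∧
    (Nonempty (V₁ ≃ₗ⁅F, SlHeis F n⁆ V₂) →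
      ¬ MultiplicityFree n (socle F (SlHeis F n) (V₁ ⊗[F] V₂)).toSubmodule) := by
  obtain ⟨k₁, hk₁, hka, h₁, hw₁, M₁, hD₁⟩ := exists_standard_model hn hV₁ D₁
  obtain ⟨k₂, hk₂, hkb, h₂, hw₂, M₂, hD₂⟩ := exists_standard_model hn hV₂ D₂
  have hS : gradedInvariants D₁ D₂ = gradedInv M₁ M₂ :=
    funext fun t => gradedInvariants_eq M₁ M₂ D₁ D₂ hD₁ hD₂ t
  have hk₁' : k₁ ≤ 2 * n - 1 := by omega
  have hk₂' : k₂ ≤ 2 * n - 1 := by omega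
  -- Each `S_t` consists of invariants and is zero or a sum of modules `V(c)`, hence lies in the
  -- socle.
  have hsoc : ∀ t : Fin 3, gradedInv M₁ M₂ t ≤
      (socle F (SlHeis F n) (V₁ ⊗[F] V₂)).toSubmodule := by
    intro t
    fin_cases t
    · exact (isoAsSl_gradedInv_zero M₁ M₂ hn).directSum_le_socle
        (gradedInv_le_heisInvariants M₁ M₂ 0)
    · exact gradedInv_one_le_socle M₁ M₂ hn hk₁ hka h₁ hw₁ hk₂ hkb h₂ hw₂
    · by_cases h : k₁ = k₂ ∧ D₁.wt 0 = D₂.wt 0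
      · exact (isoAsSl_gradedInv_two_of_eq M₁ M₂ hn hk₁ hka h₁ h₂ h).le_socle
          (gradedInv_le_heisInvariants M₁ M₂ 2)
      · change gradedInv M₁ M₂ 2 ≤ _
        rw [gradedInv_two_eq_bot M₁ M₂ hn hk₁ hka h₁ hk₂ h₂ h]
        exact bot_le
  have hS2 := isoAsSl_gradedInv_two_of_eq M₁ M₂ hn hk₁ hka h₁ h₂
  have hS2' := gradedInv_two_eq_bot M₁ M₂ hn hk₁ hka h₁ hk₂ h₂
  have hiso := FUModel.nonempty_equiv_iff hn hk₁ h₁ hk₂ h₂ M₁ M₂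
  have hm₁ : ∀ {c₀ c₁ : ℕ}, D₁.wt 0 = c₀ → D₁.wt 1 = c₁ → IsFU (F := F) n V₁ c₀ c₁ := by
    rintro _ _ rfl rfl
    exact M₁.isFU
  have hm₂ : ∀ {c₀ c₁ : ℕ}, D₂.wt 0 = c₀ → D₂.wt 1 = c₁ → IsFU (F := F) n V₂ c₀ c₁ := by
    rintro _ _ rfl rfl
    exact M₂.isFU
  rw [hS]
  dsimp only
  refine ⟨⟨socle_tensor M₁ M₂ hn hsoc, iSupIndep_gradedInv M₁ M₂⟩,
    ⟨?_, isoAsSl_gradedInv_zero M₁ M₂ hn⟩, ?_, ?_, ?_, ?_, ?_, ?_, ?_⟩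
  · rw [M₁.socle_eq hn hk₁' hka h₁, M₂.socle_eq hn hk₂' hkb h₂]
    exact gradedInv_zero M₁ M₂ hn
  · intro hn1
    constructor
    · rcases hk₁ with h | h
      · exact Or.inl (hm₁ rfl (by omega))
      · exact Or.inr ⟨by omega, hm₁ rfl (by omega)⟩
    · rcases hk₂ with h | h
      · exact Or.inl (hm₂ rfl (by omega))
      · exact Or.inr ⟨by omega, hm₂ rfl (by omega)⟩
  · intro hn1
    constructor
    · rcases hw₁ hn1 with h | h
      · exact Or.inl ⟨h.2, hm₁ rfl (by omega)⟩
      · exact Or.inr (hm₁ h.2 (by omega))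
    · rcases hw₂ hn1 with h | h
      · exact Or.inl ⟨h.2, hm₂ rfl (by omega)⟩
      · exact Or.inr (hm₂ h.2 (by omega))
  · exact fun hn1 => socle_table_of_eq_one M₁ M₂ hn1 hk₁ hka h₁ hk₂ h₂
  · exact fun hn1 => socle_table_of_one_lt M₁ M₂ hn1 (hw₁ hn1) h₁ (hw₂ hn1) h₂
  · rw [hiso]
    refine ⟨fun h => ?_, hS2⟩
    by_contra h'
    exact h.ne_bot (hS2' h')
  · rw [hiso]
    exact hS2'
  · rw [hiso]
    exact fun h => not_multiplicityFree M₁ M₂ hn h.2 (hS2 h) hsoc
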